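/- Let $F$ be a non-archimedean local field of characteristic $0$, with ring of integers $\mathfrak{o}_F$, normalized valuation $\mathrm{val}_F$ (with $\mathrm{val}_F(0)=\infty$), residue field of cardinality $q$ and absolute value $|x|_F=q^{-\mathrm{val}_F(x)}$. Let $k\ge 1$ be an integer and $G=GL_k$. Let $A$ be the diagonal torus of $G$, $U$ the group of unipotent upper triangular matrices, $B=AU$, and $K=GL_k(\mathfrak{o}_F)$ with its Haar measure of total mass $1$. Fix a Haar measure $du$ on $U(F)$. For every $g\in G(F)$ fix a decomposition $g=a_B(g)u_B(g)k_B(g)$ with $a_B(g)\in A(F)$, $u_B(g)\in U(F)$, $k_B(g)\in K$. For $a=\mathrm{diag}(a_1,\dots,a_k)\in A(F)$ let $\delta_B(a)=\prod_{1\le i<j\le k}|a_i/a_j|_F$. Put $$\Xi^G(g)=\int_K\delta_B(a_B(\kappa g))^{1/2}\,d\kappa,\qquad \sigma(g)=\max\bigl(1,\log\|g\|\bigr),\qquad \|g\|=\max_{i,j}\max\bigl(|g_{i,j}|_F,|(g^{-1})_{i,j}|_F\bigr).$$ For an integer $c\ge1$ let $U(F)_c$ be the subgroup of all $u\in U(F)$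 such that $\mathrm{val}_F(u_{i,i+1})\ge -c$ for $i=1,\dots,k-1$. **Proposition 3.2.** For every $D\in\mathbb{R}$, every integer $c\geq 1$ and every $g\in G(F)$, the integral $$I(c,D,g)=\int_{U(F)_c}\Xi^G(ug)\,\sigma(ug)^D\,du$$ is (absolutely) convergent. Moreover, for every $D\in\mathbb{R}$ there exists $R\in\mathbb{R}$ (depending, for fixed $F$ and $k$, only on $D$), and for this $R$ and the chosen measure $du$ a constant $C>0$, such that $$I(c,D,g)\le C\,c^R\,\sigma(g)^R\,\delta_B(a_B(g))^{1/2}$$ for all integers $c\ge1$ and all $g\in G(F)$. -/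

import Mathlib

open MeasureTheory ValuativeRel
open scoped WithZero MatrixGroups

namespace HarishChandra

/-! Throughout, `F` is a non-archimedean local field and `k` is the size of the matrices. -/

section Field

variable {F : Type*} [Field F] [ValuativeRel F] [TopologicalSpace F] [IsNonarchimedeanLocalField F]

/-- The normalized valuation `val_F : F → ℤ ∪ {∞}`. The identification of the value group with
`ℤᵐ⁰` is the order-preserving one, so that elements of large valuation are small. -/
noncomputable def val (x : F) : WithTop ℤ :=
  open Classical in
  if x = 0 then ⊤ else
    ((-WithZero.log (IsNonarchimedeanLocalField.valueGroupWithZeroIsoInt F (valuation F x)) : ℤ) :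
      WithTop ℤ)

/-- The normalized absolute value `|x|_F = q ^ (-val_F x)`, `|0|_F = 0`, where `q` is the number of
elements of the residue field. -/
noncomputable def absF (x : F) : ℝ :=
  open Classical in
  if x = 0 then 0 else
    (Nat.card 𝓀[F] : ℝ) ^
      WithZero.log (IsNonarchimedeanLocalField.valueGroupWithZeroIsoInt F (valuation F x))

lemma val_neg (x : F) : val (-x) = val x := by
  by_cases hx : x = 0 <;> simp [val, hx, Valuation.map_neg]

lemma val_add (x y : F) : min (val x) (val y) ≤ val (x + y) := by
  by_cases hx : x = 0
  · simp [hx]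
  by_cases hy : y = 0
  · simp [hy]
  by_cases hxy : x + y = 0
  · simp [val, hxy]
  simp only [val, hx, hy, hxy, if_false]
  rw [← WithTop.coe_min, WithTop.coe_le_coe, min_neg_neg, neg_le_neg_iff]
  have hne : ∀ z : F, z ≠ 0 →
      IsNonarchimedeanLocalField.valueGroupWithZeroIsoInt F (valuation F z) ≠ 0 := by
    intro z hz
    simpa using hz
  rcases le_max_iff.mp ((valuation F).map_add x y) with h | h
  · exact le_max_of_le_left ((WithZero.log_le_log (hne _ hxy) (hne _ hx)).mpr
      ((map_le_map_iff (IsNonarchimedeanLocalField.valueGroupWithZeroIsoInt F)).mpr h))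
  · exact le_max_of_le_right ((WithZero.log_le_log (hne _ hxy) (hne _ hy)).mpr
      ((map_le_map_iff (IsNonarchimedeanLocalField.valueGroupWithZeroIsoInt F)).mpr h))

end Field

section Groups

variable (k : ℕ) (F : Type*) [Field F]

/-- `U(F)`: the group of unipotent upper triangular matrices. -/
def unipotent : Subgroup (GL (Fin k) F) where
  carrier := {u | (∀ i, u i i = 1) ∧ ∀ i j, j < i → u i j = 0}
  one_mem' := ⟨fun i => by simp, fun i j h => by simp [h.ne']⟩
  mul_mem' := by
    rintro u v ⟨hu1, hu2⟩ ⟨hv1, hv2⟩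
    constructor
    · intro i
      rw [Units.val_mul, Matrix.mul_apply, Finset.sum_eq_single i]
      · simp [hu1, hv1]
      · intro j _ hj
        rcases lt_or_gt_of_ne hj with h | h
        · rw [hu2 i j h, zero_mul]
        · rw [hv2 j i h, mul_zero]
      · simp
    · intro i j hij
      rw [Units.val_mul, Matrix.mul_apply]
      refine Finset.sum_eq_zero fun l _ => ?_
      rcases lt_or_ge l i with h | h
      · rw [hu2 i l h, zero_mul]
      · rw [hv2 l j (hij.trans_le h), mul_zero]
  inv_mem' := by
    rintro u ⟨hu1, hu2⟩
    have hT : (u : Matrix (Fin k) (Fin k) F).BlockTriangular id := fun i j h => hu2 i j h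
    have hI : ∀ i j, j < i → (u⁻¹ : GL (Fin k) F) i j = 0 := by
      intro i j h
      let := u.invertible
      have := Matrix.blockTriangular_inv_of_blockTriangular hT h
      rwa [← Matrix.coe_units_inv] at this
    refine ⟨fun i => ?_, hI⟩
    have h1 : ((u : Matrix (Fin k) (Fin k) F) * (u⁻¹ : GL (Fin k) F)) i i = 1 := by simp
    rw [Matrix.mul_apply, Finset.sum_eq_single i] at h1
    · simpa [hu1] using h1
    · intro j _ hj
      rcases lt_or_gt_of_ne hj with h | h
      · rw [hu2 i j h, zero_mul]
      · rw [hI j i h, mul_zero]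
    · simp

variable {k F}

/-- The coefficients just above the diagonal are additive on `U(F)`. -/
lemma superdiag_mul {u v : GL (Fin k) F} (hu : u ∈ unipotent k F) (hv : v ∈ unipotent k F)
    {i j : Fin k} (hij : (i : ℕ) + 1 = j) : (u * v) i j = u i j + v i j := by
  have hne : i ≠ j := by rintro rfl; omega
  rw [Units.val_mul, Matrix.mul_apply, Finset.sum_eq_add i j hne]
  · rw [hu.1, hv.1, one_mul, mul_one, add_comm]
  · rintro l - ⟨h1, h2⟩
    rcases lt_or_gt_of_ne h1 with h | h
    · rw [hu.2 i l h, zero_mul]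
    · have : j < l := by
        rw [Fin.lt_def] at h ⊢
        have := Fin.val_ne_of_ne h2
        omega
      rw [hv.2 l j this, mul_zero]
  · simp
  · simp

/-- The element of the diagonal torus `A(F)` with diagonal entries `a`. -/
def diagGL (a : Fin k → Fˣ) : GL (Fin k) F where
  val := Matrix.diagonal fun i => (a i : F)
  inv := Matrix.diagonal fun i => ((a i)⁻¹ : Fˣ)
  val_inv := by simp [Matrix.diagonal_mul_diagonal]
  inv_val := by simp [Matrix.diagonal_mul_diagonal]

end Groups

section Iwasawa

variable {k : ℕ} {F : Type*} [Field F] [ValuativeRel F]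

variable (k F) in
/-- `K = GL_k(𝔬_F)`, as a subgroup of `GL_k(F)`. -/
noncomputable def maxCompact : Subgroup (GL (Fin k) F) :=
  (Matrix.GeneralLinearGroup.map (n := Fin k) (𝒪[F]).subtype).range

/-- Clearing the first column by integral row operations. -/
lemma exists_clear_column {n : ℕ} (h : Matrix (Fin (n + 1)) (Fin (n + 1)) F) :
    ∃ κ : GL (Fin (n + 1)) 𝒪[F], ∀ i : Fin n,
      ((κ : Matrix (Fin (n + 1)) (Fin (n + 1)) 𝒪[F]).map (𝒪[F]).subtype * h) i.succ 0 = 0 := by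
  obtain ⟨j, hj⟩ := Finite.exists_max fun i => valuation F (h i 0)
  by_cases h0 : h j 0 = 0
  · refine ⟨1, fun i => ?_⟩
    have := hj i.succ
    rw [h0, map_zero, le_zero_iff, map_eq_zero] at this
    simpa [Matrix.map_one] using this
  have hint : ∀ i, h i 0 / h j 0 ∈ 𝒪[F] := fun i => by
    rw [Valuation.mem_integer_iff, map_div₀]
    exact div_le_one_of_le₀ (hj i) zero_le
  let s : Equiv.Perm (Fin (n + 1)) := Equiv.swap 0 j
  let w : Fin (n + 1) → 𝒪[F] := fun i => ⟨h (s i) 0 / h j 0, hint _⟩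
  let T : Matrix (Fin (n + 1)) (Fin (n + 1)) 𝒪[F] :=
    Matrix.of fun i l => if i = l then 1 else if l = 0 then -w i else 0
  have hT : T.det = 1 := by
    have hlow : T.transpose.BlockTriangular id := by
      intro a b hab
      have h1 : b ≠ a := ne_of_lt hab
      have h2 : a ≠ 0 := by rintro rfl; exact absurd hab (by simp)
      simp [T, h1, h2]
    rw [← Matrix.det_transpose, Matrix.det_of_isUpperTriangular hlow]
    simp [T]
  let P : Matrix (Fin (n + 1)) (Fin (n + 1)) 𝒪[F] := T.submatrix id s
  have hP : IsUnit P.det := by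
    rw [show P = T.submatrix id s from rfl, Matrix.det_permute', hT, mul_one]
    exact (Equiv.Perm.sign s).isUnit.map (Int.castRingHom 𝒪[F])
  refine ⟨Matrix.GeneralLinearGroup.mk'' P hP, fun i => ?_⟩
  have hs0 : s 0 = j := by simp [s]
  have hss : ∀ l, s (s l) = l := by simp [s]
  have hi : (i.succ : Fin (n + 1)) ≠ 0 := Fin.succ_ne_zero i
  change ∑ l, ((P i.succ l : 𝒪[F]) : F) * h l 0 = 0
  rw [← Equiv.sum_comp s]
  have : ∀ l, ((P i.succ (s l) : 𝒪[F]) : F) * h (s l) 0 =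
      (if i.succ = l then h (s l) 0 else 0) +
        (if l = 0 then -(h (s i.succ) 0 / h j 0) * h j 0 else 0) := by
    intro l
    simp only [P, Matrix.submatrix_apply, id, hss, T, Matrix.of_apply]
    by_cases h1 : i.succ = l
    · subst h1; simp [hi]
    · by_cases h2 : l = 0
      · subst h2; simp [hi, hs0, w]
      · simp [h1, h2]
  simp only [this, Finset.sum_add_distrib, Finset.sum_ite_eq, Finset.sum_ite_eq',
    Finset.mem_univ, if_true]
  field_simp
  ring

/-- Integral row operations bring a matrix to upper triangular form. -/
lemma exists_triangular : ∀ {n : ℕ} (h : Matrix (Fin n) (Fin n) F),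
    ∃ κ : GL (Fin n) 𝒪[F],
      ((κ : Matrix _ _ 𝒪[F]).map (𝒪[F]).subtype * h).BlockTriangular id := by
  intro n
  induction n with
  | zero => exact fun h => ⟨1, fun i => i.elim0⟩
  | succ n ih =>
    intro h
    obtain ⟨κ₁, h₁⟩ := exists_clear_column h
    set h' := (κ₁ : Matrix _ _ 𝒪[F]).map (𝒪[F]).subtype * h with hh'
    obtain ⟨κ₂, h₂⟩ := ih (h'.submatrix Fin.succ Fin.succ)
    let Q : Matrix (Fin (n + 1)) (Fin (n + 1)) 𝒪[F] :=
      Matrix.of (Fin.cons (Fin.cons 1 0) fun i => Fin.cons 0 ((κ₂ : Matrix _ _ 𝒪[F]) i))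
    have hQ : IsUnit Q.det := by
      rw [Matrix.det_succ_column_zero, Fin.sum_univ_succ, Finset.sum_eq_zero]
      · have : Q.submatrix (Fin.succAbove 0) Fin.succ = (κ₂ : Matrix _ _ 𝒪[F]) := by
          ext i j; simp [Q]
        rw [this]
        simp [Q]
      · intro i _
        simp [Q]
    refine ⟨Matrix.GeneralLinearGroup.mk'' Q hQ * κ₁, ?_⟩
    have e : ((Matrix.GeneralLinearGroup.mk'' Q hQ * κ₁ : GL (Fin (n + 1)) 𝒪[F]) :
        Matrix _ _ 𝒪[F]).map (𝒪[F]).subtype * h = Q.map (𝒪[F]).subtype * h' := by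
      rw [hh', ← Matrix.mul_assoc, ← Matrix.map_mul]; rfl
    rw [e]
    intro a b hab
    induction a using Fin.cases with
    | zero => exact absurd hab (by simp)
    | succ a =>
      rw [Matrix.mul_apply, Fin.sum_univ_succ]
      induction b using Fin.cases with
      | zero => simp [Q, h₁]
      | succ b =>
        have := h₂ (show id b < id a by simpa using hab)
        rw [Matrix.mul_apply] at this
        simpa [Q] using this

/-- The Iwasawa decomposition `GL_k(F) = A(F) U(F) K`. -/
theorem iwasawa (g : GL (Fin k) F) :
    ∃ a : Fin k → Fˣ, ∃ u ∈ unipotent k F, ∃ κ ∈ maxCompact k F, g = diagGL a * u * κ := by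
  obtain ⟨κ, hκ⟩ := exists_triangular ((g⁻¹ : GL (Fin k) F) : Matrix (Fin k) (Fin k) F)
  set κ' : GL (Fin k) F := Matrix.GeneralLinearGroup.map (𝒪[F]).subtype κ with hκ'
  have hT : ((κ' * g⁻¹ : GL (Fin k) F) : Matrix (Fin k) (Fin k) F).BlockTriangular id := hκ
  have hb : ((g * κ'⁻¹ : GL (Fin k) F) : Matrix (Fin k) (Fin k) F).BlockTriangular id := by
    let := (κ' * g⁻¹).invertible
    have := Matrix.blockTriangular_inv_of_blockTriangular hT
    rwa [← Matrix.coe_units_inv, mul_inv_rev, inv_inv] at this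
  set b : GL (Fin k) F := g * κ'⁻¹ with hb'
  have hne : ∀ i, b i i ≠ 0 := by
    have h1 : IsUnit (b : Matrix (Fin k) (Fin k) F).det :=
      (Matrix.isUnit_iff_isUnit_det _).mp b.isUnit
    rw [Matrix.det_of_isUpperTriangular hb] at h1
    exact fun i => (Finset.prod_ne_zero_iff.mp h1.ne_zero) i (Finset.mem_univ i)
  let a : Fin k → Fˣ := fun i => Units.mk0 (b i i) (hne i)
  have ent : ∀ i j, ((diagGL a)⁻¹ * b : GL (Fin k) F) i j = (b i i)⁻¹ * b i j := by
    intro i j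
    change (Matrix.diagonal (fun i => (((a i)⁻¹ : Fˣ) : F)) *
      (b : Matrix (Fin k) (Fin k) F)) i j = _
    rw [Matrix.diagonal_mul]
    simp [a]
  refine ⟨a, (diagGL a)⁻¹ * b, ⟨fun i => ?_, fun i j hij => ?_⟩, κ', ⟨κ, rfl⟩, ?_⟩
  · rw [ent, inv_mul_cancel₀ (hne i)]
  · rw [ent, hb hij, mul_zero]
  · simp [hb']

/-- The torus component `a_B(g)` in a chosen decomposition `g = a_B(g) u_B(g) k_B(g)` with
`a_B(g) ∈ A(F)`, `u_B(g) ∈ U(F)`, `k_B(g) ∈ K`. -/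
noncomputable def torusPart (g : GL (Fin k) F) : Fin k → Fˣ := (iwasawa g).choose

end Iwasawa

section Functions

variable {k : ℕ} {F : Type*} [Field F] [ValuativeRel F] [TopologicalSpace F]
  [IsNonarchimedeanLocalField F]

/-- The modulus `δ_B` on the diagonal torus: `δ_B(a) = |det (Ad(a) | Lie U)|_F`, that is, the product
of the `|a_i / a_j|_F` over the positive roots `i < j`. -/
noncomputable def modulus (a : Fin k → Fˣ) : ℝ :=
  ∏ i, ∏ j ∈ Finset.Ioi i, absF ((a i : F) / (a j : F))

/-- The height `‖g‖`, the supremum of the absolute values of the entries of `g` and `g⁻¹`. -/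
noncomputable def height (g : GL (Fin k) F) : ℝ :=
  ⨆ p : Fin k × Fin k, max (absF (g p.1 p.2)) (absF ((g⁻¹ : GL (Fin k) F) p.1 p.2))

/-- `σ(g) = sup(1, log ‖g‖)`. -/
noncomputable def sigma (g : GL (Fin k) F) : ℝ := max 1 (Real.log (height g))

variable (k F) in
/-- `U(F)_c`: the subgroup of the `u ∈ U(F)` with `val_F(u_{i,i+1}) ≥ -c` for all `i`. -/
def unipotentBounded (c : ℕ) : Subgroup (unipotent k F) where
  carrier := {u | ∀ i j : Fin k, (i : ℕ) + 1 = j →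
    ((-(c : ℤ) : ℤ) : WithTop ℤ) ≤ val ((u : GL (Fin k) F) i j)}
  one_mem' := by
    intro i j hij
    have hne : i ≠ j := by rintro rfl; omega
    simp [hne, val]
  mul_mem' := by
    intro u v hu hv i j hij
    rw [Subgroup.coe_mul, superdiag_mul u.2 v.2 hij]
    exact (le_min (hu i j hij) (hv i j hij)).trans (val_add _ _)
  inv_mem' := by
    intro u hu i j hij
    have hne : i ≠ j := by rintro rfl; omega
    have h := superdiag_mul u.2 (u⁻¹).2 hij
    rw [← Subgroup.coe_mul, mul_inv_cancel] at h
    have h0 : ((u⁻¹ : unipotent k F) : GL (Fin k) F) i j = -(u : GL (Fin k) F) i j := by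
      rw [eq_neg_iff_add_eq_zero, add_comm, ← h]
      simp [hne]
    rw [h0, val_neg]
    exact hu i j hij

instance : CompactSpace (maxCompact k F) := by
  refine (isCompact_iff_compactSpace (s := (maxCompact k F : Set (GL (Fin k) F)))).mp ?_
  rw [maxCompact, MonoidHom.coe_range]
  have : CompactSpace (Matrix (Fin k) (Fin k) 𝒪[F]) :=
    inferInstanceAs (CompactSpace (Fin k → Fin k → 𝒪[F]))
  have : T1Space F := by
    let := IsTopologicalAddGroup.rightUniformSpace F
    have := isUniformAddGroup_of_addCommGroup (G := F)
    infer_instance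
  have : T1Space (Matrix (Fin k) (Fin k) 𝒪[F]) :=
    inferInstanceAs (T1Space (Fin k → Fin k → 𝒪[F]))
  have : CompactSpace (GL (Fin k) 𝒪[F]) :=
    inferInstanceAs (CompactSpace (Matrix (Fin k) (Fin k) 𝒪[F])ˣ)
  refine isCompact_range ?_
  refine Continuous.units_map (M := Matrix (Fin k) (Fin k) 𝒪[F])
    (N := Matrix (Fin k) (Fin k) F) (((𝒪[F]).subtype.mapMatrix (m := Fin k)).toMonoidHom) ?_
  exact continuous_id.matrix_map continuous_subtype_val

variable [MeasurableSpace (GL (Fin k) F)] [BorelSpace (GL (Fin k) F)]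

/-- The Haar measure of total mass `1` on `K`. -/
noncomputable def haarK : Measure (maxCompact k F) :=
  Measure.haarMeasure (⊤ : TopologicalSpace.PositiveCompacts (maxCompact k F))

/-- The Harish-Chandra function `Ξ^G(g) = ∫_K δ_B(a_B(κ g))^{1/2} dκ`. -/
noncomputable def Xi (g : GL (Fin k) F) : ℝ :=
  ∫ κ : maxCompact k F, Real.sqrt (modulus (torusPart ((κ : GL (Fin k) F) * g))) ∂haarK

end Functions

end HarishChandra

set_option linter.unusedSectionVars false

/-! Write w for the longest Weyl element, K_n for `GL_n(𝔬_F)` and Y(x) for `revMinors x`. The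
quantity `δ_B(a_B(g))^{1/2}` has a closed form. Let M_i(g) be the largest absolute value of a
maximal minor of the rows ≥ i of g. It is invariant under K on the right, and upper triangular
matrices multiply it on the left by a product of their diagonal entries, so the Iwasawa
decomposition gives `δ_B(a_B(g))^{1/2} = |det g|^{(k+1)/2} / ∏ M_i(g)`. This is `sph g`
(`sqrt_modulus_torusPart`). Everything becomes an estimate of minors.

Upper bound for Ξ: `Ξ(g) ≤ C σ(g)^e sph(g)` for all g (`exists_Xi_le`), by induction on the size.
The Cartan decomposition reduces to diagonal g, ordered so that `sph` is smallest. Averaging over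
the corner K_n brings in Ξ of the smaller group and leaves only the last row of the element of K.
The remaining integral is a product of integrals of `1 / max(|z + u y|, δ)` over `𝔬_F`, each of size
`log δ⁻¹`, that is, of order σ(g).

The integral over `U(F)_c`: since w lies in K, `Ξ(ug) = Ξ(wug)`, and the bound leaves `σ(ug)^N |det
g|^{(k+1)/2} / Y(ug)` to integrate. The function 1/Y just fails to be integrable on `U(F)`, but two
neighbouring exponents can be handled. The integral of `Y(ug)^{-(1+s)}` over all of `U(F)` converges
and grows polynomially in 1/s (`exists_lintegral_revMinors_le`). For some fixed ε > 0 the integral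
of `Y(u)^{-1+ε}` over `U(F)_c` is at most exponential in c (`exists_setLIntegral_revMinors_le`).
Both are proved one row at a time, a Haar measure on U being a product of the measures for the first
row and for the remaining corner.

Both are combined by cutting at `log Y(u) = T` (`sigma_pow_mul_sph_le`). Below the cut, 1/Y(ug) is
comparable to its power with exponent `-(1 + 1/T)`, at the cost of a polynomial in T. Above the cut
there is a gain `exp(-εT/2)`. With T a large multiple of `c σ(g)` this gain beats every exponential
loss in c and σ(g), while polynomials in T are polynomials in `c σ(g)`
(`exists_setLIntegral_sph_le_of_bounds`). -/

namespace HarishChandra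

/-! ### The absolute value of F and its topology. -/

section LocalField

variable {F : Type*} [Field F] [ValuativeRel F] [TopologicalSpace F] [IsNonarchimedeanLocalField F]

variable (F) in
/-- The cardinality of the residue field, as a real number. -/
noncomputable def resCard : ℝ := (Nat.card 𝓀[F] : ℝ)

variable (F) in
lemma two_le_resCard : 2 ≤ resCard F := by
  have : 1 < Nat.card 𝓀[F] := Finite.one_lt_card
  have h : ((2 : ℕ) : ℝ) ≤ (Nat.card 𝓀[F] : ℝ) := Nat.cast_le.mpr this
  rw [resCard]; exact_mod_cast h

variable (F) in
lemma one_lt_resCard : 1 < resCard F := lt_of_lt_of_le one_lt_two (two_le_resCard F)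

variable (F) in
lemma resCard_pos : 0 < resCard F := one_pos.trans (one_lt_resCard F)

/-- The logarithm of the valuation to base `q`. -/
noncomputable def ordF (x : F) : ℤ :=
  WithZero.log (IsNonarchimedeanLocalField.valueGroupWithZeroIsoInt F (valuation F x))

lemma isoInt_valuation_ne_zero {x : F} (hx : x ≠ 0) :
    IsNonarchimedeanLocalField.valueGroupWithZeroIsoInt F (valuation F x) ≠ 0 := by
  simpa using hx

@[simp] lemma absF_zero : absF (0 : F) = 0 := by simp [absF]

lemma absF_of_ne_zero {x : F} (hx : x ≠ 0) : absF x = resCard F ^ ordF x := by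
  simp [absF, hx, resCard, ordF]

lemma absF_pos {x : F} (hx : x ≠ 0) : 0 < absF x := by
  rw [absF_of_ne_zero hx]; exact zpow_pos (resCard_pos F) _

lemma absF_nonneg (x : F) : 0 ≤ absF x := by
  by_cases hx : x = 0
  · simp [hx]
  · exact (absF_pos hx).le

@[simp] lemma absF_eq_zero {x : F} : absF x = 0 ↔ x = 0 := by
  refine ⟨fun h => ?_, fun h => by simp [h]⟩
  by_contra hx
  exact (absF_pos hx).ne' h

@[simp] lemma absF_mul (x y : F) : absF (x * y) = absF x * absF y := by
  by_cases hx : x = 0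
  · simp [hx]
  by_cases hy : y = 0
  · simp [hy]
  rw [absF_of_ne_zero hx, absF_of_ne_zero hy, absF_of_ne_zero (mul_ne_zero hx hy),
    ← zpow_add₀ (resCard_pos F).ne', ordF, map_mul, map_mul,
    WithZero.log_mul (isoInt_valuation_ne_zero hx) (isoInt_valuation_ne_zero hy)]
  rfl

@[simp] lemma absF_one : absF (1 : F) = 1 := by
  have h : absF (1 : F) * absF (1 : F) = absF (1 : F) * 1 := by rw [← absF_mul, mul_one, mul_one]
  exact mul_left_cancel₀ (absF_pos one_ne_zero).ne' h

variable (F) in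
/-- The absolute value as a homomorphism. -/
noncomputable def absHom : F →*₀ ℝ where
  toFun := absF
  map_zero' := absF_zero
  map_one' := absF_one
  map_mul' := absF_mul

@[simp] lemma absF_inv (x : F) : absF x⁻¹ = (absF x)⁻¹ := map_inv₀ (absHom F) x

@[simp] lemma absF_div (x y : F) : absF (x / y) = absF x / absF y := map_div₀ (absHom F) x y

lemma absF_prod {ι : Type*} (s : Finset ι) (f : ι → F) :
    absF (∏ i ∈ s, f i) = ∏ i ∈ s, absF (f i) := map_prod (absHom F) f s

@[simp] lemma absF_neg (x : F) : absF (-x) = absF x := by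
  by_cases hx : x = 0
  · simp [hx]
  · rw [absF_of_ne_zero hx, absF_of_ne_zero (neg_ne_zero.mpr hx), ordF, Valuation.map_neg]; rfl

lemma absF_le_iff {x y : F} : absF x ≤ absF y ↔ valuation F x ≤ valuation F y := by
  by_cases hx : x = 0
  · simp [hx, absF_nonneg]
  by_cases hy : y = 0
  · have := absF_pos hx
    simp [hx, hy, this]
  rw [absF_of_ne_zero hx, absF_of_ne_zero hy, zpow_le_zpow_iff_right₀ (one_lt_resCard F), ordF,
    ordF, WithZero.log_le_log (isoInt_valuation_ne_zero hx) (isoInt_valuation_ne_zero hy),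
    map_le_map_iff]

lemma absF_lt_iff {x y : F} : absF x < absF y ↔ valuation F x < valuation F y :=
  lt_iff_lt_of_le_iff_le absF_le_iff

lemma absF_le_one_iff {x : F} : absF x ≤ 1 ↔ x ∈ 𝒪[F] := by
  rw [← absF_one (F := F), absF_le_iff, map_one, Valuation.mem_integer_iff]

lemma absF_coe_le_one (x : 𝒪[F]) : absF (x : F) ≤ 1 := absF_le_one_iff.mpr x.2

lemma absF_add_le (x y : F) : absF (x + y) ≤ max (absF x) (absF y) := by
  rcases le_max_iff.mp ((valuation F).map_add x y) with h | h
  · exact le_max_of_le_left (absF_le_iff.mpr h)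
  · exact le_max_of_le_right (absF_le_iff.mpr h)

lemma absF_sub_le (x y : F) : absF (x - y) ≤ max (absF x) (absF y) := by
  rw [sub_eq_add_neg, ← absF_neg y]; exact absF_add_le _ _

lemma absF_sum_le {ι : Type*} (s : Finset ι) (f : ι → F) {r : ℝ} (hr : 0 ≤ r)
    (h : ∀ i ∈ s, absF (f i) ≤ r) : absF (∑ i ∈ s, f i) ≤ r := by
  classical
  induction s using Finset.induction_on with
  | empty => simpa using hr
  | insert a s ha ih =>
    rw [Finset.sum_insert ha]
    exact (absF_add_le _ _).trans (max_le (h a (by simp)) (ih fun i hi => h i (by simp [hi])))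

lemma absF_coe_unit (x : (𝒪[F])ˣ) : absF ((x : 𝒪[F]) : F) = 1 := by
  refine le_antisymm (absF_coe_le_one _) ?_
  have h : absF ((x : 𝒪[F]) : F) * absF (((x⁻¹ : (𝒪[F])ˣ) : 𝒪[F]) : F) = 1 := by
    rw [← absF_mul, ← Subring.coe_mul, ← Units.val_mul]; simp
  nlinarith [absF_coe_le_one ((x⁻¹ : (𝒪[F])ˣ) : 𝒪[F]), absF_nonneg ((x : 𝒪[F]) : F)]

lemma exists_absF_eq (n : ℤ) : ∃ x : F, x ≠ 0 ∧ absF x = resCard F ^ n := by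
  obtain ⟨x, hx⟩ := ValuativeRel.valuation_surjective
    ((IsNonarchimedeanLocalField.valueGroupWithZeroIsoInt F).symm (WithZero.exp n))
  have h0 : x ≠ 0 := by
    rintro rfl
    rw [map_zero, eq_comm, EmbeddingLike.map_eq_zero_iff] at hx
    exact WithZero.exp_ne_zero hx
  refine ⟨x, h0, ?_⟩
  rw [absF_of_ne_zero h0, ordF, hx]
  simp

lemma val_ge_iff {x : F} {c : ℕ} :
    (((-(c : ℤ) : ℤ)) : WithTop ℤ) ≤ val x ↔ absF x ≤ resCard F ^ c := by
  by_cases hx : x = 0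
  · subst hx
    simp [val, (pow_pos (resCard_pos F) c).le]
  · rw [absF_of_ne_zero hx, ← zpow_natCast, zpow_le_zpow_iff_right₀ (one_lt_resCard F)]
    simp only [val, hx, if_false, WithTop.coe_le_coe, neg_le_neg_iff]
    rfl

/-! ### Topology -/

lemma isOpen_absF_lt {r : F} (hr : r ≠ 0) : IsOpen {x : F | absF x < absF r} := by
  have h0 : {x : F | absF x < absF r} ∈ nhds (0 : F) := by
    refine (IsValuativeTopology.hasBasis_nhds_zero' F).mem_iff.mpr
      ⟨valuation F r, by simpa using hr, fun x hx => absF_lt_iff.mpr hx⟩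
  refine isOpen_iff_mem_nhds.mpr fun a ha => ?_
  have : (fun x => x - a) ⁻¹' {x : F | absF x < absF r} ∈ nhds a :=
    (continuous_id.sub continuous_const).continuousAt.preimage_mem_nhds (by simpa using h0)
  filter_upwards [this] with x hx
  have := absF_add_le (x - a) a
  rw [sub_add_cancel] at this
  exact this.trans_lt (max_lt hx ha)

lemma continuous_absF : Continuous (absF : F → ℝ) := by
  rw [continuous_iff_continuousAt]
  intro a
  rw [ContinuousAt, Metric.tendsto_nhds]
  intro ε hε
  obtain ⟨n, hn⟩ := exists_pow_lt_of_lt_one hε (inv_lt_one_of_one_lt₀ (one_lt_resCard F))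
  obtain ⟨r, hr0, hr⟩ := exists_absF_eq (F := F) (-(n : ℤ))
  have hr' : absF r < ε := by rw [hr, zpow_neg, zpow_natCast, ← inv_pow]; exact hn
  have : (fun x => x - a) ⁻¹' {x : F | absF x < absF r} ∈ nhds a :=
    (continuous_id.sub continuous_const).continuousAt.preimage_mem_nhds
      ((isOpen_absF_lt hr0).mem_nhds (by simpa using absF_pos hr0))
  filter_upwards [this] with x hx
  refine lt_of_le_of_lt ?_ hr'
  have hx' : absF (x - a) < absF r := hx
  rw [Real.dist_eq, abs_sub_le_iff]
  have h1 := absF_add_le (x - a) a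
  have h2 := absF_sub_le x (x - a)
  rw [sub_add_cancel] at h1
  rw [sub_sub_cancel] at h2
  have := absF_nonneg (x - a)
  have := absF_nonneg x
  have := absF_nonneg a
  constructor
  · rcases max_cases (absF (x - a)) (absF a) with h | h <;> linarith
  · rcases max_cases (absF x) (absF (x - a)) with h | h <;> linarith

lemma isCompact_absF_le (r : F) : IsCompact {x : F | absF x ≤ absF r} := by
  simpa only [absF_le_iff] using IsNonarchimedeanLocalField.isCompact_closedBall F (valuation F r)

instance : T2Space F := by
  let := IsTopologicalAddGroup.rightUniformSpace F
  have := isUniformAddGroup_of_addCommGroup (G := F)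
  infer_instance

/-- Makes the uniformity of F countably generated, hence F pseudometrizable. With σ-compactness this
gives second countability, on which the Borel structure of products relies. -/
lemma nhds_zero_eq_comap_absF : nhds (0 : F) = Filter.comap absF (nhds 0) := by
  refine le_antisymm ?_ ?_
  · rw [← Filter.tendsto_iff_comap]
    simpa using (continuous_absF (F := F)).tendsto 0
  · intro s hs
    obtain ⟨γ, hγ, h⟩ := (IsValuativeTopology.hasBasis_nhds_zero' F).mem_iff.mp hs
    obtain ⟨r, rfl⟩ := ValuativeRel.valuation_surjective γ
    have hr : r ≠ 0 := by simpa using hγ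
    exact ⟨Set.Iio (absF r), Iio_mem_nhds (absF_pos hr), fun x hx => h (absF_lt_iff.mp hx)⟩

lemma exists_absF_le (x : F) : ∃ n : ℕ, absF x ≤ resCard F ^ n :=
  (pow_unbounded_of_one_lt (absF x) (one_lt_resCard F)).imp fun _ h => h.le

instance : SigmaCompactSpace F := by
  choose r _ hr using fun n : ℕ => exists_absF_eq (F := F) n
  refine SigmaCompactSpace.of_countable (Set.range fun n : ℕ => {x : F | absF x ≤ absF (r n)})
    (Set.countable_range _) ?_ ?_
  · rintro _ ⟨n, rfl⟩
    exact isCompact_absF_le _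
  · refine Set.eq_univ_of_forall fun x => ?_
    obtain ⟨n, hn⟩ := exists_absF_le x
    exact ⟨_, ⟨n, rfl⟩, by simpa [hr] using hn⟩

instance : SecondCountableTopology F := by
  let := IsTopologicalAddGroup.rightUniformSpace F
  have := isUniformAddGroup_of_addCommGroup (G := F)
  have : (uniformity F).IsCountablyGenerated := by
    rw [uniformity_eq_comap_nhds_zero, nhds_zero_eq_comap_absF]
    infer_instance
  let := UniformSpace.pseudoMetricSpace F
  infer_instance

end LocalField

/-! ### Haar measure on F: measure of balls and effect of scaling. -/

section FieldMeasure

open scoped ENNReal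

variable {F : Type*} [Field F] [ValuativeRel F] [TopologicalSpace F] [IsNonarchimedeanLocalField F]

lemma absF_lt_one_iff {x : F} : absF x < 1 ↔ absF x ≤ (resCard F)⁻¹ := by
  refine ⟨fun h => ?_, fun h => h.trans_lt (inv_lt_one_of_one_lt₀ (one_lt_resCard F))⟩
  by_cases hx : x = 0
  · simp [hx, (resCard_pos F).le]
  · rw [absF_of_ne_zero hx] at h ⊢
    rw [← zpow_neg_one]
    rw [← zpow_zero (resCard F), zpow_lt_zpow_iff_right₀ (one_lt_resCard F)] at h
    exact zpow_le_zpow_right₀ (one_lt_resCard F).le (by omega)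

lemma residue_eq_zero_iff_absF {x : 𝒪[F]} : IsLocalRing.residue 𝒪[F] x = 0 ↔ absF (x : F) < 1 := by
  rw [IsLocalRing.residue_eq_zero_iff, IsLocalRing.mem_maximalIdeal, mem_nonunits_iff]
  constructor
  · intro h
    refine lt_of_le_of_ne (absF_coe_le_one x) fun h1 => h ?_
    have hx : (x : F) ≠ 0 := by
      intro h0; rw [h0, absF_zero] at h1; exact zero_ne_one h1
    have hi : (x : F)⁻¹ ∈ 𝒪[F] := by rw [← absF_le_one_iff, absF_inv, h1, inv_one]
    exact IsUnit.of_mul_eq_one ⟨(x : F)⁻¹, hi⟩ (Subtype.ext (mul_inv_cancel₀ hx))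
  · rintro h ⟨u, rfl⟩
    exact h.ne (absF_coe_unit u)

lemma exists_zpow_le {r : ℝ} (hr : 0 < r) :
    ∃ n : ℤ, resCard F ^ n ≤ r ∧ r < resCard F ^ (n + 1) :=
  exists_mem_Ico_zpow hr (one_lt_resCard F)

variable [MeasurableSpace F] [BorelSpace F]

variable (F) in
/-- The Haar measure on `F` giving the ring of integers mass `1`. -/
noncomputable def haarF : Measure F :=
  Measure.addHaarMeasure ⟨⟨{x : F | absF x ≤ absF (1 : F)}, isCompact_absF_le 1⟩,
    ⟨0, mem_interior.mpr ⟨{x : F | absF x < absF (1 : F)}, fun _ h => le_of_lt (α := ℝ) h,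
      isOpen_absF_lt one_ne_zero, by simp⟩⟩⟩

instance : (haarF F).IsAddHaarMeasure := by unfold haarF; infer_instance

lemma haarF_unitBall : haarF F {x : F | absF x ≤ 1} = 1 := by
  have := Measure.addHaarMeasure_self (K₀ := (⟨⟨{x : F | absF x ≤ absF (1 : F)},
    isCompact_absF_le 1⟩, ⟨0, mem_interior.mpr ⟨{x : F | absF x < absF (1 : F)},
      fun _ h => le_of_lt (α := ℝ) h, isOpen_absF_lt one_ne_zero, by simp⟩⟩⟩ :
        TopologicalSpace.PositiveCompacts F))
  simpa [haarF] using this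

lemma measurableSet_absF_le (r : ℝ) : MeasurableSet {x : F | absF x ≤ r} :=
  (isClosed_le continuous_absF continuous_const).measurableSet

/-- The unit ball is the disjoint union of q translates of the maximal ideal, one for each residue
class. -/
lemma haarF_inv_resCard : haarF F {x : F | absF x ≤ (resCard F)⁻¹} = ENNReal.ofReal (resCard F)⁻¹ := by
  classical
  have := Fintype.ofFinite 𝓀[F]
  choose l hl using IsLocalRing.residue_surjective (R := 𝒪[F])
  have hU : {x : F | absF x ≤ 1} =
      ⋃ k : 𝓀[F], (fun y => y + -(l k : F)) ⁻¹' {x : F | absF x ≤ (resCard F)⁻¹} := by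
    ext y
    simp only [Set.mem_ofPred_eq, Set.mem_iUnion, Set.mem_preimage, ← absF_lt_one_iff]
    constructor
    · intro hy
      refine ⟨IsLocalRing.residue _ ⟨y, absF_le_one_iff.mp hy⟩, ?_⟩
      have := (residue_eq_zero_iff_absF (x := ⟨y, absF_le_one_iff.mp hy⟩ -
        l (IsLocalRing.residue _ ⟨y, absF_le_one_iff.mp hy⟩))).mp (by rw [map_sub, hl, sub_self])
      simpa [sub_eq_add_neg] using this
    · rintro ⟨k, hk⟩
      have := absF_add_le (y + -(l k : F)) (l k : F)
      rw [neg_add_cancel_right] at this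
      exact this.trans (max_le hk.le (absF_coe_le_one _))
  have hd : Pairwise (Function.onFun Disjoint fun k : 𝓀[F] =>
      (fun y => y + -(l k : F)) ⁻¹' {x : F | absF x ≤ (resCard F)⁻¹}) := by
    intro k k' hkk
    rw [Function.onFun, Set.disjoint_left]
    intro y hy hy'
    simp only [Set.mem_ofPred_eq, Set.mem_preimage, ← absF_lt_one_iff] at hy hy'
    refine hkk ?_
    rw [← hl k, ← hl k', ← sub_eq_zero, ← map_sub, residue_eq_zero_iff_absF]
    have := absF_sub_le (y + -(l k' : F)) (y + -(l k : F))
    have e : (y + -(l k' : F)) - (y + -(l k : F)) = ((l k - l k' : 𝒪[F]) : F) := by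
      push_cast; ring
    rw [e] at this
    exact this.trans_lt (max_lt hy' hy)
  have hm : haarF F {x : F | absF x ≤ 1} =
      ENNReal.ofReal (resCard F) * haarF F {x : F | absF x ≤ (resCard F)⁻¹} := by
    rw [hU, measure_iUnion hd fun k => (measurable_add_const _) (measurableSet_absF_le _)]
    simp only [measure_preimage_add_right, tsum_fintype, Finset.sum_const, Finset.card_univ,
      nsmul_eq_mul, resCard, Nat.card_eq_fintype_card, ENNReal.ofReal_natCast]
  rw [haarF_unitBall] at hm
  rw [ENNReal.ofReal_inv_of_pos (resCard_pos F)]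
  exact ENNReal.eq_inv_of_mul_eq_one_left (by rw [mul_comm]; exact hm.symm)

/-- The image of Haar measure under a scaling is again a Haar measure, so a multiple of the original
one; the factor is read off on the unit ball. -/
lemma map_mul_left_haarF_eq_measure_smul {a : F} (ha : a ≠ 0) :
    (haarF F).map (a * ·) = haarF F {x | absF x ≤ (absF a)⁻¹} • haarF F := by
  have h1 : ((haarF F).map (a * ·)).IsAddHaarMeasure :=
    Measure.isAddHaarMeasure_map (haarF F) (AddMonoidHom.mulLeft a) (continuous_const_mul a)
      (mul_left_surjective₀ ha) (Homeomorph.mulLeft₀ a ha).isClosedEmbedding.tendsto_cocompact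
  obtain ⟨c, h2⟩ : ∃ c : NNReal, (haarF F).map (a * ·) = c • haarF F :=
    ⟨_, Measure.isAddLeftInvariant_eq_smul _ _⟩
  have h3 : haarF F {x | absF x ≤ (absF a)⁻¹} =
      ((haarF F).map (a * ·)) {x | absF x ≤ 1} := by
    rw [Measure.map_apply (measurable_const_mul a) (measurableSet_absF_le _)]
    congr 1
    ext x
    simp only [Set.mem_ofPred_eq, Set.mem_preimage, absF_mul]
    rw [← mul_one (absF a)⁻¹, le_inv_mul_iff₀ (absF_pos ha)]
  rw [h3, h2, Measure.smul_apply, haarF_unitBall]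
  rw [ENNReal.smul_def c (1 : ENNReal), smul_eq_mul, mul_one]
  rfl

/-- The scaling factor is multiplicative in `a` and equals 1 on units, so its value at one element
of absolute value q determines it. -/
lemma haarF_absF_le_inv (a : F) (ha : a ≠ 0) :
    haarF F {x | absF x ≤ (absF a)⁻¹} = ENNReal.ofReal (absF a)⁻¹ := by
  have hmul : ∀ a b : F, a ≠ 0 → b ≠ 0 → haarF F {x | absF x ≤ (absF (a * b))⁻¹} =
      haarF F {x | absF x ≤ (absF a)⁻¹} * haarF F {x | absF x ≤ (absF b)⁻¹} := by
    intro a b ha hb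
    have h1 := map_mul_left_haarF_eq_measure_smul (mul_ne_zero ha hb)
    have h2 : (haarF F).map (a * b * ·) = ((haarF F).map (b * ·)).map (a * ·) := by
      rw [Measure.map_map (measurable_const_mul a) (measurable_const_mul b)]
      congr 1
      ext x
      simp [mul_assoc]
    rw [h2, map_mul_left_haarF_eq_measure_smul hb, Measure.map_smul,
      map_mul_left_haarF_eq_measure_smul ha, smul_smul] at h1
    have h3 := congrArg (fun ν => ν {x : F | absF x ≤ 1}) h1
    simp only [Measure.smul_apply, haarF_unitBall, smul_eq_mul, mul_one] at h3
    rw [← h3, mul_comm]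
  obtain ⟨p, hp0, hp⟩ := exists_absF_eq (F := F) 1
  rw [zpow_one] at hp
  have hpow : ∀ n : ℕ, haarF F {x | absF x ≤ (resCard F ^ n)⁻¹} =
      ENNReal.ofReal (resCard F ^ n)⁻¹ := by
    intro n
    induction n with
    | zero => simpa using haarF_unitBall
    | succ n ih =>
      have hn : absF (p ^ n) = resCard F ^ n := by
        rw [← hp]; exact map_pow (absHom F) p n
      have := hmul (p ^ n) p (pow_ne_zero _ hp0) hp0
      rw [absF_mul, hn, hp, ih, haarF_inv_resCard] at this
      rw [pow_succ, this, ← ENNReal.ofReal_mul (by have := resCard_pos F; positivity), mul_inv]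
  rcases Int.eq_nat_or_neg (ordF a) with ⟨n, hn | hn⟩
  · rw [absF_of_ne_zero ha, hn, zpow_natCast, hpow]
  · have ha' : absF a⁻¹ = resCard F ^ n := by
      rw [absF_inv, absF_of_ne_zero ha, hn, zpow_neg, inv_inv, zpow_natCast]
    have := hmul a a⁻¹ ha (inv_ne_zero ha)
    rw [mul_inv_cancel₀ ha, absF_one, inv_one, haarF_unitBall, ha', hpow] at this
    rw [ENNReal.eq_inv_of_mul_eq_one_left this.symm, absF_of_ne_zero ha, hn, zpow_neg, inv_inv,
      ← ENNReal.ofReal_inv_of_pos (by have := resCard_pos F; positivity), inv_inv, zpow_natCast]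

lemma haarF_absF_le_zpow (n : ℤ) :
    haarF F {x | absF x ≤ resCard F ^ n} = ENNReal.ofReal (resCard F ^ n) := by
  obtain ⟨a, ha, h⟩ := exists_absF_eq (F := F) (-n)
  simpa [h] using haarF_absF_le_inv a ha

lemma map_mul_left_haarF {a : F} (ha : a ≠ 0) :
    (haarF F).map (a * ·) = ENNReal.ofReal (absF a)⁻¹ • haarF F := by
  rw [map_mul_left_haarF_eq_measure_smul ha, haarF_absF_le_inv a ha]

/-- Only an inequality, because an arbitrary radius has to be rounded down to a power of q. -/
lemma haarF_absF_sub_le (c : F) (r : ℝ) (hr : 0 < r) :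
    haarF F {x | absF (x - c) ≤ r} ≤ ENNReal.ofReal r := by
  have h1 : {x : F | absF (x - c) ≤ r} = (fun x => x + -c) ⁻¹' {x | absF x ≤ r} := by
    ext x; simp [sub_eq_add_neg]
  rw [h1, measure_preimage_add_right]
  obtain ⟨n, hn, hn'⟩ := exists_zpow_le (F := F) hr
  refine (measure_mono fun x hx => ?_).trans
    ((haarF_absF_le_zpow n).le.trans (ENNReal.ofReal_le_ofReal hn))
  by_cases h0 : x = 0
  · subst h0
    simpa using (zpow_pos (resCard_pos F) n).le
  · have hx' : absF x ≤ r := hx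
    change absF x ≤ _
    rw [absF_of_ne_zero h0] at hx' ⊢
    have := (zpow_lt_zpow_iff_right₀ (one_lt_resCard F)).mp (hx'.trans_lt hn')
    exact zpow_le_zpow_right₀ (one_lt_resCard F).le (by omega)

end FieldMeasure

/-! ### Integrals in one variable with explicit dependence on the exponent and the cut-off. -/

section FieldIntegrals

variable {F : Type*} [Field F] [ValuativeRel F] [TopologicalSpace F] [IsNonarchimedeanLocalField F]

lemma exists_inv_le_pow {δ : ℝ} (h0 : 0 < δ) (h1 : δ ≤ 1) :
    ∃ M : ℕ, δ⁻¹ ≤ resCard F ^ M ∧ (M : ℝ) ≤ 1 + 2 * Real.log δ⁻¹ := by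
  -- As q ≥ 2, `log q ≥ 1/2`. This makes the bound on M independent of q.
  have hlq : (1 / 2 : ℝ) ≤ Real.log (resCard F) := by
    have := Real.log_two_gt_d9
    have := Real.log_le_log (by norm_num) (two_le_resCard F)
    linarith
  have hl : 0 ≤ Real.log δ⁻¹ := Real.log_nonneg ((one_le_inv₀ h0).mpr h1)
  refine ⟨⌈Real.log δ⁻¹ / Real.log (resCard F)⌉₊, ?_, ?_⟩
  · rw [← Real.rpow_natCast, ← Real.log_le_log_iff (by positivity)
      (Real.rpow_pos_of_pos (resCard_pos F) _), Real.log_rpow (resCard_pos F)]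
    exact (div_le_iff₀ (by linarith)).mp (Nat.le_ceil _)
  · have := (Nat.ceil_lt_add_one (div_nonneg hl (by linarith : 0 ≤ Real.log (resCard F)))).le
    refine this.trans ?_
    rw [add_comm]
    gcongr
    rw [div_le_iff₀ (by linarith)]
    nlinarith

variable [MeasurableSpace F] [BorelSpace F]

lemma measurable_absF : Measurable (absF : F → ℝ) := continuous_absF.measurable

/-- The shell of radius q^n has measure at most q^n and the integrand there is q^{-n(1+s)}, so a
geometric series of ratio q^{-s} majorizes the integral. The growth as 1/s matters: later 1/s is
proportional to `c σ(g)`. -/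
lemma lintegral_max_one_rpow_le {s : ℝ} (hs : 0 < s) (hs1 : s ≤ 1) :
    ∫⁻ y : F, ENNReal.ofReal (max 1 (absF y) ^ (-(1 + s))) ∂haarF F ≤ ENNReal.ofReal (2 / s) := by
  have hq := one_lt_resCard F
  have hq0 := resCard_pos F
  have hpt : ∀ y : F, ENNReal.ofReal (max 1 (absF y) ^ (-(1 + s))) ≤
      ∑' n : ℕ, {y : F | absF y ≤ resCard F ^ (n : ℤ)}.indicator
        (fun _ => ENNReal.ofReal ((resCard F ^ (n : ℤ)) ^ (-(1 + s)))) y := by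
    intro y
    obtain ⟨n, hn⟩ : ∃ n : ℕ, max 1 (absF y) = resCard F ^ (n : ℤ) := by
      rcases le_or_gt (absF y) 1 with h | h
      · exact ⟨0, by simp [h]⟩
      · have hy : y ≠ 0 := by rintro rfl; simp at h; linarith
        rw [max_eq_right h.le, absF_of_ne_zero hy]
        rw [absF_of_ne_zero hy, ← zpow_zero (resCard F), zpow_lt_zpow_iff_right₀ hq] at h
        exact ⟨(ordF y).toNat, by rw [Int.toNat_of_nonneg h.le]⟩
    refine le_trans ?_ (ENNReal.le_tsum n)
    rw [Set.indicator_of_mem, hn]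
    change absF y ≤ _
    rw [← hn]
    exact le_max_right _ _
  refine (lintegral_mono hpt).trans ?_
  rw [lintegral_tsum fun n => (measurable_const.indicator (measurableSet_absF_le _)).aemeasurable]
  have hterm : ∀ n : ℕ, ∫⁻ y : F, {y : F | absF y ≤ resCard F ^ (n : ℤ)}.indicator
        (fun _ => ENNReal.ofReal ((resCard F ^ (n : ℤ)) ^ (-(1 + s)))) y ∂haarF F =
      (ENNReal.ofReal (resCard F ^ (-s))) ^ n := by
    intro n
    rw [lintegral_indicator_const (measurableSet_absF_le _), haarF_absF_le_zpow,
      ← ENNReal.ofReal_mul (by positivity), ← ENNReal.ofReal_pow (by positivity)]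
    congr 1
    rw [zpow_natCast]
    nth_rewrite 2 [← Real.rpow_one (resCard F ^ n)]
    rw [← Real.rpow_add (by positivity), ← Real.rpow_natCast, ← Real.rpow_natCast,
      ← Real.rpow_mul hq0.le, ← Real.rpow_mul hq0.le]
    ring_nf
  simp only [hterm]
  rw [ENNReal.tsum_geometric, ← ENNReal.ofReal_one,
    ← ENNReal.ofReal_sub _ (by positivity)]
  -- Bernoulli's inequality for `2^{-s} = (1 - 1/2)^s`.
  have h2 : resCard F ^ (-s) ≤ 1 - s / 2 := by
    calc resCard F ^ (-s) ≤ (2 : ℝ) ^ (-s) :=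
          Real.rpow_le_rpow_of_nonpos (by norm_num) (two_le_resCard F) (by linarith)
      _ = (1 + (-1 / 2)) ^ s := by rw [Real.rpow_neg (by norm_num), ← Real.inv_rpow (by norm_num)]; norm_num
      _ ≤ 1 + s * (-1 / 2) := rpow_one_add_le_one_add_mul_self (by norm_num) hs.le hs1
      _ = 1 - s / 2 := by ring
  rw [← ENNReal.ofReal_inv_of_pos (by linarith)]
  refine ENNReal.ofReal_le_ofReal ?_
  rw [inv_le_comm₀ (by linarith) (by positivity), inv_div]
  linarith

/-- Each scale q^{-n} with 0 ≤ n ≤ M, where q^M ≥ δ⁻¹, contributes at most q^n · q^{-n} = 1, and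
there are O(log δ⁻¹) scales. This logarithm is the source of the powers of σ in the bound for Ξ. -/
lemma lintegral_inv_max_le {z u : F} (hz : absF z ≤ 1) (hu : absF u = 1) {δ : ℝ} (h0 : 0 < δ)
    (h1 : δ ≤ 1) :
    ∫⁻ y in {y : F | absF y ≤ 1}, ENNReal.ofReal (max (absF (z + u * y)) δ)⁻¹ ∂haarF F ≤
      ENNReal.ofReal (2 + 2 * Real.log δ⁻¹) := by
  have hq := one_lt_resCard F
  have hq0 := resCard_pos F
  have hu0 : u ≠ 0 := by rintro rfl; simp at hu
  obtain ⟨M, hM, hM'⟩ := exists_inv_le_pow (F := F) h0 h1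
  have hset : ∀ r : ℝ, {y : F | absF (z + u * y) ≤ r} = {y : F | absF (y - (-z / u)) ≤ r} := by
    intro r
    ext y
    have : z + u * y = u * (y - (-z / u)) := by field_simp; ring
    simp only [Set.mem_ofPred_eq, this, absF_mul, hu, one_mul]
  have hmeas : ∀ r : ℝ, MeasurableSet {y : F | absF (z + u * y) ≤ r} := fun r =>
    (isClosed_le (continuous_absF.comp (by fun_prop)) continuous_const).measurableSet
  have hpt : ∀ y ∈ {y : F | absF y ≤ 1}, ENNReal.ofReal (max (absF (z + u * y)) δ)⁻¹ ≤
      ∑ n ∈ Finset.range (M + 1), {y : F | absF (z + u * y) ≤ resCard F ^ (-(n : ℤ))}.indicator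
        (fun _ => ENNReal.ofReal (resCard F ^ n)) y := by
    intro y hy
    have hx1 : absF (z + u * y) ≤ 1 := (absF_add_le _ _).trans
      (max_le hz (by rw [absF_mul, hu, one_mul]; exact hy))
    obtain ⟨n, hn, hle, hge⟩ : ∃ n : ℕ, n < M + 1 ∧ absF (z + u * y) ≤ resCard F ^ (-(n : ℤ)) ∧
        (max (absF (z + u * y)) δ)⁻¹ ≤ resCard F ^ n := by
      rcases le_or_gt (absF (z + u * y)) (resCard F ^ (-(M : ℤ))) with h | h
      · refine ⟨M, M.lt_succ_self, h, ?_⟩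
        exact (inv_anti₀ h0 (le_max_right _ _)).trans hM
      · have hx : z + u * y ≠ 0 := by
          intro h0; rw [h0, absF_zero] at h
          exact (h.trans (zpow_pos hq0 _)).false
        rw [absF_of_ne_zero hx] at h hx1
        rw [zpow_lt_zpow_iff_right₀ hq] at h
        rw [← zpow_zero (resCard F), zpow_le_zpow_iff_right₀ hq] at hx1
        refine ⟨(-ordF (z + u * y)).toNat, by omega, ?_, ?_⟩
        · rw [absF_of_ne_zero hx, Int.toNat_of_nonneg (by omega), neg_neg]
        · refine (inv_anti₀ (absF_pos hx) (le_max_left _ _)).trans ?_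
          rw [absF_of_ne_zero hx, ← zpow_natCast, Int.toNat_of_nonneg (by omega), zpow_neg]
    refine le_trans ?_ (Finset.single_le_sum (fun _ _ => zero_le) (Finset.mem_range.mpr hn))
    rw [Set.indicator_of_mem (by exact hle)]
    exact ENNReal.ofReal_le_ofReal hge
  refine (setLIntegral_mono' (measurableSet_absF_le _) hpt).trans ?_
  refine (setLIntegral_le_lintegral _ _).trans ?_
  rw [lintegral_finsetSum _ fun n _ => measurable_const.indicator (hmeas _)]
  have : ∀ n ∈ Finset.range (M + 1), ∫⁻ y : F,
      {y : F | absF (z + u * y) ≤ resCard F ^ (-(n : ℤ))}.indicator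
        (fun _ => ENNReal.ofReal (resCard F ^ n)) y ∂haarF F ≤ 1 := by
    intro n _
    rw [lintegral_indicator_const (hmeas _), hset]
    refine (mul_le_mul_right (haarF_absF_sub_le _ _ (zpow_pos hq0 _)) _).trans ?_
    rw [← ENNReal.ofReal_mul (by positivity), zpow_neg, zpow_natCast,
      mul_inv_cancel₀ (by positivity), ENNReal.ofReal_one]
  refine (Finset.sum_le_sum this).trans ?_
  rw [Finset.sum_const, Finset.card_range, nsmul_eq_mul, mul_one, ← ENNReal.ofReal_natCast]
  refine ENNReal.ofReal_le_ofReal ?_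
  push_cast
  linarith

/-- The exponent `-1 + η` is not integrable on F, so the ball is needed. Where `max 1 |y| ≤ r` the
integrand is at most r^{2η} times an integrable power. Elsewhere it is at most r^{-1+η}, on a ball
of measure at most r. The centre is arbitrary. -/
lemma lintegral_ball_max_one_rpow_le (c : F) {r η : ℝ} (hr : 1 ≤ r) (h0 : 0 < η) (h1 : η ≤ 1) :
    ∫⁻ y in {y : F | absF (y - c) ≤ r}, ENNReal.ofReal (max 1 (absF y) ^ (-1 + η)) ∂haarF F ≤
      ENNReal.ofReal ((2 / η + 1) * r ^ (2 * η)) := by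
  have hr0 : 0 < r := by linarith
  have hms : MeasurableSet {y : F | absF (y - c) ≤ r} :=
    (isClosed_le (continuous_absF.comp (by fun_prop)) continuous_const).measurableSet
  have hpt : ∀ y ∈ {y : F | absF (y - c) ≤ r}, ENNReal.ofReal (max 1 (absF y) ^ (-1 + η)) ≤
      ENNReal.ofReal (r ^ (2 * η)) * ENNReal.ofReal (max 1 (absF y) ^ (-(1 + η))) +
      ENNReal.ofReal (r ^ (-1 + η)) := by
    intro y _
    have hm : 0 < max 1 (absF y) := by positivity
    rw [← ENNReal.ofReal_mul (by positivity), ← ENNReal.ofReal_add (by positivity) (by positivity)]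
    refine ENNReal.ofReal_le_ofReal ?_
    rcases le_or_gt (max 1 (absF y)) r with h | h
    · refine le_add_of_le_of_nonneg ?_ (by positivity)
      rw [show -1 + η = 2 * η + -(1 + η) by ring, Real.rpow_add hm]
      gcongr
    · refine le_add_of_nonneg_of_le (by positivity) ?_
      exact Real.rpow_le_rpow_of_nonpos hr0 h.le (by linarith)
  refine (setLIntegral_mono' hms hpt).trans ?_
  rw [lintegral_add_right _ measurable_const, setLIntegral_const]
  have e1 : ∫⁻ y in {y : F | absF (y - c) ≤ r},
      ENNReal.ofReal (r ^ (2 * η)) * ENNReal.ofReal (max 1 (absF y) ^ (-(1 + η))) ∂haarF F ≤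
      ENNReal.ofReal (r ^ (2 * η) * (2 / η)) := by
    refine (setLIntegral_le_lintegral _ _).trans ?_
    rw [lintegral_const_mul' _ _ ENNReal.ofReal_ne_top, ENNReal.ofReal_mul (by positivity)]
    gcongr
    exact lintegral_max_one_rpow_le h0 h1
  have e2 : ENNReal.ofReal (r ^ (-1 + η)) * haarF F {y : F | absF (y - c) ≤ r} ≤
      ENNReal.ofReal (r ^ (2 * η)) := by
    refine (mul_le_mul_right (haarF_absF_sub_le _ _ hr0) _).trans ?_
    rw [← ENNReal.ofReal_mul (by positivity)]
    refine ENNReal.ofReal_le_ofReal ?_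
    nth_rewrite 2 [← Real.rpow_one r]
    rw [← Real.rpow_add hr0]
    exact Real.rpow_le_rpow_of_exponent_le hr (by linarith)
  refine (add_le_add e1 e2).trans ?_
  rw [← ENNReal.ofReal_add (by positivity) (by positivity)]
  exact ENNReal.ofReal_le_ofReal (by linarith)

end FieldIntegrals

/-! ### Product Haar measure on row vectors and linear changes of variable. -/

section LinearChange

variable {F : Type*} [Field F] [ValuativeRel F] [TopologicalSpace F] [IsNonarchimedeanLocalField F]
  [MeasurableSpace F] [BorelSpace F]

instance : SigmaFinite (haarF F) := inferInstance

variable (F) in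
/-- The product Haar measure on row vectors. -/
noncomputable def haarVec (ι : Type*) [Fintype ι] : Measure (ι → F) := Measure.pi fun _ => haarF F

instance {ι : Type*} [Fintype ι] : (haarVec F ι).IsAddHaarMeasure := by
  unfold haarVec; infer_instance

instance {ι : Type*} [Fintype ι] : SigmaFinite (haarVec F ι) := by
  unfold haarVec; infer_instance

variable {ι : Type*} [Fintype ι] [DecidableEq ι]

lemma continuous_toLin' (A : Matrix ι ι F) : Continuous (Matrix.toLin' A) := by
  have : (⇑(Matrix.toLin' A) : (ι → F) → ι → F) = fun x => A.mulVec x := by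
    ext; simp
  rw [this]
  fun_prop

lemma haarF_preimage_mul_left {a : F} (ha : a ≠ 0) {s : Set F} (hs : MeasurableSet s) :
    haarF F ((a * ·) ⁻¹' s) = ENNReal.ofReal (absF a)⁻¹ * haarF F s := by
  rw [← Measure.map_apply (measurable_const_mul a) hs, map_mul_left_haarF ha]; simp

lemma map_diagonal_haarVec {D : ι → F} (h : (Matrix.diagonal D).det ≠ 0) :
    ENNReal.ofReal (absF (Matrix.diagonal D).det) •
      (haarVec F ι).map (Matrix.toLin' (Matrix.diagonal D)) = haarVec F ι := by
  refine (Measure.pi_eq fun s hs => ?_).symm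
  simp only [Matrix.det_diagonal, Measure.coe_smul, smul_eq_mul, Pi.smul_apply]
  rw [Measure.map_apply (continuous_toLin' _).measurable (MeasurableSet.univ_pi hs)]
  have e : (Matrix.toLin' (Matrix.diagonal D) ⁻¹' Set.pi Set.univ fun i : ι => s i) =
      Set.pi Set.univ fun i : ι => (D i * ·) ⁻¹' s i := by
    ext f
    simp [Matrix.mulVec_diagonal]
  have B : ∀ i, ENNReal.ofReal (absF (D i)) * haarF F ((D i * ·) ⁻¹' s i) = haarF F (s i) := by
    intro i
    have A : D i ≠ 0 := by
      simp only [Matrix.det_diagonal, Ne] at h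
      exact Finset.prod_ne_zero_iff.1 h i (Finset.mem_univ i)
    rw [haarF_preimage_mul_left A (hs i), ← mul_assoc, ← ENNReal.ofReal_mul (absF_nonneg _),
      mul_inv_cancel₀ (absF_pos A).ne', ENNReal.ofReal_one, one_mul]
  rw [e, haarVec, Measure.pi_pi, absF_prod,
    ENNReal.ofReal_prod_of_nonneg fun i _ => absF_nonneg (D i), ← Finset.prod_mul_distrib]
  simp only [B]

/-- A transvection translates one coordinate by an amount depending on the others, so the integral
over that coordinate alone is already unchanged. -/
lemma map_transvection_haarVec (t : Matrix.TransvectionStruct ι F) :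
    (haarVec F ι).map (Matrix.toLin' t.toMatrix) = haarVec F ι := by
  have ht : Measurable (Matrix.toLin' t.toMatrix) := (continuous_toLin' _).measurable
  refine (Measure.pi_eq fun s hs ↦ ?_).symm
  have h2s : MeasurableSet (Set.univ.pi s) := .pi Set.countable_univ fun i _ ↦ hs i
  simp_rw [← Measure.pi_pi, ← lintegral_indicator_one h2s]
  rw [lintegral_map (measurable_one.indicator h2s) ht]
  refine lintegral_eq_of_lmarginal_eq {t.i} ((measurable_one.indicator h2s).comp ht)
    (measurable_one.indicator h2s) ?_
  simp_rw [lmarginal_singleton]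
  ext x
  cases t with | mk t_i t_j t_hij t_c =>
  simp [Matrix.transvection, Matrix.single_mulVec, t_hij.symm, ← Function.update_add,
    lintegral_add_right_eq_self fun xᵢ ↦ Set.indicator (Set.univ.pi s) 1 (Function.update x t_i xᵢ)]

/-- Both sides are multiplicative in M, and invertible matrices are products of diagonal matrices
and transvections. -/
lemma map_toLin'_haarVec {M : Matrix ι ι F} (hM : M.det ≠ 0) :
    (haarVec F ι).map (Matrix.toLin' M) = ENNReal.ofReal (absF M.det)⁻¹ • haarVec F ι := by
  apply Matrix.diagonal_transvection_induction_of_det_ne_zero _ M hM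
  · intro D hD
    conv_rhs => rw [← map_diagonal_haarVec hD]
    rw [smul_smul, ← ENNReal.ofReal_mul (by simp [absF_nonneg]),
      inv_mul_cancel₀ (absF_pos hD).ne', ENNReal.ofReal_one, one_smul]
  · intro t
    simp_rw [Matrix.TransvectionStruct.det, absF_one, inv_one, ENNReal.ofReal_one, one_smul,
      map_transvection_haarVec]
  · intro A B _ _ IHA IHB
    rw [Matrix.toLin'_mul, Matrix.det_mul, LinearMap.coe_comp, ← Measure.map_map, IHB,
      Measure.map_smul, IHA, smul_smul, ← ENNReal.ofReal_mul (by simp [absF_nonneg]), absF_mul,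
      mul_inv, mul_comm]
    · exact (continuous_toLin' _).measurable
    · exact (continuous_toLin' _).measurable

/-- Change of variables for an affine map on row vectors. -/
lemma lintegral_affine_vecMul (v : ι → F) {A : Matrix ι ι F} (hA : A.det ≠ 0)
    {f : (ι → F) → ENNReal} (hf : Measurable f) :
    ∫⁻ x, f (v + Matrix.vecMul x A) ∂haarVec F ι =
      ENNReal.ofReal (absF A.det)⁻¹ * ∫⁻ x, f x ∂haarVec F ι := by
  have h1 := map_toLin'_haarVec (M := A.transpose) (by rwa [Matrix.det_transpose])
  rw [Matrix.det_transpose] at h1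
  rw [← lintegral_add_left_eq_self f v, ← smul_eq_mul, ← lintegral_smul_measure, ← h1,
    lintegral_map (by fun_prop) (continuous_toLin' _).measurable]
  simp [Matrix.mulVec_transpose]

lemma lintegral_haarVec_succ {n : ℕ} (i : Fin (n + 1)) {f : (Fin (n + 1) → F) → ENNReal}
    (hf : Measurable f) :
    ∫⁻ x, f x ∂haarVec F (Fin (n + 1)) =
      ∫⁻ y, ∫⁻ t, f (i.insertNth t y) ∂haarF F ∂haarVec F (Fin n) := by
  have h := (measurePreserving_piFinSuccAbove (fun _ : Fin (n + 1) => haarF F) i).symm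
  have e := h.lintegral_comp hf
  rw [haarVec, ← e, lintegral_prod_symm]
  · rfl
  · exact (hf.comp h.measurable).aemeasurable

lemma lintegral_haarVec_prod {n : ℕ} {f : Fin n → F → ENNReal} (hf : ∀ i, Measurable (f i)) :
    ∫⁻ x, ∏ i, f i (x i) ∂haarVec F (Fin n) = ∏ i, ∫⁻ t, f i t ∂haarF F := by
  induction n with
  | zero => simp [haarVec]
  | succ n ih =>
    rw [lintegral_haarVec_succ 0 (by fun_prop), Fin.prod_univ_succ, ← ih fun i => hf i.succ]
    have : ∀ y : Fin n → F, ∫⁻ t, ∏ i : Fin (n + 1),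
        f i ((Fin.insertNth (α := fun _ => F) 0 t y : Fin (n + 1) → F) i) ∂haarF F =
        (∫⁻ t, f 0 t ∂haarF F) * ∏ i : Fin n, f i.succ (y i) := by
      intro y
      rw [← lintegral_mul_const _ (hf 0)]
      congr 1
      ext t
      rw [Fin.prod_univ_succ]
      simp
    simp_rw [this]
    rw [lintegral_const_mul _ (by fun_prop)]

end LinearChange

/-! ### Maximal minors of the bottom rows and their behaviour under multiplication. -/

section Minors

variable {F : Type*} [Field F] [ValuativeRel F] [TopologicalSpace F] [IsNonarchimedeanLocalField F]

lemma prod_le_pow_card_of_nonneg {α : Type*} (s : Finset α) {f : α → ℝ} {r : ℝ}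
    (h0 : ∀ i ∈ s, 0 ≤ f i) (h : ∀ i ∈ s, f i ≤ r) : ∏ i ∈ s, f i ≤ r ^ s.card := by
  rw [← Finset.prod_const]
  exact Finset.prod_le_prod h0 h

section Det

variable {ι κ : Type*} [Fintype ι] [DecidableEq ι] [Fintype κ]

lemma absF_sign_mul (σ : Equiv.Perm ι) (x : F) :
    absF (((Equiv.Perm.sign σ : ℤˣ) : ℤ) * x) = absF x := by
  rcases Int.units_eq_one_or (Equiv.Perm.sign σ) with h | h <;> simp [h]

lemma absF_det_le {A : Matrix ι ι F} {r : ℝ} (hr : 0 ≤ r) (h : ∀ i j, absF (A i j) ≤ r) :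
    absF A.det ≤ r ^ Fintype.card ι := by
  rw [Matrix.det_apply']
  refine absF_sum_le _ _ (pow_nonneg hr _) fun σ _ => ?_
  rw [absF_sign_mul, absF_prod]
  exact prod_le_pow_card_of_nonneg _ (fun _ _ => absF_nonneg _) fun i _ => h _ _

/-- Cauchy–Binet summed over all maps f rather than over increasing ones. The redundant terms are
harmless, since the ultrametric inequality needs only a bound for each term. -/
lemma det_mul_eq_sum (A : Matrix ι κ F) (B : Matrix κ ι F) :
    (A * B).det = ∑ f : ι → κ, (∏ i, B (f i) i) * (A.submatrix id f).det := by
  classical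
  have h1 : (A * B).transpose = fun i => ∑ k, B k i • A.transpose k := by
    ext i j
    simp [Matrix.mul_apply, mul_comm]
  rw [← Matrix.det_transpose, h1]
  change Matrix.detRowAlternating.toMultilinearMap _ = _
  rw [MultilinearMap.map_sum]
  refine Finset.sum_congr rfl fun f _ => ?_
  rw [MultilinearMap.map_smul_univ, smul_eq_mul]
  congr 1
  rw [← Matrix.det_transpose (A.submatrix id f)]
  rfl

lemma absF_det_mul_le {A : Matrix ι κ F} {B : Matrix κ ι F} {r m : ℝ} (hr : 0 ≤ r) (hm : 0 ≤ m)
    (hB : ∀ i j, absF (B i j) ≤ r) (hA : ∀ f : ι → κ, absF (A.submatrix id f).det ≤ m) :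
    absF (A * B).det ≤ r ^ Fintype.card ι * m := by
  rw [det_mul_eq_sum]
  refine absF_sum_le _ _ (mul_nonneg (pow_nonneg hr _) hm) fun f _ => ?_
  rw [absF_mul, absF_prod]
  gcongr
  · exact absF_nonneg _
  · exact prod_le_pow_card_of_nonneg _ (fun _ _ => absF_nonneg _) fun i _ => hB _ _
  · exact hA f

end Det

variable {k : ℕ}

/-- The largest absolute value of a maximal minor of the rows `≥ i` of a square matrix. -/
noncomputable def minorSup (i : Fin k) (M : Matrix (Fin k) (Fin k) F) : ℝ :=
  ⨆ c : {j : Fin k // i ≤ j} → Fin k, absF (M.submatrix Subtype.val c).det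

lemma le_minorSup (i : Fin k) (M : Matrix (Fin k) (Fin k) F) (c : {j : Fin k // i ≤ j} → Fin k) :
    absF (M.submatrix Subtype.val c).det ≤ minorSup i M :=
  le_ciSup (f := fun c : {j : Fin k // i ≤ j} → Fin k => absF (M.submatrix Subtype.val c).det)
    (Set.finite_range _).bddAbove c

lemma le_minorSup_of_equiv (i : Fin k) (M : Matrix (Fin k) (Fin k) F) {ι : Type*} [Fintype ι]
    [DecidableEq ι] (e : ι ≃ {j : Fin k // i ≤ j}) (c : ι → Fin k) :
    absF (M.submatrix (fun x => (e x : Fin k)) c).det ≤ minorSup i M := by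
  have h := le_minorSup i M (c ∘ e.symm)
  have e1 : M.submatrix (fun x => (e x : Fin k)) c =
      (M.submatrix Subtype.val (c ∘ e.symm)).submatrix e e := by
    ext x y; simp
  rwa [e1, Matrix.det_submatrix_equiv_self]

instance (i : Fin k) : Nonempty ({j : Fin k // i ≤ j} → Fin k) := ⟨Subtype.val⟩

lemma minorSup_le {i : Fin k} {M : Matrix (Fin k) (Fin k) F} {r : ℝ}
    (h : ∀ c : {j : Fin k // i ≤ j} → Fin k, absF (M.submatrix Subtype.val c).det ≤ r) :
    minorSup i M ≤ r := ciSup_le h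

lemma minorSup_nonneg (i : Fin k) (M : Matrix (Fin k) (Fin k) F) : 0 ≤ minorSup i M :=
  (absF_nonneg _).trans (le_minorSup i M Subtype.val)

lemma card_ge_le (i : Fin k) : Fintype.card {j : Fin k // i ≤ j} ≤ k := by
  simpa using Fintype.card_subtype_le (fun j : Fin k => i ≤ j)

/-- By Cauchy–Binet the minors of `M * B` on given rows are combinations of the minors of M on the
same rows. The condition `1 ≤ r` allows the number of rows to be replaced by k in the exponent. -/
lemma minorSup_mul_le {i : Fin k} {M B : Matrix (Fin k) (Fin k) F} {r : ℝ} (hr : 1 ≤ r)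
    (hB : ∀ i j, absF (B i j) ≤ r) : minorSup i (M * B) ≤ r ^ k * minorSup i M := by
  refine minorSup_le fun c => ?_
  have e : (M * B).submatrix Subtype.val c =
      M.submatrix (Subtype.val : {j : Fin k // i ≤ j} → Fin k) id * B.submatrix id c := by
    ext x y; simp [Matrix.mul_apply]
  rw [e]
  refine (absF_det_mul_le (by linarith) (minorSup_nonneg i M) (fun _ _ => hB _ _)
    fun f => ?_).trans ?_
  · exact le_minorSup i M f
  · gcongr
    · exact minorSup_nonneg i M
    · exact card_ge_le i

lemma minorSup_le_pow {i : Fin k} {M : Matrix (Fin k) (Fin k) F} {r : ℝ} (hr : 1 ≤ r)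
    (hM : ∀ i j, absF (M i j) ≤ r) : minorSup i M ≤ r ^ k :=
  minorSup_le fun c => (absF_det_le (by linarith) fun _ _ => hM _ _).trans
    (pow_le_pow_right₀ hr (card_ge_le i))

lemma prod_subtype_ge {α : Type*} [CommMonoid α] (i : Fin k) (f : Fin k → α) :
    ∏ j : {j : Fin k // i ≤ j}, f j = ∏ j ∈ Finset.Ici i, f j :=
  (Finset.prod_subtype _ (fun x => by simp) f).symm

/-- The rows ≥ i of `b * M` involve only the rows ≥ i of M, through the lower right corner of b,
whose determinant factors out. -/
lemma minorSup_upper_mul {b : Matrix (Fin k) (Fin k) F} (hb : b.BlockTriangular id)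
    (i : Fin k) (M : Matrix (Fin k) (Fin k) F) :
    minorSup i (b * M) = (∏ j ∈ Finset.Ici i, absF (b j j)) * minorSup i M := by
  have hdet : (b.submatrix (Subtype.val : {j : Fin k // i ≤ j} → Fin k) Subtype.val).det =
      ∏ j ∈ Finset.Ici i, b j j := by
    rw [Matrix.det_of_isUpperTriangular, ← prod_subtype_ge]
    · rfl
    · intro x y hxy
      exact hb hxy
  have e : ∀ c : {j : Fin k // i ≤ j} → Fin k, (b * M).submatrix (Subtype.val : {j : Fin k // i ≤ j} → Fin k) c =
      b.submatrix (Subtype.val : {j : Fin k // i ≤ j} → Fin k) (Subtype.val : {j : Fin k // i ≤ j} → Fin k) *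
        M.submatrix Subtype.val c := by
    intro c
    ext x y
    simp only [Matrix.submatrix_apply, Matrix.mul_apply]
    rw [← Finset.sum_subtype (Finset.univ.filter (i ≤ ·)) (by simp) fun j => b x j * M j (c y)]
    refine (Finset.sum_subset (Finset.filter_subset _ _) fun j _ hj => ?_).symm
    have hji : j < i := by simpa using hj
    rw [hb (show id j < id (x : Fin k) from hji.trans_le x.2), zero_mul]
  rw [minorSup, minorSup, Real.mul_iSup_of_nonneg (Finset.prod_nonneg fun _ _ => absF_nonneg _)]
  refine congrArg _ (funext fun c => ?_)
  rw [e, Matrix.det_mul, hdet, absF_mul, absF_prod]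

lemma minorSup_one (i : Fin k) : minorSup i (1 : Matrix (Fin k) (Fin k) F) = 1 := by
  refine le_antisymm ?_ ?_
  · have := minorSup_le_pow (i := i) (M := (1 : Matrix (Fin k) (Fin k) F)) le_rfl fun i j => by
      rw [Matrix.one_apply]; split_ifs <;> simp
    simpa using this
  · have := le_minorSup i (1 : Matrix (Fin k) (Fin k) F) Subtype.val
    rwa [Matrix.submatrix_one _ Subtype.val_injective, Matrix.det_one, absF_one] at this

/-- The product over all `i` of the maximal minors of the rows `≥ i`. -/
noncomputable def prodMinors (M : Matrix (Fin k) (Fin k) F) : ℝ := ∏ i, minorSup i M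

lemma prodMinors_mul_le {M B : Matrix (Fin k) (Fin k) F} {r : ℝ} (hr : 1 ≤ r)
    (hB : ∀ i j, absF (B i j) ≤ r) : prodMinors (M * B) ≤ r ^ (k * k) * prodMinors M := by
  have : r ^ (k * k) * prodMinors M = ∏ i, r ^ k * minorSup i M := by
    rw [Finset.prod_mul_distrib, Finset.prod_const, Finset.card_univ, Fintype.card_fin, pow_mul]
    rfl
  rw [this]
  exact Finset.prod_le_prod (fun _ _ => minorSup_nonneg _ _) fun i _ => minorSup_mul_le hr hB

lemma prodMinors_one : prodMinors (1 : Matrix (Fin k) (Fin k) F) = 1 := by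
  simp [prodMinors, minorSup_one]

lemma prodMinors_upper_mul {b : Matrix (Fin k) (Fin k) F} (hb : b.BlockTriangular id)
    (M : Matrix (Fin k) (Fin k) F) :
    prodMinors (b * M) = (∏ i, ∏ j ∈ Finset.Ici i, absF (b j j)) * prodMinors M := by
  simp only [prodMinors, minorSup_upper_mul hb, Finset.prod_mul_distrib]

/-! ### The maximal compact subgroup -/

lemma absF_le_one_of_mem {κ : GL (Fin k) F} (h : κ ∈ maxCompact k F) (i j : Fin k) :
    absF (κ i j) ≤ 1 := by
  obtain ⟨x, rfl⟩ := h
  exact absF_coe_le_one _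

lemma absF_det_eq_one_of_mem {κ : GL (Fin k) F} (h : κ ∈ maxCompact k F) :
    absF (κ : Matrix (Fin k) (Fin k) F).det = 1 := by
  have h1 := absF_det_le zero_le_one (absF_le_one_of_mem h)
  have h2 := absF_det_le zero_le_one (absF_le_one_of_mem (inv_mem h))
  rw [one_pow] at h1 h2
  have h3 : absF (κ : Matrix (Fin k) (Fin k) F).det *
      absF ((κ⁻¹ : GL (Fin k) F) : Matrix (Fin k) (Fin k) F).det = 1 := by
    rw [← absF_mul, ← Matrix.det_mul, ← Units.val_mul, mul_inv_cancel]; simp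
  nlinarith [absF_nonneg (κ : Matrix (Fin k) (Fin k) F).det]

lemma mem_maxCompact_of_det {κ : GL (Fin k) F} (h : ∀ i j, absF (κ i j) ≤ 1)
    (hd : absF (κ : Matrix (Fin k) (Fin k) F).det = 1) : κ ∈ maxCompact k F := by
  let A : Matrix (Fin k) (Fin k) 𝒪[F] := fun i j => ⟨κ i j, absF_le_one_iff.mp (h i j)⟩
  have hA : ((A.det : 𝒪[F]) : F) = (κ : Matrix (Fin k) (Fin k) F).det := by
    have := RingHom.map_det (𝒪[F]).subtype A
    exact this
  have hu : IsUnit A.det := by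
    have h0 : ((A.det : 𝒪[F]) : F) ≠ 0 := by
      intro h0; rw [← hA, h0, absF_zero] at hd; exact zero_ne_one hd
    refine IsUnit.of_mul_eq_one ⟨((A.det : 𝒪[F]) : F)⁻¹, ?_⟩ (Subtype.ext (mul_inv_cancel₀ h0))
    rw [← absF_le_one_iff, absF_inv, hA, hd, inv_one]
  refine ⟨Matrix.GeneralLinearGroup.mk'' A hu, ?_⟩
  ext i j
  rfl

/-- Both κ and its inverse have integral entries, so the bound with r = 1 applies in both
directions. -/
lemma prodMinors_mul_mem (M : Matrix (Fin k) (Fin k) F) {κ : GL (Fin k) F}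
    (h : κ ∈ maxCompact k F) : prodMinors (M * (κ : Matrix (Fin k) (Fin k) F)) = prodMinors M := by
  refine le_antisymm ?_ ?_
  · simpa using prodMinors_mul_le (M := M) le_rfl (absF_le_one_of_mem h)
  · have := prodMinors_mul_le (M := M * (κ : Matrix (Fin k) (Fin k) F)) le_rfl (absF_le_one_of_mem (inv_mem h))
    rw [Matrix.mul_assoc, ← Units.val_mul, mul_inv_cancel] at this
    simpa using this

lemma minorSup_mul_mem (i : Fin k) (M : Matrix (Fin k) (Fin k) F) {κ : GL (Fin k) F}
    (h : κ ∈ maxCompact k F) : minorSup i (M * (κ : Matrix (Fin k) (Fin k) F)) = minorSup i M := by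
  refine le_antisymm ?_ ?_
  · simpa using minorSup_mul_le (i := i) (M := M) le_rfl (absF_le_one_of_mem h)
  · have := minorSup_mul_le (i := i) (M := M * (κ : Matrix (Fin k) (Fin k) F)) le_rfl (absF_le_one_of_mem (inv_mem h))
    rw [Matrix.mul_assoc, ← Units.val_mul, mul_inv_cancel] at this
    simpa using this

end Minors

/-! ### The closed formula for the square root of the modulus, and the logarithmic height. -/

section Spherical

variable {F : Type*} [Field F] [ValuativeRel F] [TopologicalSpace F] [IsNonarchimedeanLocalField F]
variable {k : ℕ}

lemma prod_prod_Ici {α : Type*} [CommMonoid α] (t : Fin k → α) :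
    ∏ i, ∏ j ∈ Finset.Ici i, t j = ∏ j, t j ^ ((j : ℕ) + 1) := by
  rw [Finset.prod_comm' (t' := Finset.univ) (s' := fun j => Finset.Iic j) (by simp)]
  exact Finset.prod_congr rfl fun j _ => by rw [Finset.prod_const, Fin.card_Iic]

lemma prodMinors_upper_mul' {b : Matrix (Fin k) (Fin k) F} (hb : b.BlockTriangular id)
    (M : Matrix (Fin k) (Fin k) F) :
    prodMinors (b * M) = (∏ j, absF (b j j) ^ ((j : ℕ) + 1)) * prodMinors M := by
  rw [prodMinors_upper_mul hb, prod_prod_Ici]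

lemma prodMinors_upper {b : Matrix (Fin k) (Fin k) F} (hb : b.BlockTriangular id) :
    prodMinors b = ∏ j, absF (b j j) ^ ((j : ℕ) + 1) := by
  have := prodMinors_upper_mul' hb 1
  rwa [mul_one, prodMinors_one, mul_one] at this

/-- The spherical section: the value at `g` of the square root of the modulus of `a_B(g)`. -/
noncomputable def sph (g : GL (Fin k) F) : ℝ :=
  absF (g : Matrix (Fin k) (Fin k) F).det ^ (((k : ℝ) + 1) / 2) /
    prodMinors (g : Matrix (Fin k) (Fin k) F)

lemma absF_det_pos (g : GL (Fin k) F) : 0 < absF (g : Matrix (Fin k) (Fin k) F).det :=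
  absF_pos (Matrix.GeneralLinearGroup.det g).ne_zero

lemma unipotent_upper {u : GL (Fin k) F} (hu : u ∈ unipotent k F) :
    (u : Matrix (Fin k) (Fin k) F).BlockTriangular id := fun i j h => hu.2 i j h

lemma diagGL_upper (a : Fin k → Fˣ) :
    ((diagGL a : GL (Fin k) F) : Matrix (Fin k) (Fin k) F).BlockTriangular id :=
  Matrix.blockTriangular_diagonal _

lemma diagGL_apply (a : Fin k → Fˣ) (i : Fin k) : (diagGL a : GL (Fin k) F) i i = a i :=
  Matrix.diagonal_apply_eq _ _

lemma prodMinors_iwasawa (a : Fin k → Fˣ) {u κ : GL (Fin k) F} (hu : u ∈ unipotent k F)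
    (hκ : κ ∈ maxCompact k F) :
    prodMinors ((diagGL a * u * κ : GL (Fin k) F) : Matrix (Fin k) (Fin k) F) =
      ∏ j, absF (a j : F) ^ ((j : ℕ) + 1) := by
  rw [Units.val_mul, prodMinors_mul_mem _ hκ, Units.val_mul, prodMinors_upper_mul' (diagGL_upper a),
    prodMinors_upper (unipotent_upper hu)]
  simp only [diagGL_apply, hu.1, absF_one, one_pow, Finset.prod_const_one, mul_one]

lemma absF_det_iwasawa (a : Fin k → Fˣ) {u κ : GL (Fin k) F} (hu : u ∈ unipotent k F)
    (hκ : κ ∈ maxCompact k F) :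
    absF ((diagGL a * u * κ : GL (Fin k) F) : Matrix (Fin k) (Fin k) F).det =
      ∏ j, absF (a j : F) := by
  rw [Units.val_mul, Units.val_mul, Matrix.det_mul, Matrix.det_mul,
    Matrix.det_of_isUpperTriangular (diagGL_upper a),
    Matrix.det_of_isUpperTriangular (unipotent_upper hu), absF_mul, absF_mul,
    absF_det_eq_one_of_mem hκ, absF_prod, absF_prod]
  simp only [diagGL_apply, hu.1, absF_one, Finset.prod_const_one, mul_one]

/-- The exponent of |a_j| in the modulus is (k - 1 - j) - j = (k + 1) - 2(j + 1), with indices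
starting at 0. -/
lemma modulus_eq (a : Fin k → Fˣ) :
    modulus a = (∏ j, absF (a j : F)) ^ (k + 1) / (∏ j, absF (a j : F) ^ ((j : ℕ) + 1)) ^ 2 := by
  have hp : ∀ j, 0 < absF (a j : F) := fun j => absF_pos (a j).ne_zero
  have h1 : modulus a = (∏ i : Fin k, absF (a i : F) ^ (k - 1 - (i : ℕ))) /
      ∏ j : Fin k, absF (a j : F) ^ (j : ℕ) := by
    simp only [modulus, absF_div, Finset.prod_div_distrib]
    congr 1
    · exact Finset.prod_congr rfl fun j _ => by rw [Finset.prod_const, Fin.card_Ioi]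
    · rw [Finset.prod_comm' (t' := Finset.univ) (s' := fun j => Finset.Iio j) (by simp)]
      exact Finset.prod_congr rfl fun j _ => by rw [Finset.prod_const, Fin.card_Iio]
  rw [h1, ← Finset.prod_pow, ← Finset.prod_pow, ← Finset.prod_div_distrib,
    ← Finset.prod_div_distrib]
  refine Finset.prod_congr rfl fun j _ => ?_
  rw [div_eq_div_iff (pow_pos (hp j) _).ne' (by have := hp j; positivity), ← pow_mul, ← pow_add,
    ← pow_add]
  congr 1
  have := j.2
  omega

lemma sqrt_modulus_eq (a : Fin k → Fˣ) :
    Real.sqrt (modulus a) = (∏ j, absF (a j : F)) ^ (((k : ℝ) + 1) / 2) /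
      ∏ j, absF (a j : F) ^ ((j : ℕ) + 1) := by
  have hp : ∀ j, 0 < absF (a j : F) := fun j => absF_pos (a j).ne_zero
  have h0 : 0 < ∏ j, absF (a j : F) := Finset.prod_pos fun j _ => hp j
  have h1 : 0 < ∏ j, absF (a j : F) ^ ((j : ℕ) + 1) := Finset.prod_pos fun j _ => pow_pos (hp j) _
  rw [modulus_eq, Real.sqrt_div (by positivity), Real.sqrt_sq h1.le, Real.sqrt_eq_rpow,
    ← Real.rpow_natCast, ← Real.rpow_mul h0.le]
  congr 2
  push_cast
  ring

/-- Replaces the chosen Iwasawa decomposition by an explicit function; in particular the value does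
not depend on the choice. -/
lemma sqrt_modulus_torusPart (g : GL (Fin k) F) : Real.sqrt (modulus (torusPart g)) = sph g := by
  obtain ⟨u, hu, κ, hκ, h⟩ := (iwasawa g).choose_spec
  change g = diagGL (torusPart g) * u * κ at h
  have key : ∀ a : Fin k → Fˣ, g = diagGL a * u * κ → Real.sqrt (modulus a) = sph g := by
    rintro a rfl
    rw [sqrt_modulus_eq, sph, prodMinors_iwasawa _ hu hκ, absF_det_iwasawa _ hu hκ]
  exact key _ h

lemma prodMinors_pos (g : GL (Fin k) F) : 0 < prodMinors (g : Matrix (Fin k) (Fin k) F) := by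
  obtain ⟨a, u, hu, κ, hκ, rfl⟩ := iwasawa g
  rw [prodMinors_iwasawa _ hu hκ]
  exact Finset.prod_pos fun j _ => pow_pos (absF_pos (a j).ne_zero) _

lemma sph_pos (g : GL (Fin k) F) : 0 < sph g :=
  div_pos (Real.rpow_pos_of_pos (absF_det_pos g) _) (prodMinors_pos g)

lemma sph_mul_mem (g : GL (Fin k) F) {κ : GL (Fin k) F} (h : κ ∈ maxCompact k F) :
    sph (g * κ) = sph g := by
  rw [sph, sph, Units.val_mul, prodMinors_mul_mem _ h, Matrix.det_mul, absF_mul,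
    absF_det_eq_one_of_mem h, mul_one]

lemma sph_upper_mul {b : GL (Fin k) F} (hb : (b : Matrix (Fin k) (Fin k) F).BlockTriangular id)
    (g : GL (Fin k) F) : sph (b * g) = sph b * sph g := by
  rw [sph, sph, sph, Units.val_mul, prodMinors_upper_mul' hb, prodMinors_upper hb, Matrix.det_mul,
    absF_mul, Real.mul_rpow (absF_nonneg _) (absF_nonneg _), mul_div_mul_comm]

lemma sph_one : sph (1 : GL (Fin k) F) = 1 := by
  simp [sph, prodMinors_one]

lemma sph_of_mem {κ : GL (Fin k) F} (h : κ ∈ maxCompact k F) : sph κ = 1 := by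
  rw [← one_mul κ, sph_mul_mem _ h, sph_one]

/-! ### The logarithmic height -/

lemma one_le_sigma (g : GL (Fin k) F) : 1 ≤ sigma g := le_max_left _ _

lemma sigma_pos (g : GL (Fin k) F) : 0 < sigma g := one_pos.trans_le (one_le_sigma g)

lemma max_absF_le_height (g : GL (Fin k) F) (i j : Fin k) :
    max (absF (g i j)) (absF ((g⁻¹ : GL (Fin k) F) i j)) ≤ height g :=
  le_ciSup (f := fun p : Fin k × Fin k => max (absF (g p.1 p.2))
    (absF ((g⁻¹ : GL (Fin k) F) p.1 p.2))) (Set.finite_range _).bddAbove (i, j)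

lemma height_le_exp_sigma (g : GL (Fin k) F) : height g ≤ Real.exp (sigma g) := by
  rcases le_or_gt (height g) 0 with h | h
  · exact h.trans (Real.exp_pos _).le
  · rw [← Real.log_le_iff_le_exp h]; exact le_max_right _ _

lemma absF_le_exp_sigma (g : GL (Fin k) F) (i j : Fin k) : absF (g i j) ≤ Real.exp (sigma g) :=
  (le_max_left _ _).trans ((max_absF_le_height g i j).trans (height_le_exp_sigma g))

lemma absF_inv_le_exp_sigma (g : GL (Fin k) F) (i j : Fin k) :
    absF ((g⁻¹ : GL (Fin k) F) i j) ≤ Real.exp (sigma g) :=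
  (le_max_right _ _).trans ((max_absF_le_height g i j).trans (height_le_exp_sigma g))

lemma sigma_le {g : GL (Fin k) F} {s : ℝ} (hs : 1 ≤ s) (h : ∀ i j, absF (g i j) ≤ Real.exp s)
    (h' : ∀ i j, absF ((g⁻¹ : GL (Fin k) F) i j) ≤ Real.exp s) : sigma g ≤ s := by
  refine max_le hs ?_
  have : height g ≤ Real.exp s := by
    refine Real.iSup_le (fun p => max_le (h _ _) (h' _ _)) (Real.exp_pos _).le
  -- For k = 0 the height is a supremum over the empty set, hence 0, and the logarithm takes its
  -- default value 0.
  rcases le_or_gt (height g) 0 with h0 | h0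
  · have h00 : height g = 0 := le_antisymm h0
      (Real.iSup_nonneg fun p => (absF_nonneg _).trans (le_max_left _ _))
    rw [h00, Real.log_zero]; linarith
  · exact (Real.log_le_iff_le_exp h0).mpr this

lemma sigma_inv (g : GL (Fin k) F) : sigma g⁻¹ = sigma g := by
  have : ∀ g : GL (Fin k) F, sigma g⁻¹ ≤ sigma g := fun g =>
    sigma_le (one_le_sigma g) (absF_inv_le_exp_sigma g)
      (by rw [inv_inv]; exact absF_le_exp_sigma g)
  exact le_antisymm (this g) (by simpa using this g⁻¹)

lemma absF_mul_apply_le {A B : Matrix (Fin k) (Fin k) F} {r s : ℝ} (hr : 0 ≤ r) (hs : 0 ≤ s)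
    (hA : ∀ i j, absF (A i j) ≤ r) (hB : ∀ i j, absF (B i j) ≤ s) (i j : Fin k) :
    absF ((A * B) i j) ≤ r * s := by
  rw [Matrix.mul_apply]
  refine absF_sum_le _ _ (mul_nonneg hr hs) fun l _ => ?_
  rw [absF_mul]
  exact mul_le_mul (hA _ _) (hB _ _) (absF_nonneg _) hr

lemma sigma_mul_le (g h : GL (Fin k) F) : sigma (g * h) ≤ sigma g + sigma h := by
  refine sigma_le (by linarith [one_le_sigma g, one_le_sigma h]) (fun i j => ?_) fun i j => ?_
  · rw [Real.exp_add, Units.val_mul]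
    exact absF_mul_apply_le (Real.exp_pos _).le (Real.exp_pos _).le (absF_le_exp_sigma g)
      (absF_le_exp_sigma h) i j
  · rw [mul_inv_rev, add_comm, Real.exp_add, Units.val_mul]
    exact absF_mul_apply_le (Real.exp_pos _).le (Real.exp_pos _).le (absF_inv_le_exp_sigma h)
      (absF_inv_le_exp_sigma g) i j

lemma sigma_mul_mem (g : GL (Fin k) F) {κ : GL (Fin k) F} (h : κ ∈ maxCompact k F) :
    sigma (g * κ) = sigma g := by
  have : ∀ (g : GL (Fin k) F) {κ : GL (Fin k) F}, κ ∈ maxCompact k F →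
      sigma (g * κ) ≤ sigma g := by
    intro g κ h
    refine sigma_le (one_le_sigma g) (fun i j => ?_) fun i j => ?_
    · rw [Units.val_mul, ← mul_one (Real.exp _)]
      exact absF_mul_apply_le (Real.exp_pos _).le zero_le_one (absF_le_exp_sigma g)
        (absF_le_one_of_mem h) i j
    · rw [mul_inv_rev, Units.val_mul, ← one_mul (Real.exp _)]
      exact absF_mul_apply_le zero_le_one (Real.exp_pos _).le (absF_le_one_of_mem (inv_mem h))
        (absF_inv_le_exp_sigma g) i j
  exact le_antisymm (this g h) (by simpa using this (g * κ) (inv_mem h))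

lemma sigma_mem_mul (g : GL (Fin k) F) {κ : GL (Fin k) F} (h : κ ∈ maxCompact k F) :
    sigma (κ * g) = sigma g := by
  rw [← sigma_inv, mul_inv_rev, sigma_mul_mem _ (inv_mem h), sigma_inv]

lemma one_le_exp_sigma (g : GL (Fin k) F) : 1 ≤ Real.exp (sigma g) :=
  Real.one_le_exp (sigma_pos g).le

lemma absF_det_le_exp (g : GL (Fin k) F) :
    absF (g : Matrix (Fin k) (Fin k) F).det ≤ Real.exp (k * sigma g) := by
  have := absF_det_le (Real.exp_pos _).le (absF_le_exp_sigma g)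
  rwa [Fintype.card_fin, ← Real.exp_nat_mul] at this

/-- The minors of x and `x * g` differ by at most a factor `exp(k² σ(g))`. The determinant
contributes `exp(k(k+1)/2 · σ(g))`, rounded up to `k² + k`. -/
lemma sph_mul_le (x g : GL (Fin k) F) :
    sph (x * g) ≤ Real.exp ((2 * k * k + k : ℝ) * sigma g) * sph x := by
  -- Here `x = (x * g) * g⁻¹`, so the entries of g⁻¹ control the loss.
  have h1 : prodMinors (x : Matrix (Fin k) (Fin k) F) ≤
      Real.exp (sigma g) ^ (k * k) * prodMinors ((x * g : GL (Fin k) F) : Matrix (Fin k) (Fin k) F) := by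
    have := prodMinors_mul_le (M := ((x * g : GL (Fin k) F) : Matrix (Fin k) (Fin k) F))
      (one_le_exp_sigma g) (absF_inv_le_exp_sigma g)
    rwa [← Units.val_mul, mul_inv_cancel_right] at this
  rw [← Real.exp_nat_mul] at h1
  have h2 : absF (g : Matrix (Fin k) (Fin k) F).det ^ (((k : ℝ) + 1) / 2) ≤
      Real.exp ((k * k + k : ℝ) * sigma g) := by
    refine (Real.rpow_le_rpow (absF_nonneg _) (absF_det_le_exp g) (by positivity)).trans ?_
    rw [← Real.exp_mul]
    refine Real.exp_le_exp.mpr ?_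
    have hk : (0 : ℝ) ≤ k := Nat.cast_nonneg k
    have := sigma_pos g
    have : (0 : ℝ) ≤ k * sigma g := by positivity
    nlinarith [mul_nonneg hk this]
  have hx := prodMinors_pos x
  have hxg := prodMinors_pos (x * g)
  rw [sph, sph, div_le_iff₀ hxg, Units.val_mul, Matrix.det_mul, absF_mul,
    Real.mul_rpow (absF_nonneg _) (absF_nonneg _), ← Units.val_mul]
  have hd := Real.rpow_pos_of_pos (absF_det_pos x) (((k : ℝ) + 1) / 2)
  set d := absF (x : Matrix (Fin k) (Fin k) F).det ^ (((k : ℝ) + 1) / 2)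
  set P := prodMinors (x : Matrix (Fin k) (Fin k) F)
  set Q := prodMinors ((x * g : GL (Fin k) F) : Matrix (Fin k) (Fin k) F)
  have h3 : Real.exp ((2 * k * k + k : ℝ) * sigma g) =
      Real.exp ((k * k + k : ℝ) * sigma g) * Real.exp (((k * k : ℕ) : ℝ) * sigma g) := by
    rw [← Real.exp_add]; congr 1; push_cast; ring
  have h4 : 1 ≤ Real.exp (((k * k : ℕ) : ℝ) * sigma g) * Q / P := by
    rw [le_div_iff₀ hx, one_mul]; exact h1
  calc d * absF (g : Matrix (Fin k) (Fin k) F).det ^ (((k : ℝ) + 1) / 2)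
      ≤ d * Real.exp ((k * k + k : ℝ) * sigma g) * 1 := by rw [mul_one]; gcongr
    _ ≤ d * Real.exp ((k * k + k : ℝ) * sigma g) *
        (Real.exp (((k * k : ℕ) : ℝ) * sigma g) * Q / P) := by gcongr
    _ = _ := by rw [h3]; ring

/-- Used to absorb the tail of the integral, whose estimate carries no factor `sph g` of its own. -/
lemma exp_neg_sigma_le_sph (g : GL (Fin k) F) :
    Real.exp (-((2 * k * k + k : ℝ) * sigma g)) ≤ sph g := by
  have := sph_mul_le g g⁻¹
  rw [mul_inv_cancel, sph_one, sigma_inv] at this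
  rw [Real.exp_neg, inv_le_iff_one_le_mul₀ (Real.exp_pos _), mul_comm]
  exact this

/-! ### Functions invariant under the maximal compact subgroup -/

lemma isOpen_maxCompact : IsOpen (maxCompact k F : Set (GL (Fin k) F)) := by
  have hO : IsOpen {x : F | absF x ≤ 1} := by
    obtain ⟨p, hp0, hp⟩ := exists_absF_eq (F := F) 1
    have : {x : F | absF x ≤ 1} = {x : F | absF x < absF p} := by
      ext x
      rw [Set.mem_ofPred_eq, Set.mem_ofPred_eq, hp]
      by_cases hx : x = 0
      · simp [hx, resCard_pos F]
      · rw [absF_of_ne_zero hx, ← zpow_zero (resCard F), zpow_le_zpow_iff_right₀ (one_lt_resCard F)]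
        rw [zpow_lt_zpow_iff_right₀ (one_lt_resCard F)]
        omega
    rw [this]; exact isOpen_absF_lt hp0
  have e : (maxCompact k F : Set (GL (Fin k) F)) =
      ⋂ i, ⋂ j, ({g : GL (Fin k) F | absF (g i j) ≤ 1} ∩
        {g : GL (Fin k) F | absF ((g⁻¹ : GL (Fin k) F) i j) ≤ 1}) := by
    ext g
    simp only [Set.mem_iInter, Set.mem_inter_iff, Set.mem_ofPred_eq, SetLike.mem_coe]
    refine ⟨fun h i j => ⟨absF_le_one_of_mem h i j, absF_le_one_of_mem (inv_mem h) i j⟩,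
      fun h => mem_maxCompact_of_det (fun i j => (h i j).1) ?_⟩
    have h1 := absF_det_le zero_le_one fun i j => (h i j).1
    have h2 := absF_det_le zero_le_one fun i j => (h i j).2
    rw [one_pow] at h1 h2
    have h3 : absF (g : Matrix (Fin k) (Fin k) F).det *
        absF ((g⁻¹ : GL (Fin k) F) : Matrix (Fin k) (Fin k) F).det = 1 := by
      rw [← absF_mul, ← Matrix.det_mul, ← Units.val_mul, mul_inv_cancel]; simp
    nlinarith [absF_nonneg (g : Matrix (Fin k) (Fin k) F).det]
  rw [e]
  refine isOpen_iInter_of_finite fun i => isOpen_iInter_of_finite fun j => IsOpen.inter ?_ ?_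
  · exact hO.preimage (Units.continuous_val.matrix_elem i j)
  · exact hO.preimage ((Units.continuous_val.comp continuous_inv).matrix_elem i j)

/-- The group K is open, so a right K-invariant function is locally constant. This settles
continuity and measurability of `sph`, σ, Ξ and the minors. -/
lemma continuous_of_mul_mem {α : Type*} [TopologicalSpace α] {f : GL (Fin k) F → α}
    (h : ∀ g, ∀ κ ∈ maxCompact k F, f (g * κ) = f g) : Continuous f := by
  rw [continuous_iff_continuousAt]
  intro g
  have : (fun x => g⁻¹ * x) ⁻¹' (maxCompact k F : Set (GL (Fin k) F)) ∈ nhds g :=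
    (continuous_const_mul g⁻¹).continuousAt.preimage_mem_nhds
      (isOpen_maxCompact.mem_nhds (by simp))
  refine (continuousAt_const (y := f g)).congr ?_
  filter_upwards [this] with x hx
  have := h g (g⁻¹ * x) hx
  rw [mul_inv_cancel_left] at this
  exact this.symm

lemma continuous_sph : Continuous (sph : GL (Fin k) F → ℝ) :=
  continuous_of_mul_mem fun g _ h => sph_mul_mem g h

lemma continuous_sigma : Continuous (sigma : GL (Fin k) F → ℝ) :=
  continuous_of_mul_mem fun g _ h => sigma_mul_mem g h

lemma continuous_prodMinors_coe :
    Continuous fun g : GL (Fin k) F => prodMinors (g : Matrix (Fin k) (Fin k) F) :=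
  continuous_of_mul_mem fun g κ h => by rw [Units.val_mul, prodMinors_mul_mem _ h]

end Spherical

/-! ### The function Ξ: integral formula and invariance under K on both sides. -/

section XiFunction

variable {F : Type*} [Field F] [ValuativeRel F] [TopologicalSpace F] [IsNonarchimedeanLocalField F]
variable {k : ℕ}

instance : SecondCountableTopology (Matrix (Fin k) (Fin k) F) :=
  inferInstanceAs (SecondCountableTopology (Fin k → Fin k → F))

instance : T2Space (Matrix (Fin k) (Fin k) F) :=
  inferInstanceAs (T2Space (Fin k → Fin k → F))

instance : LocallyCompactSpace (Matrix (Fin k) (Fin k) F) :=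
  inferInstanceAs (LocallyCompactSpace (Fin k → Fin k → F))

instance : SecondCountableTopology (Matrix (Fin k) (Fin k) F)ᵐᵒᵖ :=
  MulOpposite.opHomeomorph.symm.isEmbedding.secondCountableTopology

instance : SecondCountableTopology (GL (Fin k) F) :=
  Units.isEmbedding_embedProduct.secondCountableTopology

instance : LocallyCompactSpace (GL (Fin k) F) :=
  inferInstanceAs (LocallyCompactSpace (Matrix (Fin k) (Fin k) F)ˣ)

instance : T2Space (GL (Fin k) F) :=
  inferInstanceAs (T2Space (Matrix (Fin k) (Fin k) F)ˣ)

variable [MeasurableSpace (GL (Fin k) F)] [BorelSpace (GL (Fin k) F)]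

instance : (haarK : Measure (maxCompact k F)).IsHaarMeasure := by unfold haarK; infer_instance

instance : IsProbabilityMeasure (haarK : Measure (maxCompact k F)) :=
  ⟨by unfold haarK; exact Measure.haarMeasure_self⟩

/-- Right translation turns the Haar measure of a compact group into a Haar measure of the same
total mass, hence into itself. -/
instance : (haarK : Measure (maxCompact k F)).IsMulRightInvariant := by
  refine ⟨fun h => ?_⟩
  have h1 : ((haarK : Measure (maxCompact k F)).map (· * h)).IsHaarMeasure :=
    Measure.isHaarMeasure_map_mul_right haarK h
  have h2 := Measure.isMulInvariant_eq_smul_of_compactSpace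
    ((haarK : Measure (maxCompact k F)).map (· * h)) haarK
  have h3 := congrArg (fun ν => ν Set.univ) h2
  rw [h2]
  simp only [Measure.smul_apply, measure_univ, Measure.map_apply (measurable_mul_const h)
    MeasurableSet.univ, Set.preimage_univ, ENNReal.smul_def, smul_eq_mul, mul_one] at h3
  have h4 := ENNReal.coe_eq_one.mp h3.symm
  rw [h4, one_smul]

lemma Xi_eq_integral_sph (g : GL (Fin k) F) :
    Xi g = ∫ κ : maxCompact k F, sph ((κ : GL (Fin k) F) * g) ∂haarK := by
  simp only [Xi, sqrt_modulus_torusPart]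

lemma continuous_sph_mul (g : GL (Fin k) F) :
    Continuous fun κ : maxCompact k F => sph ((κ : GL (Fin k) F) * g) :=
  continuous_sph.comp (continuous_subtype_val.mul continuous_const)

lemma ofReal_Xi (g : GL (Fin k) F) : ENNReal.ofReal (Xi g) =
    ∫⁻ κ : maxCompact k F, ENNReal.ofReal (sph ((κ : GL (Fin k) F) * g)) ∂haarK := by
  rw [Xi_eq_integral_sph, ofReal_integral_eq_lintegral_ofReal]
  · exact (continuous_sph_mul g).integrable_of_hasCompactSupport
      (HasCompactSupport.of_compactSpace _)
  · exact Filter.Eventually.of_forall fun κ => (sph_pos _).le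

lemma Xi_nonneg (g : GL (Fin k) F) : 0 ≤ Xi g := by
  rw [Xi_eq_integral_sph]
  exact integral_nonneg fun κ => (sph_pos _).le

lemma Xi_mul_mem (g : GL (Fin k) F) {κ : GL (Fin k) F} (h : κ ∈ maxCompact k F) :
    Xi (g * κ) = Xi g := by
  simp only [Xi_eq_integral_sph, ← mul_assoc, sph_mul_mem _ h]

lemma Xi_mem_mul (g : GL (Fin k) F) {κ : GL (Fin k) F} (h : κ ∈ maxCompact k F) :
    Xi (κ * g) = Xi g := by
  rw [Xi_eq_integral_sph, Xi_eq_integral_sph,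
    ← integral_mul_right_eq_self (fun x : maxCompact k F => sph ((x : GL (Fin k) F) * g)) ⟨κ, h⟩]
  simp only [Subgroup.coe_mul, mul_assoc]

lemma continuous_Xi : Continuous (Xi : GL (Fin k) F → ℝ) :=
  continuous_of_mul_mem fun g _ h => Xi_mul_mem g h

end XiFunction

/-! ### Matrices bordered by a last row and column, and permutation matrices. -/

section Bordered

variable {R : Type*} {n : ℕ}

/-- The matrix `A` bordered by a last column `x`, a last row `y` and a last diagonal entry `d`. -/
def blk (A : Matrix (Fin n) (Fin n) R) (x y : Fin n → R) (d : R) :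
    Matrix (Fin (n + 1)) (Fin (n + 1)) R :=
  fun i j => Fin.lastCases (Fin.lastCases d y j) (fun i => Fin.lastCases (x i) (A i) j) i

section Apply

variable (A : Matrix (Fin n) (Fin n) R) (x y : Fin n → R) (d : R) (i j : Fin n)

@[simp] lemma blk_castSucc_castSucc : blk A x y d i.castSucc j.castSucc = A i j := by simp [blk]

@[simp] lemma blk_castSucc_last : blk A x y d i.castSucc (Fin.last n) = x i := by simp [blk]

@[simp] lemma blk_last_castSucc : blk A x y d (Fin.last n) j.castSucc = y j := by simp [blk]

@[simp] lemma blk_last_last : blk A x y d (Fin.last n) (Fin.last n) = d := by simp [blk]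

end Apply

lemma matrix_ext_last {M N : Matrix (Fin (n + 1)) (Fin (n + 1)) R}
    (h1 : ∀ i j : Fin n, M i.castSucc j.castSucc = N i.castSucc j.castSucc)
    (h2 : ∀ i : Fin n, M i.castSucc (Fin.last n) = N i.castSucc (Fin.last n))
    (h3 : ∀ j : Fin n, M (Fin.last n) j.castSucc = N (Fin.last n) j.castSucc)
    (h4 : M (Fin.last n) (Fin.last n) = N (Fin.last n) (Fin.last n)) : M = N := by
  ext i j
  induction i using Fin.lastCases with
  | last => induction j using Fin.lastCases with
    | last => exact h4
    | cast j => exact h3 j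
  | cast i => induction j using Fin.lastCases with
    | last => exact h2 i
    | cast j => exact h1 i j

lemma blk_eta (M : Matrix (Fin (n + 1)) (Fin (n + 1)) R) :
    blk (M.submatrix Fin.castSucc Fin.castSucc) (fun i => M i.castSucc (Fin.last n))
      (fun j => M (Fin.last n) j.castSucc) (M (Fin.last n) (Fin.last n)) = M :=
  matrix_ext_last (by simp) (by simp) (by simp) (by simp)

variable [CommRing R]

lemma blk_mul (A A' : Matrix (Fin n) (Fin n) R) (x y x' y' : Fin n → R) (d d' : R) :
    blk A x y d * blk A' x' y' d' =
      blk (A * A' + Matrix.vecMulVec x y') (A.mulVec x' + d' • x) (Matrix.vecMul y A' + d • y')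
        (y ⬝ᵥ x' + d * d') := by
  refine matrix_ext_last (fun i j => ?_) (fun i => ?_) (fun j => ?_) ?_ <;>
  simp [Matrix.mul_apply, Fin.sum_univ_castSucc, Matrix.vecMulVec_apply, Matrix.mulVec,
    Matrix.vecMul, dotProduct, mul_comm]

lemma blk_one : blk (1 : Matrix (Fin n) (Fin n) R) 0 0 1 = 1 := by
  refine matrix_ext_last (fun i j => ?_) (fun i => ?_) (fun j => ?_) ?_ <;>
  simp [Matrix.one_apply, Fin.castSucc_ne_last, (Fin.castSucc_ne_last _).symm]

lemma det_blk_row_zero (A : Matrix (Fin n) (Fin n) R) (x : Fin n → R) (d : R) :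
    (blk A x 0 d).det = A.det * d := by
  rw [Matrix.det_succ_row _ (Fin.last n), Fin.sum_univ_castSucc, Finset.sum_eq_zero (by simp)]
  have : (blk A x 0 d).submatrix (Fin.last n).succAbove (Fin.last n).succAbove = A := by
    ext i j; simp
  rw [this]
  simp [mul_comm]

lemma blk_transpose (A : Matrix (Fin n) (Fin n) R) (x y : Fin n → R) (d : R) :
    (blk A x y d).transpose = blk A.transpose y x d :=
  matrix_ext_last (by simp) (by simp) (by simp) (by simp)

lemma det_blk_col_zero (A : Matrix (Fin n) (Fin n) R) (y : Fin n → R) (d : R) :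
    (blk A 0 y d).det = A.det * d := by
  rw [← Matrix.det_transpose, blk_transpose, det_blk_row_zero, Matrix.det_transpose]

lemma blk_upper {A : Matrix (Fin n) (Fin n) R} (hA : A.BlockTriangular id) (x : Fin n → R) (d : R) :
    (blk A x 0 d).BlockTriangular id := by
  intro i j hij
  induction i using Fin.lastCases with
  | last => induction j using Fin.lastCases with
    | last => exact absurd hij (lt_irrefl _)
    | cast j => simp
  | cast i => induction j using Fin.lastCases with
    | last => exact absurd hij (not_lt_of_ge (Fin.le_last _))
    | cast j => rw [blk_castSucc_castSucc]; exact hA (by simpa using hij)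

/-- The embedding of `GL_n` in `GL_{n+1}` as a corner. -/
def embGL : GL (Fin n) R →* GL (Fin (n + 1)) R where
  toFun g := ⟨blk g 0 0 1, blk (g⁻¹ : GL (Fin n) R) 0 0 1,
    by rw [blk_mul, ← Units.val_mul, mul_inv_cancel]; simp [blk_one],
    by rw [blk_mul, ← Units.val_mul, inv_mul_cancel]; simp [blk_one]⟩
  map_one' := by ext1; simp [blk_one]
  map_mul' g h := by ext1; simp [blk_mul]

lemma coe_embGL (g : GL (Fin n) R) :
    ((embGL g : GL (Fin (n + 1)) R) : Matrix (Fin (n + 1)) (Fin (n + 1)) R) = blk g 0 0 1 := rfl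

/-- A permutation matrix as an element of the general linear group. -/
def permGL (σ : Equiv.Perm (Fin n)) : GL (Fin n) R :=
  ⟨σ.permMatrix R, σ⁻¹.permMatrix R, by rw [← Matrix.permMatrix_mul]; simp,
    by rw [← Matrix.permMatrix_mul]; simp⟩

lemma permGL_mul (σ : Equiv.Perm (Fin n)) (M : Matrix (Fin n) (Fin n) R) :
    ((permGL σ : GL (Fin n) R) : Matrix (Fin n) (Fin n) R) * M = M.submatrix σ id := by
  exact PEquiv.toMatrix_toPEquiv_mul σ M

lemma mul_permGL (σ : Equiv.Perm (Fin n)) (M : Matrix (Fin n) (Fin n) R) :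
    M * ((permGL σ : GL (Fin n) R) : Matrix (Fin n) (Fin n) R) = M.submatrix id σ.symm :=
  PEquiv.mul_toMatrix_toPEquiv M σ

end Bordered

/-! ### Lower bounds for the minors of bordered matrices; the Cartan decomposition. -/

section BorderedMinors

variable {F : Type*} [Field F] [ValuativeRel F] [TopologicalSpace F] [IsNonarchimedeanLocalField F]
variable {n : ℕ}

lemma permGL_mem (σ : Equiv.Perm (Fin n)) : (permGL σ : GL (Fin n) F) ∈ maxCompact n F := by
  refine mem_maxCompact_of_det (fun i j => ?_) ?_
  · change absF ((σ.permMatrix F) i j) ≤ 1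
    rw [Equiv.Perm.permMatrix, PEquiv.toMatrix_apply]
    split_ifs <;> simp
  · change absF (σ.permMatrix F).det = 1
    rw [Matrix.det_permutation]
    have := absF_sign_mul σ (1 : F)
    simpa using this

lemma embGL_mem {κ : GL (Fin n) F} (h : κ ∈ maxCompact n F) : embGL κ ∈ maxCompact (n + 1) F := by
  refine mem_maxCompact_of_det (fun i j => ?_) ?_
  · rw [coe_embGL]
    induction i using Fin.lastCases with
    | last => induction j using Fin.lastCases with
      | last => simp
      | cast j => simp
    | cast i => induction j using Fin.lastCases with
      | last => simp
      | cast j => simpa using absF_le_one_of_mem h i j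
  · rw [coe_embGL, det_blk_row_zero, mul_one, absF_det_eq_one_of_mem h]

lemma absF_det_le_minorSup_zero (M : Matrix (Fin (n + 1)) (Fin (n + 1)) F) :
    absF M.det ≤ minorSup 0 M :=
  le_minorSup_of_equiv 0 M (Equiv.subtypeUnivEquiv fun j => Fin.zero_le j).symm id

lemma absF_last_le_minorSup (M : Matrix (Fin (n + 1)) (Fin (n + 1)) F) (q : Fin (n + 1)) :
    absF (M (Fin.last n) q) ≤ minorSup (Fin.last n) M := by
  have e : ∀ j : {j : Fin (n + 1) // Fin.last n ≤ j}, (j : Fin (n + 1)) = Fin.last n :=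
    fun j => le_antisymm (Fin.le_last _) j.2
  let f : Unit ≃ {j : Fin (n + 1) // Fin.last n ≤ j} :=
    { toFun := fun _ => ⟨Fin.last n, le_rfl⟩
      invFun := fun _ => ()
      left_inv := fun _ => rfl
      right_inv := fun j => Subtype.ext (e j).symm }
  have := le_minorSup_of_equiv (Fin.last n) M f fun _ => q
  rwa [Matrix.det_unique] at this

/-- The rows ≥ p + 1 are the rows l > p of b and the row (y, d). With the columns l > p and one more
column, either p or the last, the minor is block triangular, because that column of b vanishes in
the rows l > p. Its determinant is the product of the b_ll times y_p or d. -/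
lemma absF_mul_le_minorSup_succ {b : Matrix (Fin n) (Fin n) F} (hb : b.BlockTriangular id)
    (y : Fin n → F) (d : F) (p : Fin n) :
    (∏ l ∈ Finset.Ioi p, absF (b l l)) * max (absF d) (absF (y p)) ≤
      minorSup p.succ (blk b 0 y d) := by
  let e0 : {l : Fin n // p < l} ⊕ Unit → {r : Fin (n + 1) // p.succ ≤ r} :=
    Sum.elim (fun l => ⟨l.1.castSucc, Fin.succ_le_castSucc_iff.mpr l.2⟩)
      fun _ => ⟨Fin.last n, Fin.le_last _⟩
  have hbij : Function.Bijective e0 := by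
    constructor
    · rintro (l | l) (l' | l') h
      · simpa [e0, Subtype.ext_iff] using h
      · simp [e0, Fin.castSucc_ne_last] at h
      · simp [e0, (Fin.castSucc_ne_last _).symm] at h
      · rfl
    · rintro ⟨r, hr⟩
      induction r using Fin.lastCases with
      | last => exact ⟨Sum.inr (), rfl⟩
      | cast l => exact ⟨Sum.inl ⟨l, Fin.succ_le_castSucc_iff.mp hr⟩, rfl⟩
  have key : ∀ q : Fin (n + 1), (∀ l : Fin n, p < l → blk b 0 y d l.castSucc q = 0) →
      (∏ l ∈ Finset.Ioi p, absF (b l l)) * absF (blk b 0 y d (Fin.last n) q) ≤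
        minorSup p.succ (blk b 0 y d) := by
    intro q hq
    have h1 := le_minorSup_of_equiv p.succ (blk b 0 y d) (Equiv.ofBijective e0 hbij)
      (Sum.elim (fun l => l.1.castSucc) fun _ => q)
    have h2 : (blk b 0 y d).submatrix (fun x => (Equiv.ofBijective e0 hbij x : Fin (n + 1)))
        (Sum.elim (fun l : {l : Fin n // p < l} => l.1.castSucc) fun _ : Unit => q) =
        Matrix.fromBlocks (b.submatrix (Subtype.val : {l : Fin n // p < l} → Fin n) Subtype.val) 0
          (Matrix.of fun _ l => y l) (Matrix.of fun _ _ => blk b 0 y d (Fin.last n) q) := by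
      ext (i | i) (j | j)
      · simp [e0]
      · simpa [e0] using hq i i.2
      · simp [e0]
      · simp [e0]
    rw [h2, Matrix.det_fromBlocks_zero₁₂, Matrix.det_of_isUpperTriangular, absF_mul,
      Matrix.det_unique, Matrix.of_apply, absF_prod] at h1
    · rwa [Finset.prod_subtype (Finset.Ioi p) (p := fun l => p < l) (by simp)]
    · intro i j hij
      exact hb hij
  rcases le_total (absF d) (absF (y p)) with h | h
  · rw [max_eq_right h]
    have := key p.castSucc fun l hl => by rw [blk_castSucc_castSucc]; exact hb hl
    rwa [blk_last_castSucc] at this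
  · rw [max_eq_left h]
    have := key (Fin.last n) fun l hl => by simp
    rwa [blk_last_last] at this

/-- The top factor of `prodMinors` is bounded below by |det|, and the diagonal entries of b
reassemble into `prodMinors b`. The lower bounds β are left free because the truncated row integral
needs a better one for the last index. -/
lemma prodMinors_blk_ge_of_bounds {b : Matrix (Fin n) (Fin n) F} (hb : b.BlockTriangular id)
    (y : Fin n → F) (d : F) {β : Fin n → ℝ} (hβ0 : ∀ p, 0 ≤ β p)
    (hβ : ∀ p, (∏ l ∈ Finset.Ioi p, absF (b l l)) * β p ≤ minorSup p.succ (blk b 0 y d)) :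
    absF d * prodMinors b * ∏ p, β p ≤ prodMinors (blk b 0 y d) := by
  have h1 := absF_det_le_minorSup_zero (blk b 0 y d)
  rw [det_blk_col_zero, Matrix.det_of_isUpperTriangular hb, absF_mul, absF_prod] at h1
  have h2 : ∏ p, (∏ l ∈ Finset.Ioi p, absF (b l l)) * β p ≤
      ∏ p : Fin n, minorSup p.succ (blk b 0 y d) :=
    Finset.prod_le_prod (fun p _ => mul_nonneg (Finset.prod_nonneg fun _ _ => absF_nonneg _)
      (hβ0 p)) fun p _ => hβ p
  have h3 : prodMinors b = (∏ i, absF (b i i)) * ∏ p, ∏ l ∈ Finset.Ioi p, absF (b l l) := by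
    rw [prodMinors_upper hb, ← prod_prod_Ici, ← Finset.prod_mul_distrib]
    refine Finset.prod_congr rfl fun p _ => ?_
    rw [← Finset.Ioi_insert, Finset.prod_insert (by simp)]
  rw [h3, prodMinors, Fin.prod_univ_succ]
  refine le_trans (le_of_eq ?_) (mul_le_mul h1 h2 (Finset.prod_nonneg fun p _ =>
    mul_nonneg (Finset.prod_nonneg fun _ _ => absF_nonneg _) (hβ0 p)) (minorSup_nonneg _ _))
  rw [Finset.prod_mul_distrib]
  ring

lemma prodMinors_blk_ge {b : Matrix (Fin n) (Fin n) F} (hb : b.BlockTriangular id)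
    (y : Fin n → F) (d : F) :
    absF d * prodMinors b * ∏ p, max (absF d) (absF (y p)) ≤ prodMinors (blk b 0 y d) :=
  prodMinors_blk_ge_of_bounds hb y d (fun _ => (absF_nonneg d).trans (le_max_left _ _))
    fun p => absF_mul_le_minorSup_succ hb y d p

/-! ### Cartan decomposition -/

lemma prod_le_prod_Ici_of_monotone {t : Fin n → ℝ} (h0 : ∀ i, 0 ≤ t i) (hm : Monotone t) (i : Fin n)
    {S : Finset (Fin n)} (hS : S.card = (Finset.Ici i).card) :
    ∏ j ∈ S, t j ≤ ∏ j ∈ Finset.Ici i, t j := by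
  rw [← Finset.prod_inter_mul_prod_sdiff S (Finset.Ici i),
    ← Finset.prod_inter_mul_prod_sdiff (Finset.Ici i) S, Finset.inter_comm]
  refine mul_le_mul_of_nonneg_left ?_ (Finset.prod_nonneg fun _ _ => h0 _)
  have hc : (S \ Finset.Ici i).card = (Finset.Ici i \ S).card := Finset.card_sdiff_comm hS
  calc ∏ j ∈ S \ Finset.Ici i, t j ≤ t i ^ (S \ Finset.Ici i).card :=
        prod_le_pow_card_of_nonneg _ (fun _ _ => h0 _) fun j hj => hm (by
          simp only [Finset.mem_sdiff, Finset.mem_Ici, not_le] at hj; exact hj.2.le)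
    _ = ∏ j ∈ Finset.Ici i \ S, t i := by rw [hc, Finset.prod_const]
    _ ≤ ∏ j ∈ Finset.Ici i \ S, t j := Finset.prod_le_prod (fun _ _ => h0 _) fun j hj => hm (by
          simp only [Finset.mem_sdiff, Finset.mem_Ici] at hj; exact hj.1)

/-- A minor of `κ * diagonal m` is an integral minor of κ times a product of distinct entries of m,
and the product over `Ici i` is the largest one since |m| is increasing. Hence increasing diagonal
matrices minimize `sph` on their left K-orbit. -/
lemma minorSup_mul_diagonal_le {κ : Matrix (Fin n) (Fin n) F} (hκ : ∀ i j, absF (κ i j) ≤ 1)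
    {m : Fin n → F} (hm : Monotone fun i => absF (m i)) (i : Fin n) :
    minorSup i (κ * Matrix.diagonal m) ≤ ∏ j ∈ Finset.Ici i, absF (m j) := by
  refine minorSup_le fun c => ?_
  have hnn : 0 ≤ ∏ j ∈ Finset.Ici i, absF (m j) := Finset.prod_nonneg fun _ _ => absF_nonneg _
  by_cases hc : Function.Injective c
  · have e : (κ * Matrix.diagonal m).submatrix (Subtype.val : {j : Fin n // i ≤ j} → Fin n) c =
        Matrix.of fun x y => m (c y) * κ.submatrix Subtype.val c x y := by
      ext x y; simp [mul_comm]
    rw [e, Matrix.det_mul_row, absF_mul, absF_prod]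
    have h1 := absF_det_le (A := κ.submatrix Subtype.val c) zero_le_one fun _ _ => hκ _ _
    rw [one_pow] at h1
    refine (mul_le_of_le_one_right (Finset.prod_nonneg fun _ _ => absF_nonneg _) h1).trans ?_
    rw [← Finset.prod_image (s := Finset.univ) (g := c) (f := fun j => absF (m j))
      (fun _ _ _ _ h => hc h)]
    refine prod_le_prod_Ici_of_monotone (fun _ => absF_nonneg _) hm i ?_
    rw [Finset.card_image_of_injective _ hc, Finset.card_univ, Fintype.card_subtype]
    congr 1
    ext; simp
  · simp only [Function.Injective, not_forall] at hc
    obtain ⟨x, y, hxy, hne⟩ := hc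
    rw [Matrix.det_zero_of_column_eq hne fun r => by simp [hxy], absF_zero]
    exact hnn

lemma absF_mul_mul_mem_le {M : Matrix (Fin n) (Fin n) F} {r : ℝ} (hr : 0 ≤ r)
    (hM : ∀ i j, absF (M i j) ≤ r) {κ κ' : GL (Fin n) F} (h : κ ∈ maxCompact n F)
    (h' : κ' ∈ maxCompact n F) (i j : Fin n) :
    absF (((κ : Matrix (Fin n) (Fin n) F) * M * κ') i j) ≤ r := by
  have := absF_mul_apply_le (by simpa using hr) zero_le_one
    (absF_mul_apply_le zero_le_one hr (absF_le_one_of_mem h) hM) (absF_le_one_of_mem h') i j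
  simpa using this

/-- Permutations bring an entry of largest absolute value to the last corner. Its row and column are
cleared by integral operations, because quotients by a largest entry are integral, and the remaining
corner is treated by induction. The pivot dominates what remains, whence the monotonicity. -/
theorem cartan : ∀ {n : ℕ} (M : Matrix (Fin n) (Fin n) F), ∃ κ ∈ maxCompact n F,
    ∃ κ' ∈ maxCompact n F, ∃ m : Fin n → F, (Monotone fun i => absF (m i)) ∧
      (κ : Matrix (Fin n) (Fin n) F) * M * κ' = Matrix.diagonal m := by
  intro n
  induction n with
  | zero => exact fun M => ⟨1, one_mem _, 1, one_mem _, 0, fun i => i.elim0, by ext i; exact i.elim0⟩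
  | succ n ih =>
    intro M
    obtain ⟨⟨i₀, j₀⟩, h₀⟩ := Finite.exists_max fun p : Fin (n + 1) × Fin (n + 1) =>
      absF (M p.1 p.2)
    by_cases hz : M i₀ j₀ = 0
    · refine ⟨1, one_mem _, 1, one_mem _, 0, fun i j _ => le_rfl, ?_⟩
      ext i j
      have := h₀ (i, j)
      simp only [hz, absF_zero] at this
      have := absF_eq_zero.mp (le_antisymm this (absF_nonneg _))
      simp [this]
    let σ := Equiv.swap i₀ (Fin.last n)
    let τ := Equiv.swap j₀ (Fin.last n)
    set N := M.submatrix σ τ with hN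
    have hσ : σ (Fin.last n) = i₀ := by simp [σ]
    have hτ : τ (Fin.last n) = j₀ := by simp [τ]
    set d := N (Fin.last n) (Fin.last n) with hd
    have hdM : d = M i₀ j₀ := by simp [hd, hN, hσ, hτ]
    have hd0 : d ≠ 0 := hdM ▸ hz
    have hdpos := absF_pos hd0
    have hmax : ∀ i j, absF (N i j) ≤ absF d := fun i j => by rw [hdM]; exact h₀ (σ i, τ j)
    set A := N.submatrix Fin.castSucc Fin.castSucc with hA
    set x : Fin n → F := fun i => N i.castSucc (Fin.last n) with hx
    set y : Fin n → F := fun j => N (Fin.last n) j.castSucc with hy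
    have hNb : N = blk A x y d := (blk_eta N).symm
    have hunit : ∀ z : Fin n → F, (∀ i, absF (z i) ≤ absF d) → ∀ i, absF ((-(d⁻¹ • z)) i) ≤ 1 := by
      intro z hz i
      rw [Pi.neg_apply, absF_neg, Pi.smul_apply, smul_eq_mul, absF_mul, absF_inv,
        inv_mul_le_iff₀ hdpos, mul_one]
      exact hz i
    have hL : ∀ a b : Fin n → F, (∀ i, absF (a i) ≤ 1) → (∀ i, absF (b i) ≤ 1) →
        ∀ i j, absF (blk (1 : Matrix (Fin n) (Fin n) F) a b 1 i j) ≤ 1 := by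
      intro a b ha hb i j
      induction i using Fin.lastCases with
      | last => induction j using Fin.lastCases with
        | last => simp
        | cast j => simpa using hb j
      | cast i => induction j using Fin.lastCases with
        | last => simpa using ha i
        | cast j =>
          rw [blk_castSucc_castSucc, Matrix.one_apply]
          split_ifs <;> simp
    let L : GL (Fin (n + 1)) F := Matrix.GeneralLinearGroup.mkOfDetNeZero
      (blk 1 (-(d⁻¹ • x)) 0 1) (by simp [det_blk_row_zero])
    let R : GL (Fin (n + 1)) F := Matrix.GeneralLinearGroup.mkOfDetNeZero
      (blk 1 0 (-(d⁻¹ • y)) 1) (by simp [det_blk_col_zero])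
    have hLm : L ∈ maxCompact (n + 1) F := mem_maxCompact_of_det
      (hL _ _ (hunit x fun i => hmax _ _) (by simp)) (by
        change absF (blk 1 (-(d⁻¹ • x)) 0 1).det = 1
        simp [det_blk_row_zero])
    have hRm : R ∈ maxCompact (n + 1) F := mem_maxCompact_of_det
      (hL _ _ (by simp) (hunit y fun i => hmax _ _)) (by
        change absF (blk 1 0 (-(d⁻¹ • y)) 1).det = 1
        simp [det_blk_col_zero])
    have hLNR : (L : Matrix (Fin (n + 1)) (Fin (n + 1)) F) * N * R =
        blk (A - d⁻¹ • Matrix.vecMulVec x y) 0 0 d := by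
      change blk 1 (-(d⁻¹ • x)) 0 1 * N * blk 1 0 (-(d⁻¹ • y)) 1 = _
      rw [hNb, blk_mul, blk_mul]
      congr 1
      · ext i j
        simp [Matrix.vecMulVec_apply, hd0]
        ring
      · ext i
        simp [hd0]
      · ext i
        simp [hd0]
      · simp
    obtain ⟨κ, hκ, κ', hκ', m, hm, hmm⟩ := ih (A - d⁻¹ • Matrix.vecMulVec x y)
    refine ⟨embGL κ * L * permGL σ, mul_mem (mul_mem (embGL_mem hκ) hLm) (permGL_mem σ),
      permGL τ.symm * R * embGL κ', mul_mem (mul_mem (permGL_mem _) hRm) (embGL_mem hκ'),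
      Fin.lastCases d m, ?_, ?_⟩
    · have hle : ∀ i, absF (m i) ≤ absF d := by
        intro i
        have h1 : m i = (Matrix.diagonal m) i i := by simp
        rw [h1, ← hmm]
        refine absF_mul_mul_mem_le (absF_nonneg d) (fun a b => ?_) hκ hκ' i i
        have := absF_mul_mul_mem_le (absF_nonneg d) hmax hLm hRm a.castSucc b.castSucc
        rwa [hLNR, blk_castSucc_castSucc] at this
      intro i j hij
      induction j using Fin.lastCases with
      | last => induction i using Fin.lastCases with
        | last => exact le_rfl
        | cast i => simpa using hle i
      | cast j => induction i using Fin.lastCases with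
        | last => exact absurd hij (not_le_of_gt (Fin.castSucc_lt_last j))
        | cast i => simpa using hm (by simpa using hij)
    · have e1 : ((permGL σ : GL (Fin (n + 1)) F) : Matrix (Fin (n + 1)) (Fin (n + 1)) F) * M *
          ((permGL τ.symm : GL (Fin (n + 1)) F) : Matrix (Fin (n + 1)) (Fin (n + 1)) F) = N := by
        rw [permGL_mul, mul_permGL]; rfl
      have e2 : ((embGL κ * L * permGL σ : GL (Fin (n + 1)) F) :
          Matrix (Fin (n + 1)) (Fin (n + 1)) F) * M *
          ((permGL τ.symm * R * embGL κ' : GL (Fin (n + 1)) F) :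
          Matrix (Fin (n + 1)) (Fin (n + 1)) F) =
          (embGL κ : GL (Fin (n + 1)) F) * ((L : Matrix (Fin (n + 1)) (Fin (n + 1)) F) * N * R) *
            (embGL κ' : GL (Fin (n + 1)) F) := by
        rw [← e1]
        simp only [Units.val_mul, Matrix.mul_assoc]
      rw [e2, hLNR, coe_embGL, coe_embGL, blk_mul, blk_mul]
      refine matrix_ext_last (fun i j => ?_) (fun i => ?_) (fun j => ?_) ?_
      · have := congrFun (congrFun hmm i) j
        simp only [Matrix.diagonal_apply] at this ⊢
        simpa using this
      · simp [Fin.castSucc_ne_last]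
      · simp [(Fin.castSucc_ne_last _).symm]
      · simp

end BorderedMinors

/-! ### Matrices with a prescribed last row, and block upper triangular matrices. -/

section LowerRow

variable {R : Type*} [Field R] {n : ℕ}

/-- The matrix which is the identity except for its last row `(y, d)`. -/
def lowGL (y : Fin n → R) (d : Rˣ) : GL (Fin (n + 1)) R where
  val := blk 1 0 y d
  inv := blk 1 0 (-((d⁻¹ : Rˣ) : R) • y) (d⁻¹ : Rˣ)
  val_inv := by rw [blk_mul]; simp [← blk_one]
  inv_val := by rw [blk_mul]; simp [← blk_one]

lemma coe_lowGL (y : Fin n → R) (d : Rˣ) :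
    ((lowGL y d : GL (Fin (n + 1)) R) : Matrix (Fin (n + 1)) (Fin (n + 1)) R) = blk 1 0 y d := rfl

lemma exists_eq_blk_of_last_row (M : GL (Fin (n + 1)) R)
    (hM : ∀ j : Fin n, M (Fin.last n) j.castSucc = 0) :
    ∃ (h : GL (Fin n) R) (x x' : Fin n → R) (d : Rˣ),
      (M : Matrix (Fin (n + 1)) (Fin (n + 1)) R) = blk h x 0 d ∧
      ((M⁻¹ : GL (Fin (n + 1)) R) : Matrix (Fin (n + 1)) (Fin (n + 1)) R) =
        blk (h⁻¹ : GL (Fin n) R) x' 0 (d⁻¹ : Rˣ) := by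
  set A : Matrix (Fin n) (Fin n) R :=
    (M : Matrix (Fin (n + 1)) (Fin (n + 1)) R).submatrix Fin.castSucc Fin.castSucc
  set x : Fin n → R := fun i => M i.castSucc (Fin.last n)
  have e : (M : Matrix (Fin (n + 1)) (Fin (n + 1)) R) = blk A x 0 (M (Fin.last n) (Fin.last n)) := by
    refine Eq.trans (blk_eta _).symm ?_
    congr 1
    funext j
    exact hM j
  have hdet : A.det * M (Fin.last n) (Fin.last n) ≠ 0 := by
    rw [← det_blk_row_zero A x, ← e]
    exact (Matrix.GeneralLinearGroup.det M).ne_zero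
  set d : Rˣ := Units.mk0 _ (right_ne_zero_of_mul hdet)
  set h : GL (Fin n) R := Matrix.GeneralLinearGroup.mkOfDetNeZero A (left_ne_zero_of_mul hdet)
  have e' : (M : Matrix (Fin (n + 1)) (Fin (n + 1)) R) = blk h x 0 d := e
  refine ⟨h, x, -(((d⁻¹ : Rˣ) : R) • ((h⁻¹ : GL (Fin n) R) : Matrix (Fin n) (Fin n) R).mulVec x), d,
    e', ?_⟩
  refine Units.inv_eq_of_mul_eq_one_right ?_
  rw [e', blk_mul, ← Units.val_mul, mul_inv_cancel, Matrix.mulVec_neg, Matrix.mulVec_smul,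
    Matrix.mulVec_mulVec, ← Units.val_mul, mul_inv_cancel]
  simp [← blk_one]

end LowerRow

/-! ### Averaging `sph` over the corner subgroup. -/

section XiBound

variable {F : Type*} [Field F] [ValuativeRel F] [TopologicalSpace F] [IsNonarchimedeanLocalField F]
variable {n : ℕ}

lemma lowGL_mem {y : Fin n → F} (hy : ∀ p, absF (y p) ≤ 1) {d : Fˣ} (hd : absF (d : F) = 1) :
    lowGL y d ∈ maxCompact (n + 1) F := by
  refine mem_maxCompact_of_det (fun i j => ?_) ?_
  · rw [coe_lowGL]
    induction i using Fin.lastCases with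
    | last => induction j using Fin.lastCases with
      | last => simp [hd]
      | cast j => simpa using hy j
    | cast i => induction j using Fin.lastCases with
      | last => simp
      | cast j => simp only [blk_castSucc_castSucc, Matrix.one_apply]; split_ifs <;> simp
  · rw [coe_lowGL, det_blk_col_zero, Matrix.det_one, one_mul, hd]

lemma prodMinors_blk_row_zero (h : GL (Fin n) F) (x : Fin n → F) (d : F) :
    prodMinors (blk (h : Matrix (Fin n) (Fin n) F) x 0 d) =
      absF d ^ (n + 1) * prodMinors (h : Matrix (Fin n) (Fin n) F) := by
  obtain ⟨a, u, hu, κ, hκ, rfl⟩ := iwasawa h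
  have hb : ((diagGL a * u : GL (Fin n) F) : Matrix (Fin n) (Fin n) F).BlockTriangular id :=
    (diagGL_upper a).mul (unipotent_upper hu)
  have e : blk ((diagGL a * u * κ : GL (Fin n) F) : Matrix (Fin n) (Fin n) F) x 0 d =
      blk ((diagGL a * u : GL (Fin n) F) : Matrix (Fin n) (Fin n) F) x 0 d *
        (embGL κ : GL (Fin (n + 1)) F) := by
    rw [coe_embGL, blk_mul, Units.val_mul _ κ]
    simp
  rw [e, prodMinors_mul_mem _ (embGL_mem hκ), prodMinors_upper (blk_upper hb x d),
    Units.val_mul _ κ, prodMinors_mul_mem _ hκ, prodMinors_upper hb, Fin.prod_univ_castSucc,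
    mul_comm]
  simp

/-- On block upper triangular matrices `sph` is `sph` of the corner times a factor depending only on
d and |det h|. That factor is unchanged when h is multiplied by an element of K_n. -/
lemma sph_of_eq_blk {M : GL (Fin (n + 1)) F} {h : GL (Fin n) F} {x : Fin n → F} {d : F}
    (e : (M : Matrix (Fin (n + 1)) (Fin (n + 1)) F) = blk (h : Matrix (Fin n) (Fin n) F) x 0 d) :
    sph M = (absF d ^ (((n : ℝ) + 2) / 2) / absF d ^ (n + 1) *
      absF (h : Matrix (Fin n) (Fin n) F).det ^ (1 / 2 : ℝ)) * sph h := by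
  have hd := absF_det_pos h
  rw [sph, sph, e, prodMinors_blk_row_zero, det_blk_row_zero, absF_mul,
    Real.mul_rpow (absF_nonneg _) (absF_nonneg _)]
  have : ((n + 1 : ℕ) + 1 : ℝ) / 2 = ((n : ℝ) + 1) / 2 + 1 / 2 := by push_cast; ring
  rw [this, Real.rpow_add hd]
  have : ((n : ℝ) + 1) / 2 + 1 / 2 = ((n : ℝ) + 2) / 2 := by ring
  rw [this]
  ring

variable [MeasurableSpace (GL (Fin n) F)] [BorelSpace (GL (Fin n) F)]

/-- The Iwasawa decomposition makes N upper triangular. The average then becomes a constant times Ξ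
of the corner h, to which the bound in size n applies, and the constant times `sph h` is `sph N`
again. -/
lemma lintegral_sph_embGL_le_of_last_row {C : ℝ} {e : ℕ}
    (hQ : ∀ g : GL (Fin n) F, Xi g ≤ C * sigma g ^ e * sph g) (hC : 0 ≤ C)
    (N : GL (Fin (n + 1)) F) :
    ∫⁻ κ : maxCompact n F, ENNReal.ofReal (sph (embGL (κ : GL (Fin n) F) * N)) ∂haarK ≤
      ENNReal.ofReal (C * sigma N ^ e * sph N) := by
  obtain ⟨a, u, hu, κ', hκ', rfl⟩ := iwasawa N
  set b : GL (Fin (n + 1)) F := diagGL a * u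
  have hb : (b : Matrix (Fin (n + 1)) (Fin (n + 1)) F).BlockTriangular id :=
    (diagGL_upper a).mul (unipotent_upper hu)
  simp only [← mul_assoc, sph_mul_mem _ hκ', sigma_mul_mem _ hκ']
  obtain ⟨h, x, x', d, h1, h2⟩ := exists_eq_blk_of_last_row b fun j => hb (Fin.castSucc_lt_last j)
  have h3 : ∀ κ : maxCompact n F, sph (embGL (κ : GL (Fin n) F) * b) =
      (absF (d : F) ^ (((n : ℝ) + 2) / 2) / absF (d : F) ^ (n + 1) *
        absF (h : Matrix (Fin n) (Fin n) F).det ^ (1 / 2 : ℝ)) *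
        sph ((κ : GL (Fin n) F) * h) := by
    intro κ
    have : ((embGL (κ : GL (Fin n) F) * b : GL (Fin (n + 1)) F) :
        Matrix (Fin (n + 1)) (Fin (n + 1)) F) =
        blk ((((κ : GL (Fin n) F) * h : GL (Fin n) F)) : Matrix (Fin n) (Fin n) F)
          (((κ : GL (Fin n) F) : Matrix (Fin n) (Fin n) F).mulVec x) 0 d := by
      rw [Units.val_mul, coe_embGL, h1, blk_mul, Units.val_mul]
      simp
    rw [sph_of_eq_blk this, Units.val_mul, Matrix.det_mul, absF_mul, absF_det_eq_one_of_mem κ.2,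
      one_mul]
  have hσ : sigma h ≤ sigma b := by
    refine sigma_le (one_le_sigma b) (fun i j => ?_) fun i j => ?_
    · have := absF_le_exp_sigma b i.castSucc j.castSucc
      rwa [h1, blk_castSucc_castSucc] at this
    · have := absF_inv_le_exp_sigma b i.castSucc j.castSucc
      rwa [h2, blk_castSucc_castSucc] at this
  have hc : 0 ≤ absF (d : F) ^ (((n : ℝ) + 2) / 2) / absF (d : F) ^ (n + 1) *
        absF (h : Matrix (Fin n) (Fin n) F).det ^ (1 / 2 : ℝ) := by
    have := absF_nonneg (d : F)
    have := absF_det_pos h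
    positivity
  simp only [h3, ENNReal.ofReal_mul hc]
  rw [lintegral_const_mul _ (continuous_sph_mul h).measurable.ennreal_ofReal, ← ofReal_Xi,
    ← ENNReal.ofReal_mul hc, sph_of_eq_blk h1]
  refine ENNReal.ofReal_le_ofReal ?_
  rw [mul_left_comm]
  refine mul_le_mul_of_nonneg_left ((hQ h).trans ?_) hc
  have := (sph_pos h).le
  have := (sigma_pos h).le
  gcongr

/-- Here p is `embGL h` up to an upper triangular factor in K, which `sph` does not see, and h is
absorbed by invariance of the measure on K_n. The freedom in p serves to replace an element of K by
one with the same last row. -/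
lemma lintegral_sph_embGL_le {C : ℝ} {e : ℕ}
    (hQ : ∀ g : GL (Fin n) F, Xi g ≤ C * sigma g ^ e * sph g) (hC : 0 ≤ C)
    (N : GL (Fin (n + 1)) F) {p : GL (Fin (n + 1)) F} (hp : p ∈ maxCompact (n + 1) F)
    (hp0 : ∀ j : Fin n, p (Fin.last n) j.castSucc = 0) :
    ∫⁻ κ : maxCompact n F, ENNReal.ofReal (sph (embGL (κ : GL (Fin n) F) * N)) ∂haarK ≤
      ENNReal.ofReal (C * sigma N ^ e * sph (p * N)) := by
  obtain ⟨h, x, x', d, h1, h2⟩ := exists_eq_blk_of_last_row p hp0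
  have hd : absF (d : F) = 1 := by
    have h3 := absF_le_one_of_mem hp (Fin.last n) (Fin.last n)
    have h4 := absF_le_one_of_mem (inv_mem hp) (Fin.last n) (Fin.last n)
    rw [h1, blk_last_last] at h3
    rw [h2, blk_last_last, Units.val_inv_eq_inv_val, absF_inv,
      inv_le_one₀ (absF_pos d.ne_zero)] at h4
    exact le_antisymm h3 h4
  have hh : h ∈ maxCompact n F := by
    refine mem_maxCompact_of_det (fun i j => ?_) ?_
    · have := absF_le_one_of_mem hp i.castSucc j.castSucc
      rwa [h1, blk_castSucc_castSucc] at this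
    · have := absF_det_eq_one_of_mem hp
      rwa [h1, det_blk_row_zero, absF_mul, hd, mul_one] at this
  have hv : ((p * (embGL h)⁻¹ : GL (Fin (n + 1)) F) :
      Matrix (Fin (n + 1)) (Fin (n + 1)) F) = blk 1 x 0 d := by
    rw [← map_inv, Units.val_mul, coe_embGL, h1, blk_mul, ← Units.val_mul, mul_inv_cancel]
    simp
  have hpN : sph (p * N) = sph (embGL h * N) := by
    rw [show p * N = (p * (embGL h)⁻¹) * (embGL h * N) by group, sph_upper_mul, sph_of_mem, one_mul]
    · exact mul_mem hp (inv_mem (embGL_mem hh))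
    · rw [hv]; exact blk_upper Matrix.blockTriangular_one x d
  rw [hpN, ← sigma_mem_mul N (embGL_mem hh)]
  refine le_trans (le_of_eq ?_) (lintegral_sph_embGL_le_of_last_row hQ hC (embGL h * N))
  rw [← lintegral_mul_right_eq_self
    (fun κ : maxCompact n F => ENNReal.ofReal (sph (embGL (κ : GL (Fin n) F) * N))) ⟨h, hh⟩]
  simp only [Subgroup.coe_mul, map_mul, mul_assoc]

end XiBound

/-! ### Lower row times diagonal matrix: comparison with the diagonal matrix alone. -/

section XiBound

variable {F : Type*} [Field F] [ValuativeRel F] [TopologicalSpace F] [IsNonarchimedeanLocalField F]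
variable {n : ℕ}

/-- The permutation of `Fin (n + 1)` sending `Fin.last n` to `j` and increasing on the rest. -/
def lastTo (j : Fin (n + 1)) : Equiv.Perm (Fin (n + 1)) :=
  (finSuccEquiv' (Fin.last n)).trans (finSuccEquiv' j).symm

lemma lastTo_last (j : Fin (n + 1)) : lastTo j (Fin.last n) = j := by
  simp [lastTo]

lemma lastTo_castSucc (j : Fin (n + 1)) (l : Fin n) : lastTo j l.castSucc = j.succAbove l := by
  rw [lastTo, Equiv.trans_apply, ← Fin.succAbove_last_apply l, finSuccEquiv'_succAbove,
    finSuccEquiv'_symm_some]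

/-- Bookkeeping for the removal of index j: it belongs to `Ici p.succ` exactly when `p.castSucc <
j`, and otherwise `j.succAbove p` takes its place. -/
lemma prod_Ici_succ_eq {f : Fin (n + 1) → ℝ} (j : Fin (n + 1)) (p : Fin n) :
    ∏ r ∈ Finset.Ici p.succ, f r = if p.castSucc < j then f j * ∏ l ∈ Finset.Ioi p, f (j.succAbove l)
      else f (j.succAbove p) * ∏ l ∈ Finset.Ioi p, f (j.succAbove l) := by
  have h0 : Finset.Ici p.succ = Finset.univ.filter fun r => p.succ ≤ r := by ext; simp
  rw [h0, Finset.prod_filter, Fin.prod_univ_succAbove _ j]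
  split_ifs with h1 h2 h2
  · congr 1
    rw [← Finset.prod_filter]
    refine Finset.prod_congr ?_ fun _ _ => rfl
    ext l
    simp only [Finset.mem_filter, Finset.mem_univ, true_and, Finset.mem_Ioi]
    rcases lt_or_ge l.castSucc j with h | h
    · rw [Fin.succAbove_of_castSucc_lt _ _ h]
      simp only [Fin.le_def, Fin.lt_def, Fin.val_succ, Fin.val_castSucc] at *
      omega
    · rw [Fin.succAbove_of_le_castSucc _ _ h]
      simp only [Fin.le_def, Fin.lt_def, Fin.val_succ, Fin.val_castSucc] at *
      omega
  · simp only [Fin.le_def, Fin.lt_def, Fin.val_succ, Fin.val_castSucc] at *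
    omega
  · simp only [Fin.le_def, Fin.lt_def, Fin.val_succ, Fin.val_castSucc] at *
    omega
  · rw [one_mul, ← Finset.prod_filter, ← Finset.prod_cons (f := fun l => f (j.succAbove l))
      (s := Finset.Ioi p) (a := p) (by simp)]
    refine Finset.prod_congr ?_ fun _ _ => rfl
    ext l
    simp only [Finset.mem_filter, Finset.mem_univ, true_and, Finset.mem_cons, Finset.mem_Ioi]
    rcases lt_or_ge l.castSucc j with h | h
    · rw [Fin.succAbove_of_castSucc_lt _ _ h]
      simp only [Fin.le_def, Fin.lt_def, Fin.val_succ, Fin.val_castSucc, Fin.ext_iff] at *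
      omega
    · rw [Fin.succAbove_of_le_castSucc _ _ h]
      simp only [Fin.le_def, Fin.lt_def, Fin.val_succ, Fin.val_castSucc, Fin.ext_iff] at *
      omega

lemma prodMinors_diagonal (m : Fin n → F) :
    prodMinors (Matrix.diagonal m) = ∏ i, ∏ j ∈ Finset.Ici i, absF (m j) := by
  rw [prod_prod_Ici, prodMinors_upper (Matrix.blockTriangular_diagonal m)]
  simp

/-- In each minor either the entry m_j occurs already and `max |z_p| δ ≤ 1` suffices, or a diagonal
entry has to be replaced by z_p times itself or by m_j, which costs at most δ by the comparability
of the entries. -/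
lemma prodMinors_le_blk_diagonal {m : Fin (n + 1) → F} {δ : ℝ} (hδ0 : 0 ≤ δ) (hδ1 : δ ≤ 1)
    (hδ : ∀ i j, δ * absF (m i) ≤ absF (m j)) (j : Fin (n + 1)) {z : Fin n → F}
    (hz : ∀ p, absF (z p) ≤ 1) {u : F} (hu : absF u = 1) :
    prodMinors (Matrix.diagonal m) * ∏ p, max (absF (z p)) δ ≤
      prodMinors (blk (Matrix.diagonal fun l => m (j.succAbove l)) 0
        (fun l => z l * m (j.succAbove l)) (u * m j)) := by
  set b : Matrix (Fin n) (Fin n) F := Matrix.diagonal fun l => m (j.succAbove l)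
  have hb : b.BlockTriangular id := Matrix.blockTriangular_diagonal _
  rw [prodMinors_diagonal, prodMinors, Fin.prod_univ_succ, Fin.prod_univ_succ, mul_assoc,
    ← Finset.prod_mul_distrib]
  refine mul_le_mul ?_ (Finset.prod_le_prod (fun p _ => ?_) fun p _ => ?_) ?_ (minorSup_nonneg _ _)
  · refine le_trans (le_of_eq ?_) (absF_det_le_minorSup_zero _)
    rw [det_blk_col_zero, Matrix.det_diagonal, absF_mul, absF_mul, absF_prod, hu, one_mul,
      mul_comm, ← Fin.prod_univ_succAbove (fun i => absF (m i)) j]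
    refine Finset.prod_congr ?_ fun _ _ => rfl
    ext; simp
  · exact mul_nonneg (Finset.prod_nonneg fun _ _ => absF_nonneg _) (hδ0.trans (le_max_right _ _))
  · refine le_trans ?_ (absF_mul_le_minorSup_succ hb _ _ p)
    have hP : 0 ≤ ∏ l ∈ Finset.Ioi p, absF (m (j.succAbove l)) :=
      Finset.prod_nonneg fun _ _ => absF_nonneg _
    have hbl : ∀ l, b l l = m (j.succAbove l) := fun l => Matrix.diagonal_apply_eq _ _
    simp only [hbl]
    rw [absF_mul, absF_mul, hu, one_mul, prod_Ici_succ_eq j p]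
    split_ifs with h
    · rw [mul_right_comm, mul_comm (_ * _)]
      refine mul_le_mul_of_nonneg_left ?_ hP
      refine le_max_of_le_left ?_
      exact mul_le_of_le_one_right (absF_nonneg _) (max_le (hz p) hδ1)
    · rw [mul_right_comm, mul_comm (_ * _)]
      refine mul_le_mul_of_nonneg_left ?_ hP
      rw [mul_max_of_nonneg _ _ (absF_nonneg _), max_comm]
      refine max_le_max ?_ (mul_comm _ _).le
      rw [mul_comm]; exact hδ _ _
  · exact Finset.prod_nonneg fun _ _ => mul_nonneg (Finset.prod_nonneg fun _ _ => absF_nonneg _)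
      (hδ0.trans (le_max_right _ _))

/-- Multiplying on the right by the inverse permutation, which lies in K, turns the product into a
diagonal matrix bordered by a last row; its determinant has the same absolute value as that of G. -/
lemma sph_lowGL_mul_le {G : GL (Fin (n + 1)) F} {m : Fin (n + 1) → F}
    (hG : (G : Matrix (Fin (n + 1)) (Fin (n + 1)) F) = Matrix.diagonal m) {δ : ℝ} (hδ0 : 0 < δ)
    (hδ1 : δ ≤ 1) (hδ : ∀ i j, δ * absF (m i) ≤ absF (m j)) (j : Fin (n + 1)) {z : Fin n → F}
    (hz : ∀ p, absF (z p) ≤ 1) {u : Fˣ} (hu : absF (u : F) = 1) :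
    sph (lowGL z u * (permGL (lastTo j) * G)) ≤ sph G * ∏ p, (max (absF (z p)) δ)⁻¹ := by
  have e : ((lowGL z u * (permGL (lastTo j) * G) * (permGL (lastTo j))⁻¹ : GL (Fin (n + 1)) F) :
      Matrix (Fin (n + 1)) (Fin (n + 1)) F) =
      blk (Matrix.diagonal fun l => m (j.succAbove l)) 0
        (fun l => z l * m (j.succAbove l)) (u * m j) := by
    have h1 : ((permGL (lastTo j) * G : GL (Fin (n + 1)) F) :
        Matrix (Fin (n + 1)) (Fin (n + 1)) F) =
        blk (Matrix.diagonal fun l => m (j.succAbove l)) 0 0 (m j) *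
          ((permGL (lastTo j) : GL (Fin (n + 1)) F) : Matrix (Fin (n + 1)) (Fin (n + 1)) F) := by
      rw [mul_permGL, Units.val_mul, permGL_mul, hG]
      ext a b
      obtain ⟨b, rfl⟩ := (lastTo j).surjective b
      simp only [Matrix.submatrix_apply, id, Matrix.diagonal_apply, (lastTo j).injective.eq_iff,
        Equiv.symm_apply_apply]
      induction a using Fin.lastCases with
      | last => induction b using Fin.lastCases with
        | last => simp [lastTo_last]
        | cast b => simp [(Fin.castSucc_ne_last b).symm]
      | cast a => induction b using Fin.lastCases with
        | last => simp
        | cast b => simp [lastTo_castSucc, Matrix.diagonal_apply]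
    rw [Units.val_mul, Units.val_mul, h1, ← mul_assoc, mul_assoc, ← Units.val_mul, mul_inv_cancel,
      coe_lowGL, Units.val_one, mul_one, blk_mul]
    refine matrix_ext_last ?_ ?_ ?_ ?_ <;> simp [Matrix.vecMul_diagonal]
  have hp := permGL_mem (F := F) (lastTo j)
  rw [← sph_mul_mem _ (inv_mem hp), sph, e, sph]
  have hdet : absF (blk (Matrix.diagonal fun l => m (j.succAbove l)) 0
        (fun l => z l * m (j.succAbove l)) (u * m j)).det =
      absF (G : Matrix (Fin (n + 1)) (Fin (n + 1)) F).det := by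
    rw [← e, Units.val_mul, Units.val_mul, Units.val_mul, Matrix.det_mul, Matrix.det_mul,
      Matrix.det_mul, absF_mul, absF_mul, absF_mul, absF_det_eq_one_of_mem hp,
      absF_det_eq_one_of_mem (inv_mem hp), absF_det_eq_one_of_mem (lowGL_mem hz hu)]
    ring
  have hpos := prodMinors_pos G
  rw [hG] at hpos
  have hm : 0 < ∏ p, max (absF (z p)) δ := Finset.prod_pos fun p _ => lt_max_of_lt_right hδ0
  rw [hdet, hG, Finset.prod_inv_distrib, ← div_eq_mul_inv, div_div]
  refine div_le_div_of_nonneg_left (Real.rpow_nonneg (absF_nonneg _) _) (mul_pos hpos hm) ?_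
  exact prodMinors_le_blk_diagonal hδ0.le hδ1 hδ j hz hu

variable [MeasurableSpace (GL (Fin n) F)] [BorelSpace (GL (Fin n) F)]

/-- After averaging over the corner subgroup only the last row of `N` matters. -/
lemma lintegral_sph_embGL_le_of_lowGL {C : ℝ} {e : ℕ}
    (hQ : ∀ g : GL (Fin n) F, Xi g ≤ C * sigma g ^ e * sph g) (hC : 0 ≤ C)
    {κ : GL (Fin (n + 1)) F} (hκ : κ ∈ maxCompact (n + 1) F)
    (hu : absF (κ (Fin.last n) (Fin.last n)) = 1)
    {G : GL (Fin (n + 1)) F} {m : Fin (n + 1) → F}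
    (hG : (G : Matrix (Fin (n + 1)) (Fin (n + 1)) F) = Matrix.diagonal m) {δ : ℝ} (hδ0 : 0 < δ)
    (hδ1 : δ ≤ 1) (hδ : ∀ i j, δ * absF (m i) ≤ absF (m j)) (j : Fin (n + 1)) :
    ∫⁻ κ₀ : maxCompact n F, ENNReal.ofReal
        (sph (embGL (κ₀ : GL (Fin n) F) * (κ * (permGL (lastTo j) * G)))) ∂haarK ≤
      ENNReal.ofReal (C * sigma G ^ e * sph G) *
        ∏ p : Fin n, ENNReal.ofReal (max (absF (κ (Fin.last n) p.castSucc)) δ)⁻¹ := by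
  set z : Fin n → F := fun p => κ (Fin.last n) p.castSucc
  have hz : ∀ p, absF (z p) ≤ 1 := fun p => absF_le_one_of_mem hκ _ _
  have hu0 : κ (Fin.last n) (Fin.last n) ≠ 0 := by
    intro h; rw [h, absF_zero] at hu; exact zero_ne_one hu
  set u : Fˣ := Units.mk0 _ hu0
  have hu' : absF (u : F) = 1 := hu
  -- `lowGL z u` has the last row of κ, so this product has last row (0, …, 0, 1).
  have hp : lowGL z u * κ⁻¹ ∈ maxCompact (n + 1) F := mul_mem (lowGL_mem hz hu') (inv_mem hκ)
  have hp0 : ∀ b : Fin n, (lowGL z u * κ⁻¹ : GL (Fin (n + 1)) F) (Fin.last n) b.castSucc = 0 := by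
    intro b
    have h1 : ∀ c, (lowGL z u : GL (Fin (n + 1)) F) (Fin.last n) c = κ (Fin.last n) c := by
      intro c
      rw [coe_lowGL]
      induction c using Fin.lastCases with
      | last => rw [blk_last_last]; rfl
      | cast c => rw [blk_last_castSucc]
    rw [Units.val_mul, Matrix.mul_apply]
    simp only [h1]
    rw [← Matrix.mul_apply, ← Units.val_mul, mul_inv_cancel, Units.val_one,
      Matrix.one_apply_ne (Fin.castSucc_ne_last b).symm]
  have h1 := lintegral_sph_embGL_le hQ hC (κ * (permGL (lastTo j) * G)) hp hp0
  refine h1.trans ?_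
  rw [mul_assoc (lowGL z u), inv_mul_cancel_left, sigma_mem_mul _ hκ, sigma_mem_mul _ (permGL_mem _),
    ← ENNReal.ofReal_prod_of_nonneg fun p _ => inv_nonneg.mpr (hδ0.le.trans (le_max_right _ _)),
    ← ENNReal.ofReal_mul]
  · refine ENNReal.ofReal_le_ofReal ?_
    rw [mul_assoc (C * sigma G ^ e)]
    exact mul_le_mul_of_nonneg_left (sph_lowGL_mul_le hG hδ0 hδ1 hδ j hz hu')
      (mul_nonneg hC (pow_nonneg (sigma_pos G).le _))
  · exact mul_nonneg (mul_nonneg hC (pow_nonneg (sigma_pos G).le _)) (sph_pos G).le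

end XiBound

/-! ### Integration over the elements of K whose last diagonal entry is a unit. -/

section XiBound

variable {F : Type*} [Field F] [ValuativeRel F] [TopologicalSpace F] [IsNonarchimedeanLocalField F]
variable {n : ℕ}

lemma continuous_embGL : Continuous (embGL : GL (Fin n) F → GL (Fin (n + 1)) F) := by
  have key : ∀ f : GL (Fin n) F → Matrix (Fin n) (Fin n) F, Continuous f →
      Continuous fun g => blk (f g) 0 0 1 := by
    intro f hf
    refine continuous_matrix fun i j => ?_
    induction i using Fin.lastCases with
    | last => induction j using Fin.lastCases with
      | last => simpa using continuous_const
      | cast j => simpa using continuous_const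
    | cast i => induction j using Fin.lastCases with
      | last => simpa using continuous_const
      | cast j => simpa using hf.matrix_elem i j
  refine Units.continuous_iff.mpr ⟨key _ Units.continuous_val, ?_⟩
  exact key (fun g => ((g⁻¹ : GL (Fin n) F) : Matrix (Fin n) (Fin n) F))
    (Units.continuous_val.comp continuous_inv)

instance {k : ℕ} : SecondCountableTopology (maxCompact k F) :=
  inferInstanceAs (SecondCountableTopology (maxCompact k F : Set (GL (Fin k) F)))

/-- Otherwise the last row would vanish modulo the maximal ideal, and so would the last row of `κ *
κ⁻¹ = 1`. -/
lemma exists_absF_last_eq_one {κ : GL (Fin (n + 1)) F} (h : κ ∈ maxCompact (n + 1) F) :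
    ∃ j, absF (κ (Fin.last n) j) = 1 := by
  by_contra! hne
  have h1 : ∀ j, absF (κ (Fin.last n) j) ≤ (resCard F)⁻¹ := fun j =>
    absF_lt_one_iff.mp (lt_of_le_of_ne (absF_le_one_of_mem h _ _) (hne j))
  have h2 : absF ((κ * κ⁻¹ : GL (Fin (n + 1)) F) (Fin.last n) (Fin.last n)) ≤ (resCard F)⁻¹ := by
    rw [Units.val_mul, Matrix.mul_apply]
    refine absF_sum_le _ _ (inv_nonneg.mpr (resCard_pos F).le) fun j _ => ?_
    rw [absF_mul, ← mul_one (resCard F)⁻¹]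
    exact mul_le_mul (h1 j) (absF_le_one_of_mem (inv_mem h) _ _) (absF_nonneg _)
      (inv_nonneg.mpr (resCard_pos F).le)
  rw [mul_inv_cancel, Units.val_one, Matrix.one_apply_eq, absF_one] at h2
  exact absurd h2 (not_le.mpr (inv_lt_one_of_one_lt₀ (one_lt_resCard F)))

variable [MeasurableSpace (GL (Fin (n + 1)) F)] [BorelSpace (GL (Fin (n + 1)) F)]

lemma measurableSet_absF_last_eq_one : MeasurableSet
    {κ : maxCompact (n + 1) F | absF ((κ : GL (Fin (n + 1)) F) (Fin.last n) (Fin.last n)) = 1} := by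
  refine (isClosed_eq (continuous_absF.comp ?_) continuous_const).measurableSet
  exact (Units.continuous_val.comp continuous_subtype_val).matrix_elem _ _

variable [MeasurableSpace (GL (Fin n) F)] [BorelSpace (GL (Fin n) F)]

lemma lintegral_haarK_eq_lintegral_embGL {f : maxCompact (n + 1) F → ENNReal} (hf : Measurable f) :
    ∫⁻ κ, f κ ∂haarK = ∫⁻ κ, ∫⁻ κ₀ : maxCompact n F,
      f (⟨embGL (κ₀ : GL (Fin n) F), embGL_mem κ₀.2⟩ * κ) ∂haarK ∂haarK := by
  rw [lintegral_lintegral_swap]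
  · simp only [lintegral_mul_left_eq_self f, lintegral_const, measure_univ, mul_one]
  · refine (hf.comp (Continuous.measurable ?_)).aemeasurable
    refine Continuous.mul ?_ continuous_fst
    exact (continuous_embGL.comp (continuous_subtype_val.comp continuous_snd)).subtype_mk _

variable [MeasurableSpace F] [BorelSpace F]

/-- The set S is stable under left multiplication by the corner K_n and right multiplication by
`lowGL y 1` with y integral. The left average leaves only the last row (z, u) of κ; the right
translation replaces z_p by z_p + u y_p. Averaging over y gives n independent logarithmic integrals.
-/
lemma setLIntegral_sph_le {C : ℝ} {e : ℕ}
    (hQ : ∀ g : GL (Fin n) F, Xi g ≤ C * sigma g ^ e * sph g) (hC : 0 ≤ C)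
    {G : GL (Fin (n + 1)) F} {m : Fin (n + 1) → F}
    (hG : (G : Matrix (Fin (n + 1)) (Fin (n + 1)) F) = Matrix.diagonal m) {δ : ℝ} (hδ0 : 0 < δ)
    (hδ1 : δ ≤ 1) (hδ : ∀ i j, δ * absF (m i) ≤ absF (m j)) (j : Fin (n + 1)) :
    ∫⁻ κ in {κ : maxCompact (n + 1) F |
        absF ((κ : GL (Fin (n + 1)) F) (Fin.last n) (Fin.last n)) = 1},
      ENNReal.ofReal (sph ((κ : GL (Fin (n + 1)) F) * (permGL (lastTo j) * G))) ∂haarK ≤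
      ENNReal.ofReal (C * sigma G ^ e * sph G) * ENNReal.ofReal (2 + 2 * Real.log δ⁻¹) ^ n := by
  set S : Set (maxCompact (n + 1) F) :=
    {κ | absF ((κ : GL (Fin (n + 1)) F) (Fin.last n) (Fin.last n)) = 1}
  have hS : MeasurableSet S := measurableSet_absF_last_eq_one
  set X : GL (Fin (n + 1)) F := permGL (lastTo j) * G
  set f : maxCompact (n + 1) F → ENNReal :=
    S.indicator fun κ => ENNReal.ofReal (sph ((κ : GL (Fin (n + 1)) F) * X))
  have hf : Measurable f := (continuous_sph_mul X).measurable.ennreal_ofReal.indicator hS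
  set Φ := ENNReal.ofReal (C * sigma G ^ e * sph G)
  set w : maxCompact (n + 1) F → Fin n → F → ENNReal := fun κ p t => ENNReal.ofReal
    (max (absF ((κ : GL (Fin (n + 1)) F) (Fin.last n) p.castSucc +
      (κ : GL (Fin (n + 1)) F) (Fin.last n) (Fin.last n) * t)) δ)⁻¹
  have hw : ∀ p, Measurable fun a : F × maxCompact (n + 1) F => w a.2 p a.1 := by
    intro p
    have hc : ∀ q, Measurable fun a : F × maxCompact (n + 1) F =>
        (a.2 : GL (Fin (n + 1)) F) (Fin.last n) q := fun q =>
      ((Units.continuous_val.comp continuous_subtype_val).matrix_elem _ _).measurable.comp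
        measurable_snd
    refine Measurable.ennreal_ofReal (Measurable.inv (Measurable.max ?_ measurable_const))
    exact measurable_absF.comp ((hc _).add ((hc _).mul measurable_fst))
  have h1 : ∀ y : Fin n → F, (∀ p, absF (y p) ≤ 1) →
      ∫⁻ κ, f κ ∂haarK ≤ ∫⁻ κ in S, Φ * ∏ p, w κ p (y p) ∂haarK := by
    intro y hy
    have hN : lowGL y 1 ∈ maxCompact (n + 1) F := lowGL_mem hy (by simp)
    have h0 := lintegral_haarK_eq_lintegral_embGL
      (hf.comp (measurable_mul_const (⟨lowGL y 1, hN⟩ : maxCompact (n + 1) F)))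
    simp only [Function.comp_apply] at h0
    rw [← lintegral_mul_right_eq_self f ⟨lowGL y 1, hN⟩, h0, ← lintegral_indicator hS]
    refine lintegral_mono fun κ => ?_
    have hlast : ((κ : GL (Fin (n + 1)) F) * lowGL y 1 : GL (Fin (n + 1)) F)
        (Fin.last n) (Fin.last n) = (κ : GL (Fin (n + 1)) F) (Fin.last n) (Fin.last n) := by
      rw [Units.val_mul, Matrix.mul_apply, Fin.sum_univ_castSucc, coe_lowGL]
      simp
    have hcast : ∀ p : Fin n, ((κ : GL (Fin (n + 1)) F) * lowGL y 1 : GL (Fin (n + 1)) F)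
        (Fin.last n) p.castSucc = (κ : GL (Fin (n + 1)) F) (Fin.last n) p.castSucc +
          (κ : GL (Fin (n + 1)) F) (Fin.last n) (Fin.last n) * y p := by
      intro p
      rw [Units.val_mul, Matrix.mul_apply, Fin.sum_univ_castSucc, coe_lowGL]
      simp [Matrix.one_apply]
    by_cases hκ : κ ∈ S
    · rw [Set.indicator_of_mem hκ]
      have h2 := lintegral_sph_embGL_le_of_lowGL hQ hC (mul_mem κ.2 hN)
        (by rw [hlast]; exact hκ) hG hδ0 hδ1 hδ j
      simp only [hcast] at h2
      refine le_trans (lintegral_mono fun κ₀ => ?_) h2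
      refine (Set.indicator_le_self _ _ _).trans (le_of_eq ?_)
      simp only [Subgroup.coe_mul, mul_assoc, X]
    -- Neither multiplication changes the last diagonal entry, so outside S the average is zero.
    · rw [Set.indicator_of_notMem hκ, nonpos_iff_eq_zero, lintegral_eq_zero_iff']
      · refine Filter.Eventually.of_forall fun κ₀ => Set.indicator_of_notMem ?_ _
        intro hmem
        refine hκ ?_
        have h3 : absF ((embGL (κ₀ : GL (Fin n) F) * ((κ : GL (Fin (n + 1)) F) * lowGL y 1) :
          GL (Fin (n + 1)) F) (Fin.last n) (Fin.last n)) = 1 := by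
          have h4 : absF ((embGL (κ₀ : GL (Fin n) F) * (κ : GL (Fin (n + 1)) F) * lowGL y 1 :
            GL (Fin (n + 1)) F) (Fin.last n) (Fin.last n)) = 1 := hmem
          rwa [mul_assoc] at h4
        rw [Units.val_mul, Matrix.mul_apply, Fin.sum_univ_castSucc, coe_embGL] at h3
        simp only [blk_last_castSucc, Pi.zero_apply, zero_mul, Finset.sum_const_zero, zero_add,
          blk_last_last, one_mul] at h3
        rwa [hlast] at h3
      · refine (hf.comp (Continuous.measurable ?_)).aemeasurable
        refine Continuous.mul (Continuous.mul ?_ continuous_const) continuous_const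
        exact (continuous_embGL.comp continuous_subtype_val).subtype_mk _
  set O : Set F := {t | absF t ≤ 1}
  have hO : MeasurableSet O := measurableSet_absF_le 1
  -- The integral of f does not depend on y, so it may be averaged over the box of integral y, which
  -- has mass 1.
  have hbox : ∫⁻ y : Fin n → F, ∏ p, O.indicator 1 (y p) ∂haarVec F (Fin n) = 1 := by
    rw [lintegral_haarVec_prod fun _ => measurable_one.indicator hO]
    simp [lintegral_indicator_one hO, O, haarF_unitBall]
  have hwO : ∀ p, Measurable fun a : F × maxCompact (n + 1) F =>
      O.indicator (1 : F → ENNReal) a.1 * w a.2 p a.1 := fun p =>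
    ((measurable_one.indicator hO).comp measurable_fst).mul (hw p)
  rw [← lintegral_indicator hS]
  change ∫⁻ κ, f κ ∂haarK ≤ _
  calc ∫⁻ κ, f κ ∂haarK
      = ∫⁻ y : Fin n → F, (∫⁻ κ, f κ ∂haarK) * ∏ p, O.indicator 1 (y p) ∂haarVec F (Fin n) := by
        rw [lintegral_const_mul, hbox, mul_one]
        exact Finset.measurable_prod _ fun p _ =>
          (measurable_one.indicator hO).comp (measurable_pi_apply p)
    _ ≤ ∫⁻ y : Fin n → F, ∫⁻ κ in S, Φ * ∏ p, (O.indicator 1 (y p) * w κ p (y p)) ∂haarK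
          ∂haarVec F (Fin n) := by
        refine lintegral_mono fun y => ?_
        by_cases hy : ∀ p, absF (y p) ≤ 1
        · have hy' : ∀ p, O.indicator (1 : F → ENNReal) (y p) = 1 := fun p =>
            Set.indicator_of_mem (show y p ∈ O from hy p) _
          simp only [hy', Finset.prod_const_one, mul_one, one_mul]
          exact h1 y hy
        · push Not at hy
          obtain ⟨p, hp⟩ := hy
          rw [Finset.prod_eq_zero (Finset.mem_univ p)
            (Set.indicator_of_notMem (show y p ∉ O from not_le.mpr hp) _), mul_zero]
          exact zero_le
    _ = ∫⁻ κ in S, ∫⁻ y : Fin n → F, Φ * ∏ p, (O.indicator 1 (y p) * w κ p (y p))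
          ∂haarVec F (Fin n) ∂haarK := by
        refine lintegral_lintegral_swap (Measurable.aemeasurable ?_)
        refine measurable_const.mul (Finset.measurable_prod _ fun p _ => ?_)
        have h2 : Measurable fun a : (Fin n → F) × maxCompact (n + 1) F => (a.1 p, a.2) :=
          ((measurable_pi_apply p).comp measurable_fst).prodMk measurable_snd
        exact (hwO p).comp h2
    _ ≤ ∫⁻ κ in S, Φ * ENNReal.ofReal (2 + 2 * Real.log δ⁻¹) ^ n ∂haarK := by
        refine setLIntegral_mono' hS fun κ hκ => ?_
        have hm : ∀ p, Measurable fun t => O.indicator (1 : F → ENNReal) t * w κ p t := fun p =>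
          (hwO p).comp (measurable_id.prodMk measurable_const)
        have hmm : Measurable fun y : Fin n → F =>
            ∏ p, (O.indicator (1 : F → ENNReal) (y p) * w κ p (y p)) :=
          Finset.measurable_prod _ fun p _ => (hm p).comp (measurable_pi_apply p)
        rw [lintegral_const_mul _ hmm,
          lintegral_haarVec_prod (f := fun p t => O.indicator (1 : F → ENNReal) t * w κ p t) hm]
        refine mul_le_mul_right (le_trans (Finset.prod_le_pow_card _ _ _ fun p _ => ?_)
          (le_of_eq (by rw [Finset.card_univ, Fintype.card_fin]))) _
        have : ∀ t, O.indicator (1 : F → ENNReal) t * w κ p t = O.indicator (w κ p) t := by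
          intro t
          by_cases ht : t ∈ O <;> simp [ht]
        simp only [this]
        rw [lintegral_indicator hO]
        exact lintegral_inv_max_le (absF_le_one_of_mem κ.2 _ _) hκ hδ0 hδ1
    _ ≤ Φ * ENNReal.ofReal (2 + 2 * Real.log δ⁻¹) ^ n := by
        rw [lintegral_const, Measure.restrict_apply_univ]
        exact mul_le_of_le_one_right' prob_le_one

end XiBound

/-! ### The upper bound for Ξ, by induction on the size. -/

section XiBound

variable {F : Type*} [Field F] [ValuativeRel F] [TopologicalSpace F] [IsNonarchimedeanLocalField F]

/-- The last row of every element of K has a unit in some column j, and the permutation `lastTo j`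
moves that column to the end. -/
lemma Xi_le_sum_setLIntegral {n : ℕ} [MeasurableSpace (GL (Fin (n + 1)) F)]
    [BorelSpace (GL (Fin (n + 1)) F)] (G : GL (Fin (n + 1)) F) :
    ENNReal.ofReal (Xi G) ≤ ∑ j, ∫⁻ κ in {κ : maxCompact (n + 1) F |
        absF ((κ : GL (Fin (n + 1)) F) (Fin.last n) (Fin.last n)) = 1},
      ENNReal.ofReal (sph ((κ : GL (Fin (n + 1)) F) * (permGL (lastTo j) * G))) ∂haarK := by
  have hS := measurableSet_absF_last_eq_one (F := F) (n := n)
  set S : Set (maxCompact (n + 1) F) :=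
    {κ | absF ((κ : GL (Fin (n + 1)) F) (Fin.last n) (Fin.last n)) = 1} with hSdef
  let f : Fin (n + 1) → maxCompact (n + 1) F → ENNReal := fun j τ =>
    ENNReal.ofReal (sph ((τ : GL (Fin (n + 1)) F) * (permGL (lastTo j) * G)))
  let w : Fin (n + 1) → maxCompact (n + 1) F := fun j =>
    ⟨(permGL (lastTo j))⁻¹, inv_mem (permGL_mem _)⟩
  have hf : ∀ j, Measurable (S.indicator (f j)) := fun j =>
    (continuous_sph_mul _).measurable.ennreal_ofReal.indicator hS
  have hcover : ∀ τ : maxCompact (n + 1) F, ENNReal.ofReal (sph ((τ : GL (Fin (n + 1)) F) * G)) ≤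
      ∑ j, S.indicator (f j) (τ * w j) := by
    intro τ
    obtain ⟨j, hj⟩ := exists_absF_last_eq_one τ.2
    refine le_trans ?_ (Finset.single_le_sum (f := fun j => S.indicator (f j) (τ * w j))
      (fun _ _ => zero_le) (Finset.mem_univ j))
    have hmem : τ * w j ∈ S := by
      change absF (((τ : GL (Fin (n + 1)) F) * (permGL (lastTo j))⁻¹ : GL (Fin (n + 1)) F)
        (Fin.last n) (Fin.last n)) = 1
      have h1 : ((τ : GL (Fin (n + 1)) F) : Matrix (Fin (n + 1)) (Fin (n + 1)) F) =
          (((τ : GL (Fin (n + 1)) F) * (permGL (lastTo j))⁻¹ : GL (Fin (n + 1)) F) :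
            Matrix (Fin (n + 1)) (Fin (n + 1)) F) *
          ((permGL (lastTo j) : GL (Fin (n + 1)) F) : Matrix (Fin (n + 1)) (Fin (n + 1)) F) := by
        rw [← Units.val_mul, inv_mul_cancel_right]
      rw [mul_permGL] at h1
      rw [h1, Matrix.submatrix_apply, (Equiv.symm_apply_eq _).mpr (lastTo_last j).symm] at hj
      exact hj
    have h2 : (τ : GL (Fin (n + 1)) F) * G =
        (τ : GL (Fin (n + 1)) F) * (permGL (lastTo j))⁻¹ * (permGL (lastTo j) * G) := by group
    change _ ≤ S.indicator (f j) (τ * w j)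
    rw [Set.indicator_of_mem hmem, h2]
    exact le_rfl
  rw [ofReal_Xi]
  refine (lintegral_mono hcover).trans ?_
  have hfw : ∀ j ∈ Finset.univ, Measurable fun τ => S.indicator (f j) (τ * w j) :=
    fun j _ => (hf j).comp (measurable_mul_const (w j))
  rw [lintegral_finsetSum _ hfw]
  refine Finset.sum_le_sum fun j _ => le_of_eq ?_
  rw [lintegral_mul_right_eq_self (S.indicator (f j)) (w j), lintegral_indicator hS]

lemma Xi_diagonal_le {n : ℕ} [MeasurableSpace (GL (Fin n) F)] [BorelSpace (GL (Fin n) F)]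
    [MeasurableSpace (GL (Fin (n + 1)) F)] [BorelSpace (GL (Fin (n + 1)) F)] {C : ℝ} {e : ℕ}
    (hQ : ∀ g : GL (Fin n) F, Xi g ≤ C * sigma g ^ e * sph g) (hC : 0 ≤ C)
    {G : GL (Fin (n + 1)) F} {m : Fin (n + 1) → F}
    (hG : (G : Matrix (Fin (n + 1)) (Fin (n + 1)) F) = Matrix.diagonal m) :
    Xi G ≤ ((n + 1) * C * 6 ^ n) * sigma G ^ (e + n) * sph G := by
  let : MeasurableSpace F := borel F
  have : BorelSpace F := ⟨rfl⟩
  -- The diagonal entries lie between exp(-σ(G)) and exp(σ(G)), so any ratio is at least δ. Moreover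
  -- `2 + 2 log δ⁻¹ = 2 + 4σ(G) ≤ 6σ(G)`.
  set δ : ℝ := Real.exp (-(2 * sigma G)) with hδdef
  have hσ1 := one_le_sigma G
  have hδ1 : δ ≤ 1 := Real.exp_le_one_iff.mpr (by linarith)
  have hδ : ∀ i j, δ * absF (m i) ≤ absF (m j) := by
    intro i j
    have h1 := absF_le_exp_sigma G i i
    rw [hG, Matrix.diagonal_apply_eq] at h1
    have h2 := absF_inv_le_exp_sigma G j j
    have h3 : absF (m j) * absF ((G⁻¹ : GL (Fin (n + 1)) F) j j) = 1 := by
      have h4 : ((G * G⁻¹ : GL (Fin (n + 1)) F) j j) = 1 := by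
        rw [mul_inv_cancel, Units.val_one, Matrix.one_apply_eq]
      rw [Units.val_mul, hG, Matrix.diagonal_mul] at h4
      rw [← absF_mul, h4, absF_one]
    have h5 : Real.exp (-sigma G) ≤ absF (m j) := by
      rw [Real.exp_neg, inv_le_iff_one_le_mul₀ (Real.exp_pos _), ← h3]
      exact mul_le_mul_of_nonneg_left h2 (absF_nonneg _)
    calc δ * absF (m i) ≤ δ * Real.exp (sigma G) :=
          mul_le_mul_of_nonneg_left h1 (Real.exp_pos _).le
      _ = Real.exp (-sigma G) := by rw [hδdef, ← Real.exp_add]; congr 1; ring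
      _ ≤ _ := h5
  have hlog : Real.log δ⁻¹ = 2 * sigma G := by rw [hδdef, ← Real.exp_neg, Real.log_exp, neg_neg]
  have hσ0 := (sigma_pos G).le
  have hΦ : 0 ≤ C * sigma G ^ e * sph G :=
    mul_nonneg (mul_nonneg hC (pow_nonneg hσ0 _)) (sph_pos G).le
  have key : ENNReal.ofReal (Xi G) ≤
      ENNReal.ofReal ((n + 1) * (C * sigma G ^ e * sph G * (6 * sigma G) ^ n)) := by
    refine (Xi_le_sum_setLIntegral G).trans ?_
    refine (Finset.sum_le_sum (g := fun _ =>
      ENNReal.ofReal (C * sigma G ^ e * sph G * (6 * sigma G) ^ n)) fun j _ => ?_).trans ?_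
    · refine (setLIntegral_sph_le hQ hC hG (Real.exp_pos _) hδ1 hδ j).trans ?_
      rw [hlog, ← ENNReal.ofReal_pow (by linarith), ← ENNReal.ofReal_mul hΦ]
      refine ENNReal.ofReal_le_ofReal (mul_le_mul_of_nonneg_left ?_ hΦ)
      exact pow_le_pow_left₀ (by linarith) (by linarith) n
    · rw [Finset.sum_const, Finset.card_univ, Fintype.card_fin, nsmul_eq_mul,
        ENNReal.ofReal_mul (p := (n : ℝ) + 1) (by positivity), ← ENNReal.ofReal_natCast]
      push_cast
      rfl
  have hr : 0 ≤ (n + 1) * (C * sigma G ^ e * sph G * (6 * sigma G) ^ n) :=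
    mul_nonneg (by positivity) (mul_nonneg hΦ (by positivity))
  refine ((ENNReal.ofReal_le_ofReal_iff hr).mp key).trans (le_of_eq ?_)
  rw [mul_pow, pow_add]
  ring

/-- Both Ξ and σ are invariant under K on both sides, but `sph` only on the right. The reduction to
diagonal G works because the increasing order makes `sph G ≤ sph g`. -/
lemma exists_Xi_le_succ {n : ℕ} [MeasurableSpace (GL (Fin n) F)] [BorelSpace (GL (Fin n) F)]
    [MeasurableSpace (GL (Fin (n + 1)) F)] [BorelSpace (GL (Fin (n + 1)) F)] {C : ℝ} {e : ℕ}
    (hQ : ∀ g : GL (Fin n) F, Xi g ≤ C * sigma g ^ e * sph g) (hC : 0 ≤ C)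
    (g : GL (Fin (n + 1)) F) :
    Xi g ≤ ((n + 1) * C * 6 ^ n) * sigma g ^ (e + n) * sph g := by
  obtain ⟨κ, hκ, κ', hκ', m, hm, hd⟩ := cartan (g : Matrix (Fin (n + 1)) (Fin (n + 1)) F)
  set G : GL (Fin (n + 1)) F := κ * g * κ' with hGdef
  have hG : (G : Matrix (Fin (n + 1)) (Fin (n + 1)) F) = Matrix.diagonal m := hd
  have hXi : Xi g = Xi G := by rw [Xi_mul_mem _ hκ', Xi_mem_mul _ hκ]
  have hσ : sigma g = sigma G := by rw [sigma_mul_mem _ hκ', sigma_mem_mul _ hκ]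
  have h1 : κ⁻¹ * G = g * κ' := by rw [hGdef]; group
  have hsph : sph G ≤ sph g := by
    rw [← sph_mul_mem g hκ', ← h1]
    clear_value G
    rw [sph, sph, Units.val_mul, Matrix.det_mul, absF_mul,
      absF_det_eq_one_of_mem (inv_mem hκ), one_mul, ← Units.val_mul]
    refine div_le_div_of_nonneg_left (Real.rpow_nonneg (absF_nonneg _) _) (prodMinors_pos _) ?_
    rw [Units.val_mul, hG, prodMinors_diagonal]
    exact Finset.prod_le_prod (fun _ _ => minorSup_nonneg _ _) fun i _ =>
      minorSup_mul_diagonal_le (absF_le_one_of_mem (inv_mem hκ)) hm i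
  rw [hXi, hσ]
  refine le_trans ?_ (mul_le_mul_of_nonneg_left hsph (mul_nonneg (by positivity)
    (pow_nonneg (sigma_pos G).le _)))
  exact Xi_diagonal_le hQ hC hG

variable (F) in
/-- Harish-Chandra's upper bound for `Ξ`, in a form that does not require a dominance condition. -/
theorem exists_Xi_le (k : ℕ) : ∃ C : ℝ, 0 ≤ C ∧ ∃ e : ℕ,
    ∀ [MeasurableSpace (GL (Fin k) F)] [BorelSpace (GL (Fin k) F)] (g : GL (Fin k) F),
      Xi g ≤ C * sigma g ^ e * sph g := by
  induction k with
  | zero =>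
    refine ⟨1, zero_le_one, 0, fun g => ?_⟩
    have h : ∀ g : GL (Fin 0) F, sph g = 1 := fun g => by
      rw [Subsingleton.elim g 1, sph_one]
    rw [Xi_eq_integral_sph]
    simp [h]
  | succ n ih =>
    obtain ⟨C, hC, e, hQ⟩ := ih
    let : MeasurableSpace (GL (Fin n) F) := borel _
    have : BorelSpace (GL (Fin n) F) := ⟨rfl⟩
    exact ⟨(n + 1) * C * 6 ^ n, by positivity, e + n,
      fun g => exists_Xi_le_succ (fun g => hQ g) hC g⟩

end XiBound

/-! ### Matrices with a distinguished first row. -/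

section FirstRow

variable {R : Type*} {n : ℕ}

/-- The matrix with first row `(a, x)` and with `0` and `B` below. -/
def gcons [Zero R] (a : R) (x : Fin n → R) (B : Matrix (Fin n) (Fin n) R) :
    Matrix (Fin (n + 1)) (Fin (n + 1)) R :=
  Matrix.of (Fin.cons (Fin.cons a x) fun i => Fin.cons 0 (B i))

section Apply

variable [Zero R] (a : R) (x : Fin n → R) (B : Matrix (Fin n) (Fin n) R) (i j : Fin n)

@[simp] lemma gcons_zero_zero : gcons a x B 0 0 = a := rfl

@[simp] lemma gcons_zero_succ : gcons a x B 0 j.succ = x j := rfl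

@[simp] lemma gcons_succ_zero : gcons a x B i.succ 0 = 0 := rfl

@[simp] lemma gcons_succ_succ : gcons a x B i.succ j.succ = B i j := rfl

lemma gcons_eta {M : Matrix (Fin (n + 1)) (Fin (n + 1)) R} (hM : ∀ i : Fin n, M i.succ 0 = 0) :
    gcons (M 0 0) (fun j => M 0 j.succ) (M.submatrix Fin.succ Fin.succ) = M := by
  ext i j
  induction i using Fin.cases with
  | zero => induction j using Fin.cases <;> rfl
  | succ i => induction j using Fin.cases with
    | zero => exact (hM i).symm
    | succ j => rfl

end Apply

variable [CommRing R]

lemma gcons_mul (a a' : R) (x x' : Fin n → R) (B B' : Matrix (Fin n) (Fin n) R) :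
    gcons a x B * gcons a' x' B' = gcons (a * a') (a • x' + Matrix.vecMul x B') (B * B') := by
  ext i j
  rw [Matrix.mul_apply, Fin.sum_univ_succ]
  induction i using Fin.cases <;> induction j using Fin.cases <;>
    simp [Matrix.mul_apply, Matrix.vecMul, dotProduct]

lemma gcons_one : gcons (1 : R) 0 (1 : Matrix (Fin n) (Fin n) R) = 1 := by
  ext i j
  induction i using Fin.cases <;> induction j using Fin.cases <;>
    simp [Matrix.one_apply, (Fin.succ_ne_zero _).symm]

lemma gcons_upper {a : R} {x : Fin n → R} {B : Matrix (Fin n) (Fin n) R}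
    (hB : B.BlockTriangular id) : (gcons a x B).BlockTriangular id := by
  intro i j hij
  induction i using Fin.cases with
  | zero => exact absurd hij (by simp)
  | succ i => induction j using Fin.cases with
    | zero => rfl
    | succ j => exact hB (by simpa using hij)

end FirstRow

/-! ### The unipotent group of size n + 1 as a first row and a unipotent corner. -/

section Unipotent

variable {F : Type*} [Field F] {n : ℕ}

/-- Bordering a unipotent matrix by a first row `(1, x)`. -/
def ucons (x : Fin n → F) (u : unipotent n F) : unipotent (n + 1) F :=
  ⟨⟨gcons 1 x ((u : GL (Fin n) F) : Matrix (Fin n) (Fin n) F),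
    gcons 1 (-Matrix.vecMul x (((u : GL (Fin n) F)⁻¹ : GL (Fin n) F) : Matrix (Fin n) (Fin n) F))
      (((u : GL (Fin n) F)⁻¹ : GL (Fin n) F) : Matrix (Fin n) (Fin n) F),
    by rw [gcons_mul, ← Units.val_mul, mul_inv_cancel]; simp [gcons_one],
    by
      rw [gcons_mul, ← Units.val_mul, inv_mul_cancel, Matrix.neg_vecMul, Matrix.vecMul_vecMul,
        ← Units.val_mul, inv_mul_cancel]
      simp [gcons_one]⟩,
  by
    refine ⟨fun i => ?_, fun i j h => gcons_upper (fun i j h => u.2.2 i j h) h⟩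
    induction i using Fin.cases with
    | zero => rfl
    | succ i => exact u.2.1 i⟩

lemma coe_ucons (x : Fin n → F) (u : unipotent n F) :
    ((ucons x u : GL (Fin (n + 1)) F) : Matrix (Fin (n + 1)) (Fin (n + 1)) F) =
      gcons 1 x ((u : GL (Fin n) F) : Matrix (Fin n) (Fin n) F) := rfl

lemma ucons_mul (x x' : Fin n → F) (u u' : unipotent n F) :
    ucons x u * ucons x' u' =
      ucons (x' + Matrix.vecMul x ((u' : GL (Fin n) F) : Matrix (Fin n) (Fin n) F)) (u * u') := by
  refine Subtype.ext (Units.ext ?_)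
  rw [Subgroup.coe_mul, Units.val_mul, coe_ucons, coe_ucons, coe_ucons, gcons_mul, Subgroup.coe_mul,
    Units.val_mul]
  simp

lemma coe_eq_gcons (u : unipotent (n + 1) F) :
    ((u : GL (Fin (n + 1)) F) : Matrix (Fin (n + 1)) (Fin (n + 1)) F) =
      gcons 1 (fun j => (u : GL (Fin (n + 1)) F) 0 j.succ)
        (((u : GL (Fin (n + 1)) F) : Matrix (Fin (n + 1)) (Fin (n + 1)) F).submatrix
          Fin.succ Fin.succ) := by
  conv_lhs => rw [← gcons_eta fun i => u.2.2 i.succ 0 (Fin.succ_pos i)]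
  rw [u.2.1 0]

lemma submatrix_succ_mul (u v : unipotent (n + 1) F) :
    ((u : GL (Fin (n + 1)) F) : Matrix (Fin (n + 1)) (Fin (n + 1)) F).submatrix
        Fin.succ Fin.succ *
      ((v : GL (Fin (n + 1)) F) : Matrix (Fin (n + 1)) (Fin (n + 1)) F).submatrix
        Fin.succ Fin.succ =
      ((u * v : unipotent (n + 1) F) : GL (Fin (n + 1)) F).1.submatrix Fin.succ Fin.succ := by
  rw [Subgroup.coe_mul, Units.val_mul, coe_eq_gcons u, coe_eq_gcons v, gcons_mul]
  rfl

/-- The lower right corner of a unipotent matrix. -/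
def utail (u : unipotent (n + 1) F) : unipotent n F :=
  ⟨⟨((u : GL (Fin (n + 1)) F) : Matrix (Fin (n + 1)) (Fin (n + 1)) F).submatrix Fin.succ Fin.succ,
    ((u⁻¹ : unipotent (n + 1) F) : GL (Fin (n + 1)) F).1.submatrix Fin.succ Fin.succ,
    by
      rw [submatrix_succ_mul, mul_inv_cancel]
      ext i j; simp [Matrix.one_apply],
    by
      rw [submatrix_succ_mul, inv_mul_cancel]
      ext i j; simp [Matrix.one_apply]⟩,
  fun i => u.2.1 i.succ, fun i j h => u.2.2 i.succ j.succ (by simpa using h)⟩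

lemma ucons_utail (u : unipotent (n + 1) F) :
    ucons (fun j => (u : GL (Fin (n + 1)) F) 0 j.succ) (utail u) = u :=
  Subtype.ext (Units.ext (coe_eq_gcons u).symm)

end Unipotent

/-! ### Haar measure on the unipotent group as a product measure. -/

section Disintegration

variable {F : Type*} [Field F] [ValuativeRel F] [TopologicalSpace F] [IsNonarchimedeanLocalField F]
variable {n k : ℕ}

lemma continuous_gcons {α : Type*} [TopologicalSpace α] {x : α → Fin n → F}
    {B : α → Matrix (Fin n) (Fin n) F} (hx : Continuous x) (hB : Continuous B) :
    Continuous fun a => gcons 1 (x a) (B a) := by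
  refine continuous_matrix fun i j => ?_
  induction i using Fin.cases with
  | zero => induction j using Fin.cases with
    | zero => exact continuous_const
    | succ j => exact (continuous_apply j).comp hx
  | succ i => induction j using Fin.cases with
    | zero => exact continuous_const
    | succ j => exact hB.matrix_elem i j

/-- The unipotent group is a product of the first row and of the lower right corner. -/
def uconsHomeomorph : unipotent n F × (Fin n → F) ≃ₜ unipotent (n + 1) F where
  toFun p := ucons p.2 p.1
  invFun u := (utail u, fun j => (u : GL (Fin (n + 1)) F) 0 j.succ)
  left_inv _ := rfl
  right_inv u := ucons_utail u
  continuous_toFun := by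
    have h1 : Continuous fun p : unipotent n F × (Fin n → F) =>
        ((p.1 : GL (Fin n) F) : Matrix (Fin n) (Fin n) F) :=
      Units.continuous_val.comp (continuous_subtype_val.comp continuous_fst)
    have h2 : Continuous fun p : unipotent n F × (Fin n → F) =>
        (((p.1 : GL (Fin n) F)⁻¹ : GL (Fin n) F) : Matrix (Fin n) (Fin n) F) :=
      Units.continuous_val.comp (continuous_inv.comp (continuous_subtype_val.comp continuous_fst))
    refine Continuous.subtype_mk (Units.continuous_iff.mpr ⟨?_, ?_⟩) _
    · exact continuous_gcons continuous_snd h1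
    · exact continuous_gcons (continuous_snd.matrix_vecMul h2).neg h2
  continuous_invFun := by
    have h1 : Continuous fun u : unipotent (n + 1) F =>
        ((u : GL (Fin (n + 1)) F) : Matrix (Fin (n + 1)) (Fin (n + 1)) F) :=
      Units.continuous_val.comp continuous_subtype_val
    refine Continuous.prodMk (Continuous.subtype_mk (Units.continuous_iff.mpr ⟨?_, ?_⟩) _) ?_
    · exact h1.matrix_submatrix _ _
    · exact (h1.comp continuous_inv).matrix_submatrix _ _
    · exact continuous_pi fun j => h1.matrix_elem 0 j.succ

instance : SecondCountableTopology (unipotent k F) :=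
  inferInstanceAs (SecondCountableTopology (unipotent k F : Set (GL (Fin k) F)))

lemma isClosed_unipotent : IsClosed (unipotent k F : Set (GL (Fin k) F)) := by
  have e : (unipotent k F : Set (GL (Fin k) F)) =
      (⋂ i, {u : GL (Fin k) F | u i i = 1}) ∩
        ⋂ i, ⋂ j, ⋂ (_ : j < i), {u : GL (Fin k) F | u i j = 0} := by
    ext u
    simp only [Set.mem_inter_iff, Set.mem_iInter, Set.mem_ofPred_eq]
    rfl
  have h : ∀ i j, Continuous fun u : GL (Fin k) F => u i j := fun i j =>
    Units.continuous_val.matrix_elem i j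
  rw [e]
  refine IsClosed.inter (isClosed_iInter fun i => isClosed_eq (h i i) continuous_const) ?_
  exact isClosed_iInter fun i => isClosed_iInter fun j => isClosed_iInter fun _ =>
    isClosed_eq (h i j) continuous_const

instance : LocallyCompactSpace (unipotent k F) :=
  isClosed_unipotent.isClosedEmbedding_subtypeVal.locallyCompactSpace

variable [MeasurableSpace F] [BorelSpace F]
variable [MeasurableSpace (GL (Fin n) F)] [BorelSpace (GL (Fin n) F)]
variable [MeasurableSpace (GL (Fin (n + 1)) F)] [BorelSpace (GL (Fin (n + 1)) F)]

lemma lintegral_map_ucons (ν : Measure (unipotent n F)) [SFinite ν]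
    {f : unipotent (n + 1) F → ENNReal} (hf : Measurable f) :
    ∫⁻ u, f u ∂((ν.prod (haarVec F (Fin n))).map uconsHomeomorph) =
      ∫⁻ u, ∫⁻ x, f (ucons x u) ∂haarVec F (Fin n) ∂ν := by
  have hm : Measurable (uconsHomeomorph : unipotent n F × (Fin n → F) → unipotent (n + 1) F) :=
    uconsHomeomorph.continuous.measurable
  rw [lintegral_map hf hm]
  exact lintegral_prod _ (hf.comp hm).aemeasurable

/-- Left translation by (x₀, v) sends (x, u) to (x + x₀u, vu): for fixed u a translation of the row,
followed by a left translation of the corner. -/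
lemma isHaarMeasure_map_ucons (ν : Measure (unipotent n F)) [ν.IsHaarMeasure] :
    ((ν.prod (haarVec F (Fin n))).map
      (uconsHomeomorph : unipotent n F × (Fin n → F) → unipotent (n + 1) F)).IsHaarMeasure where
  toIsFiniteMeasureOnCompacts :=
    Measure.IsFiniteMeasureOnCompacts.map _ uconsHomeomorph
  toIsMulLeftInvariant := by
    refine ⟨fun g => Measure.ext_of_lintegral _ fun f hf => ?_⟩
    obtain ⟨⟨v, x₀⟩, rfl⟩ := uconsHomeomorph.surjective g
    have hm := hf.comp (measurable_const_mul (uconsHomeomorph (v, x₀)))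
    rw [lintegral_map hf (measurable_const_mul _), lintegral_map_ucons ν hf]
    refine (lintegral_map_ucons ν hm).trans ?_
    have h1 : ∀ u, ∫⁻ x, (f ∘ fun w => uconsHomeomorph (v, x₀) * w) (ucons x u) ∂haarVec F (Fin n) =
        ∫⁻ x, f (ucons x (v * u)) ∂haarVec F (Fin n) := by
      intro u
      rw [← lintegral_add_right_eq_self (fun x => f (ucons x (v * u)))
        (Matrix.vecMul x₀ ((u : GL (Fin n) F) : Matrix (Fin n) (Fin n) F))]
      simp only [← ucons_mul]
      rfl
    simp only [h1]
    exact lintegral_mul_left_eq_self (fun u => ∫⁻ x, f (ucons x u) ∂haarVec F (Fin n)) v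
  toIsOpenPosMeasure := uconsHomeomorph.continuous.isOpenPosMeasure_map uconsHomeomorph.surjective

/-- Haar measures on the unipotent group are products of Haar measures. -/
theorem exists_lintegral_unipotent_eq (μ : Measure (unipotent (n + 1) F)) [μ.IsHaarMeasure]
    (ν : Measure (unipotent n F)) [ν.IsHaarMeasure] : ∃ c : NNReal,
    ∀ f : unipotent (n + 1) F → ENNReal, Measurable f →
      ∫⁻ u, f u ∂μ = c * ∫⁻ u, ∫⁻ x, f (ucons x u) ∂haarVec F (Fin n) ∂ν := by
  have := isHaarMeasure_map_ucons ν
  have h := Measure.isMulLeftInvariant_eq_smul μ ((ν.prod (haarVec F (Fin n))).map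
    (uconsHomeomorph : unipotent n F × (Fin n → F) → unipotent (n + 1) F))
  refine ⟨μ.haarScalarFactor ((ν.prod (haarVec F (Fin n))).map
    (uconsHomeomorph : unipotent n F × (Fin n → F) → unipotent (n + 1) F)), fun f hf => ?_⟩
  conv_lhs => rw [h]
  rw [lintegral_smul_measure, lintegral_map_ucons ν hf]
  rfl

end Disintegration

/-! ### Minors of w·u for unipotent u. -/

section Reversal

variable {F : Type*} [Field F] [ValuativeRel F] [TopologicalSpace F] [IsNonarchimedeanLocalField F]
variable {n k : ℕ}

lemma absF_pow (x : F) (m : ℕ) : absF (x ^ m) = absF x ^ m := map_pow (absHom F) x m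

/-- The product of the suprema of minors of `w M`, where `w` is the longest Weyl element. -/
noncomputable def revMinors (M : Matrix (Fin k) (Fin k) F) : ℝ := prodMinors (M.submatrix Fin.rev id)

lemma coe_permGL_rev_mul (g : GL (Fin k) F) :
    ((permGL Fin.revPerm * g : GL (Fin k) F) : Matrix (Fin k) (Fin k) F) =
      (g : Matrix (Fin k) (Fin k) F).submatrix Fin.rev id := by
  rw [Units.val_mul, permGL_mul]
  rfl

lemma revMinors_coe (g : GL (Fin k) F) : revMinors (g : Matrix (Fin k) (Fin k) F) =
    prodMinors ((permGL Fin.revPerm * g : GL (Fin k) F) : Matrix (Fin k) (Fin k) F) := by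
  rw [coe_permGL_rev_mul, revMinors]

lemma revMinors_pos (g : GL (Fin k) F) : 0 < revMinors (g : Matrix (Fin k) (Fin k) F) := by
  rw [revMinors_coe]; exact prodMinors_pos _

/-- Reversing the rows puts the first row last, and a cyclic permutation of the columns, which lies
in K, puts the first column last. -/
lemma revMinors_gcons (a : F) (y : Fin n → F) (B : Matrix (Fin n) (Fin n) F) :
    revMinors (gcons a y B) = prodMinors (blk (B.submatrix Fin.rev id) 0 y a) := by
  have e : (gcons a y B).submatrix Fin.rev id = blk (B.submatrix Fin.rev id) 0 y a *
      ((permGL (lastTo 0) : GL (Fin (n + 1)) F) : Matrix (Fin (n + 1)) (Fin (n + 1)) F) := by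
    rw [mul_permGL]
    ext i j
    obtain ⟨j, rfl⟩ := (lastTo 0).surjective j
    simp only [Matrix.submatrix_apply, id, Equiv.symm_apply_apply]
    induction i using Fin.lastCases with
    | last => induction j using Fin.lastCases with
      | last => simp [lastTo_last]
      | cast j => simp [lastTo_castSucc]
    | cast i => induction j using Fin.lastCases with
      | last => simp [lastTo_last, Fin.rev_castSucc]
      | cast j => simp [lastTo_castSucc, Fin.rev_castSucc]
  rw [revMinors, e, prodMinors_mul_mem _ (permGL_mem _)]

/-- The rows ≥ `rev i` of w·u are the rows 0, …, i of u. With diagonal columns for the rows before i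
and column j for row i, the minor is triangular with determinant u_ij. -/
lemma absF_apply_le_minorSup_rev {u : GL (Fin k) F} (hu : u ∈ unipotent k F) (i j : Fin k) :
    absF (u i j) ≤ minorSup (Fin.rev i) ((u : Matrix (Fin k) (Fin k) F).submatrix Fin.rev id) := by
  refine le_trans (le_of_eq ?_) (le_minorSup (Fin.rev i) _
    fun r => if (r : Fin k) = Fin.rev i then j else Fin.rev r)
  rw [Matrix.det_of_isLowerTriangular, Finset.prod_eq_single ⟨Fin.rev i, le_rfl⟩]
  · simp
  · intro r _ hr
    have hr' : (r : Fin k) ≠ Fin.rev i := fun h => hr (Subtype.ext h)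
    simp [hr', hu.1]
  · simp
  · intro r r' h
    have h1 : (r : Fin k) < (r' : Fin k) := h
    have h2 : (r' : Fin k) ≠ Fin.rev i := (lt_of_le_of_lt r.2 h1).ne'
    simp only [Matrix.submatrix_apply, h2, if_false, id]
    exact hu.2 _ _ (Fin.rev_lt_rev.mpr h1)

lemma one_le_minorSup_rev {u : GL (Fin k) F} (hu : u ∈ unipotent k F) (i : Fin k) :
    1 ≤ minorSup i ((u : Matrix (Fin k) (Fin k) F).submatrix Fin.rev id) := by
  have := absF_apply_le_minorSup_rev hu (Fin.rev i) (Fin.rev i)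
  rwa [hu.1, absF_one, Fin.rev_rev] at this

lemma minorSup_le_prodMinors {M : Matrix (Fin k) (Fin k) F} (hM : ∀ i, 1 ≤ minorSup i M)
    (i : Fin k) : minorSup i M ≤ prodMinors M := by
  rw [prodMinors, ← Finset.mul_prod_erase _ _ (Finset.mem_univ i)]
  exact le_mul_of_one_le_right (minorSup_nonneg _ _)
    (Finset.one_le_prod fun j _ => hM j)

lemma one_le_revMinors {u : GL (Fin k) F} (hu : u ∈ unipotent k F) :
    1 ≤ revMinors (u : Matrix (Fin k) (Fin k) F) := by
  rw [revMinors, prodMinors]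
  exact Finset.one_le_prod fun i _ => one_le_minorSup_rev hu i

lemma absF_apply_le_revMinors {u : GL (Fin k) F} (hu : u ∈ unipotent k F) (i j : Fin k) :
    absF (u i j) ≤ revMinors (u : Matrix (Fin k) (Fin k) F) :=
  (absF_apply_le_minorSup_rev hu i j).trans
    (minorSup_le_prodMinors (one_le_minorSup_rev hu) _)

/-- All entries of u are themselves minors counted in `revMinors u`, and those of u⁻¹ are cofactors
of u since det u = 1. So σ(u) is controlled by the logarithm of the minors. -/
lemma sigma_unipotent_le {u : GL (Fin k) F} (hu : u ∈ unipotent k F) :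
    sigma u ≤ 1 + k * Real.log (revMinors (u : Matrix (Fin k) (Fin k) F)) := by
  have h1 := one_le_revMinors hu
  set Y := revMinors (u : Matrix (Fin k) (Fin k) F)
  have h0 : 0 < Y := by linarith
  have hl : 0 ≤ Real.log Y := Real.log_nonneg h1
  have hk : (0 : ℝ) ≤ k * Real.log Y := by positivity
  have hY : Y ^ k ≤ Real.exp (1 + k * Real.log Y) := by
    rw [Real.exp_add, Real.exp_nat_mul, Real.exp_log h0]
    exact le_mul_of_one_le_left (by positivity) (Real.one_le_exp zero_le_one)
  refine sigma_le (by linarith) (fun i j => ?_) fun i j => ?_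
  · refine (absF_apply_le_revMinors hu i j).trans (le_trans ?_ hY)
    have : k ≠ 0 := by rintro rfl; exact i.elim0
    exact le_self_pow₀ h1 this
  · refine le_trans ?_ hY
    rw [Matrix.coe_units_inv, Matrix.inv_def, Matrix.det_of_isUpperTriangular (unipotent_upper hu)]
    simp only [hu.1, Finset.prod_const_one, Ring.inverse_one, one_smul]
    rw [Matrix.adjugate_apply]
    refine (absF_det_le h0.le fun a b => ?_).trans (by rw [Fintype.card_fin])
    rw [Matrix.updateRow_apply]
    split_ifs
    · rw [Pi.single_apply]
      split_ifs <;> simp <;> linarith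
    · exact absF_apply_le_revMinors hu a b

/-- Reduces a bordered matrix to a triangular corner; the compact factor only moves the last row y
to y κ⁻¹, a change of variables of determinant of absolute value 1. -/
lemma prodMinors_blk_iwasawa (h : GL (Fin n) F) : ∃ b : GL (Fin n) F,
    (b : Matrix (Fin n) (Fin n) F).BlockTriangular id ∧ ∃ κ ∈ maxCompact n F, h = b * κ ∧
      ∀ (y : Fin n → F) (a : F), prodMinors (blk (h : Matrix (Fin n) (Fin n) F) 0 y a) =
        prodMinors (blk (b : Matrix (Fin n) (Fin n) F) 0
          (Matrix.vecMul y ((κ⁻¹ : GL (Fin n) F) : Matrix (Fin n) (Fin n) F)) a) := by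
  obtain ⟨a, u, hu, κ, hκ, rfl⟩ := iwasawa h
  refine ⟨diagGL a * u, ?_, κ, hκ, rfl, fun y d => ?_⟩
  · rw [Units.val_mul]; exact (diagGL_upper a).mul (unipotent_upper hu)
  · rw [← prodMinors_mul_mem (blk ((diagGL a * u : GL (Fin n) F) : Matrix (Fin n) (Fin n) F) 0
      (Matrix.vecMul y ((κ⁻¹ : GL (Fin n) F) : Matrix (Fin n) (Fin n) F)) d) (embGL_mem hκ),
      coe_embGL, blk_mul, Matrix.vecMul_vecMul, ← Units.val_mul κ⁻¹, inv_mul_cancel,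
      Units.val_mul _ κ]
    simp

end Reversal

/-! ### The row integral for exponents below -1. -/

section RowIntegral

variable {F : Type*} [Field F] [ValuativeRel F] [TopologicalSpace F] [IsNonarchimedeanLocalField F]
variable [MeasurableSpace F] [BorelSpace F]
variable {n : ℕ}

/-- Integrating the reciprocal of the minors over the last row. -/
lemma lintegral_prodMinors_blk_rpow_le (h g : GL (Fin n) F) (v : Fin n → F) {a : F} (ha : a ≠ 0)
    {s : ℝ} (hs : 0 < s) (hs1 : s ≤ 1) :
    ∫⁻ x, ENNReal.ofReal (prodMinors (blk (h : Matrix (Fin n) (Fin n) F) 0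
        (v + Matrix.vecMul x (g : Matrix (Fin n) (Fin n) F)) a) ^ (-(1 + s))) ∂haarVec F (Fin n) ≤
      ENNReal.ofReal (absF a ^ (-(1 + (n + 1) * s)) *
        (absF (g : Matrix (Fin n) (Fin n) F).det)⁻¹ * (2 / s) ^ n) *
        ENNReal.ofReal (prodMinors (h : Matrix (Fin n) (Fin n) F) ^ (-(1 + s))) := by
  obtain ⟨b, hb, κ, hκ, rfl, e⟩ := prodMinors_blk_iwasawa h
  have ha0 := absF_pos ha
  have hg0 := absF_det_pos g
  set c : Matrix (Fin n) (Fin n) F := ((κ⁻¹ : GL (Fin n) F) : Matrix (Fin n) (Fin n) F)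
  -- After division by a, each factor `max |a| |y_p|` is |a| times `max 1 |t_p|`, and the integral
  -- splits into one-variable integrals.
  set A : Matrix (Fin n) (Fin n) F := a⁻¹ • ((g : Matrix (Fin n) (Fin n) F) * c)
  have hc : absF c.det = 1 := absF_det_eq_one_of_mem (inv_mem hκ)
  have hdet : absF A.det = (absF a ^ n)⁻¹ * absF (g : Matrix (Fin n) (Fin n) F).det := by
    rw [Matrix.det_smul, Matrix.det_mul, absF_mul, absF_mul, hc, mul_one, Fintype.card_fin,
      absF_pow, absF_inv, inv_pow]
  have hA : A.det ≠ 0 := by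
    intro h0
    rw [h0, absF_zero] at hdet
    exact absurd hdet (by positivity)
  set v' : Fin n → F := a⁻¹ • Matrix.vecMul v c
  have hy : ∀ x, Matrix.vecMul (v + Matrix.vecMul x (g : Matrix (Fin n) (Fin n) F)) c =
      a • (v' + Matrix.vecMul x A) := by
    intro x
    rw [Matrix.add_vecMul, smul_add, Matrix.vecMul_smul, smul_smul, smul_smul, mul_inv_cancel₀ ha,
      one_smul, one_smul, Matrix.vecMul_vecMul]
  set B := prodMinors ((b * κ : GL (Fin n) F) : Matrix (Fin n) (Fin n) F)
  have hB : 0 < B := prodMinors_pos _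
  have hBb : prodMinors (b : Matrix (Fin n) (Fin n) F) = B := by
    rw [← prodMinors_mul_mem _ hκ, ← Units.val_mul]
  set f : (Fin n → F) → ENNReal := fun t =>
    ∏ p, ENNReal.ofReal (max 1 (absF (t p)) ^ (-(1 + s)))
  have hm : ∀ p : Fin n, Measurable fun t : F => ENNReal.ofReal (max 1 (absF t) ^ (-(1 + s))) :=
    fun p => ((measurable_const.max measurable_absF).pow_const _).ennreal_ofReal
  have hf : Measurable f := Finset.measurable_prod _ fun p _ => (hm p).comp (measurable_pi_apply p)
  have hpt : ∀ x, ENNReal.ofReal (prodMinors (blk ((b * κ : GL (Fin n) F) :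
      Matrix (Fin n) (Fin n) F) 0 (v + Matrix.vecMul x (g : Matrix (Fin n) (Fin n) F)) a) ^
        (-(1 + s))) ≤
      ENNReal.ofReal (B ^ (-(1 + s)) * absF a ^ (-((n + 1) * (1 + s)))) *
        f (v' + Matrix.vecMul x A) := by
    intro x
    have hfx : f (v' + Matrix.vecMul x A) = ENNReal.ofReal
        (∏ p, max 1 (absF ((v' + Matrix.vecMul x A) p)) ^ (-(1 + s))) :=
      (ENNReal.ofReal_prod_of_nonneg fun p _ => by positivity).symm
    rw [e, hy, hfx, ← ENNReal.ofReal_mul (by positivity)]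
    refine ENNReal.ofReal_le_ofReal ?_
    have hpos : 0 < ∏ p, max 1 (absF ((v' + Matrix.vecMul x A) p)) :=
      Finset.prod_pos fun p _ => lt_max_of_lt_left one_pos
    have h1 := prodMinors_blk_ge hb (a • (v' + Matrix.vecMul x A)) a
    have h2 : ∏ p, max (absF a) (absF ((a • (v' + Matrix.vecMul x A)) p)) =
        absF a ^ n * ∏ p, max 1 (absF ((v' + Matrix.vecMul x A) p)) := by
      have : ∀ p, max (absF a) (absF ((a • (v' + Matrix.vecMul x A)) p)) =
          absF a * max 1 (absF ((v' + Matrix.vecMul x A) p)) := by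
        intro p
        rw [Pi.smul_apply, smul_eq_mul, absF_mul, mul_max_of_nonneg _ _ ha0.le, mul_one]
      simp only [this, Finset.prod_mul_distrib, Finset.prod_const, Finset.card_univ,
        Fintype.card_fin]
    rw [h2, hBb] at h1
    set P := ∏ p, max 1 (absF ((v' + Matrix.vecMul x A) p)) with hP
    refine (Real.rpow_le_rpow_of_nonpos (by positivity) h1 (by linarith)).trans (le_of_eq ?_)
    rw [show absF a * B * (absF a ^ n * P) = B * absF a ^ (n + 1) * P by ring,
      Real.mul_rpow (by positivity) hpos.le, Real.mul_rpow hB.le (by positivity), hP,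
      ← Real.finsetProd_rpow _ _ fun p _ => by positivity, ← Real.rpow_natCast,
      ← Real.rpow_mul ha0.le]
    push_cast
    congr 3
    ring
  refine (lintegral_mono hpt).trans ?_
  have hfA : Measurable fun x => f (v' + Matrix.vecMul x A) := hf.comp
    (continuous_const.add (continuous_id.matrix_vecMul continuous_const)).measurable
  rw [lintegral_const_mul _ hfA, lintegral_affine_vecMul v' hA hf,
    lintegral_haarVec_prod hm]
  have hI : ∏ _p : Fin n, ∫⁻ t : F, ENNReal.ofReal (max 1 (absF t) ^ (-(1 + s))) ∂haarF F ≤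
      ENNReal.ofReal ((2 / s) ^ n) := by
    refine (Finset.prod_le_pow_card _ _ _ fun p _ => lintegral_max_one_rpow_le hs hs1).trans ?_
    rw [Finset.card_univ, Fintype.card_fin, ENNReal.ofReal_pow (by positivity)]
  refine (mul_le_mul_right (mul_le_mul_right hI _) _).trans ?_
  rw [← ENNReal.ofReal_mul (inv_nonneg.mpr (absF_nonneg _)), ← ENNReal.ofReal_mul (by positivity),
    ← ENNReal.ofReal_mul (by positivity)]
  refine ENNReal.ofReal_le_ofReal (le_of_eq ?_)
  have h3 : absF a ^ (-(1 + ((n : ℝ) + 1) * s)) =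
      absF a ^ (-((n + 1) * (1 + s))) * absF a ^ n := by
    rw [← Real.rpow_natCast (absF a) n, ← Real.rpow_add ha0]
    congr 1; ring
  rw [hdet, h3, mul_inv, inv_inv]
  ring

end RowIntegral

/-! ### The truncated row integral for an exponent slightly above -1. -/

section TruncatedRow

variable {F : Type*} [Field F] [ValuativeRel F] [TopologicalSpace F] [IsNonarchimedeanLocalField F]
variable {m : ℕ}

/-- With exponent `-1 + ε` no coordinate would be integrable. But the minor M of the last row alone
dominates every |y_l|, so part of its power can be given away: each of the first m coordinates
receives an extra -2ε and reaches the integrable exponent `-(1 + ε)`. Only the last coordinate, left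
with `-1 + (1 + 2m)ε`, has to be truncated. -/
lemma prodMinors_blk_rpow_le {b : GL (Fin (m + 1)) F}
    (hb : (b : Matrix (Fin (m + 1)) (Fin (m + 1)) F).BlockTriangular id) (y : Fin (m + 1) → F)
    {ε : ℝ} (h0 : 0 < ε) (h1 : (1 + 2 * m) * ε ≤ 1) :
    prodMinors (blk (b : Matrix (Fin (m + 1)) (Fin (m + 1)) F) 0 y 1) ^ (-1 + ε) ≤
      prodMinors (b : Matrix (Fin (m + 1)) (Fin (m + 1)) F) ^ (-1 + ε) *
        (max 1 (absF (y (Fin.last m))) ^ (-1 + (1 + 2 * m) * ε) *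
          ∏ p : Fin m, max 1 (absF (y p.castSucc)) ^ (-(1 + ε))) := by
  set N := blk (b : Matrix (Fin (m + 1)) (Fin (m + 1)) F) 0 y 1
  set M := minorSup (Fin.last (m + 1)) N
  have hM1 : 1 ≤ M := by
    have := absF_last_le_minorSup N (Fin.last (m + 1))
    rwa [show N (Fin.last _) (Fin.last _) = 1 from blk_last_last _ _ _ _, absF_one] at this
  have hMy : ∀ l, max 1 (absF (y l)) ≤ M := fun l => max_le hM1 (by
    have := absF_last_le_minorSup N l.castSucc
    rwa [show N (Fin.last _) l.castSucc = y l from blk_last_castSucc _ _ _ _ _] at this)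
  have hM0 : 0 < M := by linarith
  -- For the last index the whole minor M is kept instead of `max 1 |y_last|`.
  have key := prodMinors_blk_ge_of_bounds hb y 1
    (β := Fin.snoc (α := fun _ => ℝ) (fun p : Fin m => max 1 (absF (y p.castSucc))) M)
    (by
      intro p
      induction p using Fin.lastCases with
      | last => simpa using hM0.le
      | cast p => simp)
    (by
      intro p
      induction p using Fin.lastCases with
      | last =>
        have : Finset.Ioi (Fin.last m) = ∅ := by
          rw [← Finset.coe_eq_empty, Finset.coe_Ioi]
          exact Set.Ioi_eq_empty_iff.mpr fun x _ => Fin.le_last x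
        rw [this, Finset.prod_empty, one_mul, Fin.snoc_last]
        exact le_rfl
      | cast p =>
        rw [Fin.snoc_castSucc]
        have := absF_mul_le_minorSup_succ hb y 1 p.castSucc
        rwa [absF_one] at this)
  rw [absF_one, one_mul, Fin.prod_univ_castSucc] at key
  simp only [Fin.snoc_castSucc, Fin.snoc_last] at key
  have hB := prodMinors_pos b
  have hm0 : (0 : ℝ) ≤ m := Nat.cast_nonneg m
  have hε1 : ε ≤ 1 := by nlinarith
  set P := ∏ p : Fin m, max 1 (absF (y p.castSucc))
  have hP : 0 < P := Finset.prod_pos fun p _ => lt_max_of_lt_left one_pos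
  have h2 : M ^ (-1 + ε) ≤ max 1 (absF (y (Fin.last m))) ^ (-1 + (1 + 2 * m) * ε) *
      ∏ p : Fin m, max 1 (absF (y p.castSucc)) ^ (-(2 * ε)) := by
    have e1 : M ^ (-1 + ε) = M ^ (-1 + (1 + 2 * m) * ε) * ∏ _p : Fin m, M ^ (-(2 * ε)) := by
      rw [Finset.prod_const, Finset.card_univ, Fintype.card_fin, ← Real.rpow_natCast,
        ← Real.rpow_mul hM0.le, ← Real.rpow_add hM0]
      congr 1; ring
    rw [e1]
    refine mul_le_mul ?_ (Finset.prod_le_prod (fun _ _ => by positivity) fun p _ => ?_)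
      (by positivity) (by positivity)
    · exact Real.rpow_le_rpow_of_nonpos (by positivity) (hMy _) (by linarith)
    · exact Real.rpow_le_rpow_of_nonpos (by positivity) (hMy _) (by linarith)
  calc prodMinors N ^ (-1 + ε)
      ≤ (prodMinors (b : Matrix (Fin (m + 1)) (Fin (m + 1)) F) * (P * M)) ^ (-1 + ε) :=
        Real.rpow_le_rpow_of_nonpos (by positivity) key (by linarith)
    _ = prodMinors (b : Matrix (Fin (m + 1)) (Fin (m + 1)) F) ^ (-1 + ε) *
        (P ^ (-1 + ε) * M ^ (-1 + ε)) := by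
        rw [Real.mul_rpow hB.le (by positivity), Real.mul_rpow hP.le hM0.le]
    _ ≤ prodMinors (b : Matrix (Fin (m + 1)) (Fin (m + 1)) F) ^ (-1 + ε) *
        (P ^ (-1 + ε) * (max 1 (absF (y (Fin.last m))) ^ (-1 + (1 + 2 * m) * ε) *
          ∏ p : Fin m, max 1 (absF (y p.castSucc)) ^ (-(2 * ε)))) := by gcongr
    _ = _ := by
        rw [mul_left_comm (P ^ _), ← Real.finsetProd_rpow _ _ fun p _ => by positivity,
          ← Finset.prod_mul_distrib]
        congr 2
        refine Finset.prod_congr rfl fun p _ => ?_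
        rw [← Real.rpow_add (by positivity)]
        congr 1; ring

variable [MeasurableSpace F] [BorelSpace F]

/-- Integrating a power of the minors, larger than the reciprocal, over a truncated last row. -/
lemma setLIntegral_prodMinors_blk_rpow_le (h : GL (Fin (m + 1)) F)
    (hl : absF (h (Fin.last m) 0) = 1)
    (hminor : ∀ i, 1 ≤ minorSup i (h : Matrix (Fin (m + 1)) (Fin (m + 1)) F))
    {ε r : ℝ} (h0 : 0 < ε) (h1 : (1 + 2 * m) * ε ≤ 1) (hr : 1 ≤ r) :
    ∫⁻ x in {x : Fin (m + 1) → F | absF (x 0) ≤ r},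
      ENNReal.ofReal (prodMinors (blk (h : Matrix (Fin (m + 1)) (Fin (m + 1)) F) 0 x 1) ^ (-1 + ε))
        ∂haarVec F (Fin (m + 1)) ≤
      ENNReal.ofReal ((2 / ε) ^ m * (2 / ((1 + 2 * m) * ε) + 1) * r ^ (2 * ((1 + 2 * m) * ε))) *
        ENNReal.ofReal (prodMinors (h : Matrix (Fin (m + 1)) (Fin (m + 1)) F) ^
          (-1 + (3 + 4 * m) * ε)) := by
  obtain ⟨b, hb, κ, hκ, rfl, e⟩ := prodMinors_blk_iwasawa h
  set η := (1 + 2 * m) * ε with hη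
  have hη0 : 0 < η := by positivity
  set c : Matrix (Fin (m + 1)) (Fin (m + 1)) F :=
    ((κ⁻¹ : GL (Fin (m + 1)) F) : Matrix (Fin (m + 1)) (Fin (m + 1)) F) with hc
  set B := prodMinors ((b * κ : GL (Fin (m + 1)) F) : Matrix (Fin (m + 1)) (Fin (m + 1)) F)
  have hB : 0 < B := prodMinors_pos _
  have hBb : prodMinors (b : Matrix (Fin (m + 1)) (Fin (m + 1)) F) = B := by
    rw [← prodMinors_mul_mem _ hκ, ← Units.val_mul]
  set τ := absF (b (Fin.last m) (Fin.last m)) with hτdef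
  have hτ : minorSup (Fin.last m) ((b * κ : GL (Fin (m + 1)) F) :
      Matrix (Fin (m + 1)) (Fin (m + 1)) F) = τ := by
    rw [Units.val_mul, minorSup_mul_mem _ _ hκ,
      ← mul_one (b : Matrix (Fin (m + 1)) (Fin (m + 1)) F), minorSup_upper_mul hb, minorSup_one,
      mul_one, Finset.prod_eq_single (Fin.last m)]
    · intro j hj hne
      exact absurd (le_antisymm (Fin.le_last j) (Finset.mem_Ici.mp hj)) hne
    · simp
  have hτ1 : 1 ≤ τ := hτ ▸ hminor _
  have hτB : τ ≤ B := hτ ▸ minorSup_le_prodMinors hminor _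
  set q := κ (Fin.last m) 0
  -- The last row of `b * κ` is b_last,last times the last row of κ, and its entry in column 0 is a
  -- unit.
  have hq : τ * absF q = 1 := by
    rw [Units.val_mul, Matrix.mul_apply, Finset.sum_eq_single (Fin.last m), absF_mul] at hl
    · exact hl
    · intro j _ hj
      rw [show b (Fin.last m) j = 0 from hb (Fin.lt_last_iff_ne_last.mpr hj), zero_mul]
    · simp
  have hq0 : q ≠ 0 := by
    intro h; rw [h, absF_zero, mul_zero] at hq; exact zero_ne_one hq
  set S : Set (Fin (m + 1) → F) := {y | absF (Matrix.vecMul y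
    (κ : Matrix (Fin (m + 1)) (Fin (m + 1)) F) 0) ≤ r}
  have hS : MeasurableSet S := by
    refine (isClosed_le (continuous_absF.comp ?_) continuous_const).measurableSet
    exact (continuous_apply 0).comp (continuous_id.matrix_vecMul continuous_const)
  set G : (Fin (m + 1) → F) → ENNReal := fun y => ENNReal.ofReal (B ^ (-1 + ε)) *
    (S.indicator (fun y => ENNReal.ofReal (max 1 (absF (y (Fin.last m))) ^ (-1 + η))) y *
      ∏ p : Fin m, ENNReal.ofReal (max 1 (absF (y p.castSucc)) ^ (-(1 + ε)))) with hG
  have hmax : ∀ a : ℝ, Measurable fun t : F => ENNReal.ofReal (max 1 (absF t) ^ a) := fun a =>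
    ((measurable_const.max measurable_absF).pow_const _).ennreal_ofReal
  have hGm : Measurable G := by
    refine measurable_const.mul (Measurable.mul ?_ ?_)
    · exact ((hmax _).comp (measurable_pi_apply _)).indicator hS
    · exact Finset.measurable_prod _ fun p _ => (hmax _).comp (measurable_pi_apply _)
  have hdet : absF c.det = 1 := absF_det_eq_one_of_mem (inv_mem hκ)
  have hdet0 : c.det ≠ 0 := by
    intro h; rw [h, absF_zero] at hdet; exact zero_ne_one hdet
  have hms : MeasurableSet {x : Fin (m + 1) → F | absF (x 0) ≤ r} :=
    (isClosed_le (continuous_absF.comp (continuous_apply 0)) continuous_const).measurableSet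
  have hpt : ∀ x, {x : Fin (m + 1) → F | absF (x 0) ≤ r}.indicator (fun x => ENNReal.ofReal
      (prodMinors (blk ((b * κ : GL (Fin (m + 1)) F) : Matrix (Fin (m + 1)) (Fin (m + 1)) F)
        0 x 1) ^ (-1 + ε))) x ≤ G (0 + Matrix.vecMul x c) := by
    intro x
    by_cases hx : absF (x 0) ≤ r
    · rw [Set.indicator_of_mem (show x ∈ {x : Fin (m + 1) → F | absF (x 0) ≤ r} from hx), zero_add]
      have hxS : Matrix.vecMul x c ∈ S := by
        change absF (Matrix.vecMul (Matrix.vecMul x c)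
          (κ : Matrix (Fin (m + 1)) (Fin (m + 1)) F) 0) ≤ r
        rw [Matrix.vecMul_vecMul, hc, ← Units.val_mul, inv_mul_cancel, Units.val_one,
          Matrix.vecMul_one]
        exact hx
      simp only [hG]
      rw [Set.indicator_of_mem hxS, ← ENNReal.ofReal_prod_of_nonneg fun p _ => by positivity,
        ← ENNReal.ofReal_mul (by positivity), ← ENNReal.ofReal_mul (by positivity), e, ← hBb]
      exact ENNReal.ofReal_le_ofReal (prodMinors_blk_rpow_le hb _ h0 h1)
    · rw [Set.indicator_of_notMem (show x ∉ {x : Fin (m + 1) → F | absF (x 0) ≤ r} from hx)]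
      exact zero_le
  have hinner : ∀ y : Fin m → F, ∫⁻ t, G ((Fin.last m).insertNth t y) ∂haarF F ≤
      ENNReal.ofReal (B ^ (-1 + ε)) * ENNReal.ofReal ((2 / η + 1) * (r * τ) ^ (2 * η)) *
        ∏ p : Fin m, ENNReal.ofReal (max 1 (absF (y p)) ^ (-(1 + ε))) := by
    intro y
    set z : F := -(q⁻¹ * ∑ p : Fin m, y p * κ p.castSucc 0)
    -- In the coordinates y = xκ⁻¹ the truncation of x_0 becomes a condition on the last coordinate
    -- t, with coefficient q of absolute value τ⁻¹. It confines t to a ball of radius rτ.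
    have hzS : ∀ t, ((Fin.last m).insertNth t y : Fin (m + 1) → F) ∈ S ↔ absF (t - z) ≤ r * τ := by
      intro t
      have h2 : Matrix.vecMul ((Fin.last m).insertNth t y : Fin (m + 1) → F)
          (κ : Matrix (Fin (m + 1)) (Fin (m + 1)) F) 0 = (t - z) * q := by
        rw [Matrix.vecMul, dotProduct, Fin.sum_univ_castSucc]
        simp only [Fin.insertNth_last', Fin.snoc_castSucc, Fin.snoc_last]
        change _ + t * q = _
        simp only [z]
        field_simp
        ring
      change absF (Matrix.vecMul ((Fin.last m).insertNth t y : Fin (m + 1) → F)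
          (κ : Matrix (Fin (m + 1)) (Fin (m + 1)) F) 0) ≤ r ↔ _
      rw [h2, absF_mul]
      have hτ0 : 0 < τ := by linarith
      rw [← mul_le_mul_iff_left₀ hτ0, mul_assoc, mul_comm (absF q), hq, mul_one]
    have hms' : MeasurableSet {t : F | absF (t - z) ≤ r * τ} :=
      (isClosed_le (continuous_absF.comp (continuous_sub_right z)) continuous_const).measurableSet
    have h3 : ∀ t, G ((Fin.last m).insertNth t y) = ENNReal.ofReal (B ^ (-1 + ε)) *
        (∏ p : Fin m, ENNReal.ofReal (max 1 (absF (y p)) ^ (-(1 + ε)))) *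
        {t : F | absF (t - z) ≤ r * τ}.indicator
          (fun t => ENNReal.ofReal (max 1 (absF t) ^ (-1 + η))) t := by
      intro t
      have h4 : S.indicator (fun y => ENNReal.ofReal (max 1 (absF (y (Fin.last m))) ^ (-1 + η)))
          ((Fin.last m).insertNth t y : Fin (m + 1) → F) =
          {t : F | absF (t - z) ≤ r * τ}.indicator
          (fun t => ENNReal.ofReal (max 1 (absF t) ^ (-1 + η))) t := by
        by_cases ht : absF (t - z) ≤ r * τ
        · rw [Set.indicator_of_mem ((hzS t).mpr ht),
            Set.indicator_of_mem (show t ∈ {t : F | absF (t - z) ≤ r * τ} from ht),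
            Fin.insertNth_apply_same]
        · rw [Set.indicator_of_notMem (fun h => ht ((hzS t).mp h)),
            Set.indicator_of_notMem (show t ∉ {t : F | absF (t - z) ≤ r * τ} from ht)]
      simp only [hG]
      rw [h4]
      simp only [Fin.insertNth_last', Fin.snoc_castSucc]
      ring
    simp only [h3]
    rw [lintegral_const_mul _ ((hmax _).indicator hms'), lintegral_indicator hms', mul_right_comm]
    refine mul_le_mul_left (mul_le_mul_right ?_ _) _
    exact lintegral_ball_max_one_rpow_le z (one_le_mul_of_one_le_of_one_le hr hτ1) hη0 h1
  rw [← lintegral_indicator hms]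
  refine (lintegral_mono hpt).trans ?_
  rw [lintegral_affine_vecMul 0 hdet0 hGm, hdet, inv_one, ENNReal.ofReal_one, one_mul,
    lintegral_haarVec_succ (Fin.last m) hGm]
  refine (lintegral_mono hinner).trans ?_
  have hprod : Measurable fun y : Fin m → F =>
      ∏ p : Fin m, ENNReal.ofReal (max 1 (absF (y p)) ^ (-(1 + ε))) :=
    Finset.measurable_prod _ fun p _ => (hmax _).comp (measurable_pi_apply p)
  rw [lintegral_const_mul _ hprod, lintegral_haarVec_prod fun _ => hmax _]
  have hε1 : ε ≤ 1 := by
    have : (0 : ℝ) ≤ m := Nat.cast_nonneg m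
    nlinarith
  have hI : ∏ _p : Fin m, ∫⁻ t : F, ENNReal.ofReal (max 1 (absF t) ^ (-(1 + ε))) ∂haarF F ≤
      ENNReal.ofReal ((2 / ε) ^ m) := by
    refine (Finset.prod_le_pow_card _ _ _ fun p _ => lintegral_max_one_rpow_le h0 hε1).trans ?_
    rw [Finset.card_univ, Fintype.card_fin, ENNReal.ofReal_pow (by positivity)]
  refine (mul_le_mul_right hI _).trans ?_
  have hr0 : 0 ≤ r := by linarith
  have hτ0 : 0 ≤ τ := by linarith
  rw [← ENNReal.ofReal_mul (by positivity), ← ENNReal.ofReal_mul (by positivity),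
    ← ENNReal.ofReal_mul (by positivity)]
  refine ENNReal.ofReal_le_ofReal ?_
  -- The widening by τ is paid for by τ ≤ B, and ε + 2η = (3 + 4m)ε.
  have h5 : B ^ (-1 + ε) * τ ^ (2 * η) ≤ B ^ (-1 + (3 + 4 * m) * ε) := by
    have : -1 + (3 + 4 * m) * ε = (-1 + ε) + 2 * η := by rw [hη]; ring
    rw [this, Real.rpow_add hB (-1 + ε) (2 * η)]
    exact mul_le_mul_of_nonneg_left (Real.rpow_le_rpow hτ0 hτB (by positivity)) (by positivity)
  rw [Real.mul_rpow hr0 hτ0]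
  calc _ = ((2 / ε) ^ m * (2 / η + 1) * r ^ (2 * η)) * (B ^ (-1 + ε) * τ ^ (2 * η)) := by ring
    _ ≤ _ := mul_le_mul_of_nonneg_left h5 (by positivity)

end TruncatedRow

/-! ### Integrals of powers of the minors over U, by induction on the size. -/

section UnipotentIntegral

variable {F : Type*} [Field F]

lemma exists_eq_gcons_of_upper {n : ℕ} {g : GL (Fin (n + 1)) F}
    (hg : (g : Matrix (Fin (n + 1)) (Fin (n + 1)) F).BlockTriangular id) :
    ∃ (a : F) (v : Fin n → F) (g₂ : GL (Fin n) F), a ≠ 0 ∧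
      (g₂ : Matrix (Fin n) (Fin n) F).BlockTriangular id ∧
      (g : Matrix (Fin (n + 1)) (Fin (n + 1)) F) = gcons a v g₂ := by
  have hdet : (g : Matrix (Fin (n + 1)) (Fin (n + 1)) F).det ≠ 0 :=
    (Matrix.GeneralLinearGroup.det g).ne_zero
  rw [Matrix.det_of_isUpperTriangular hg, Fin.prod_univ_succ] at hdet
  set A := (g : Matrix (Fin (n + 1)) (Fin (n + 1)) F).submatrix Fin.succ Fin.succ
  have hA : A.BlockTriangular id := fun i j h => hg (show id j.succ < id i.succ by simpa using h)
  have hA0 : A.det ≠ 0 := by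
    rw [Matrix.det_of_isUpperTriangular hA]
    exact right_ne_zero_of_mul hdet
  exact ⟨g 0 0, fun j => g 0 j.succ, Matrix.GeneralLinearGroup.mkOfDetNeZero A hA0,
    left_ne_zero_of_mul hdet, hA, (gcons_eta fun i => hg (Fin.succ_pos i)).symm⟩

instance : Subsingleton (unipotent 0 F) :=
  ⟨fun _ _ => Subtype.ext (Units.ext (Matrix.ext fun i => i.elim0))⟩

instance : Subsingleton (unipotent 1 F) :=
  ⟨fun u v => Subtype.ext (Units.ext (Matrix.ext fun i j => by
    rw [Subsingleton.elim j i, u.2.1, v.2.1]))⟩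

variable [ValuativeRel F] [TopologicalSpace F] [IsNonarchimedeanLocalField F]

lemma measurable_revMinors_mul {k : ℕ} [MeasurableSpace (GL (Fin k) F)] [BorelSpace (GL (Fin k) F)]
    (g : GL (Fin k) F) (a : ℝ) : Measurable fun u : unipotent k F => ENNReal.ofReal
      (revMinors (((u : GL (Fin k) F) * g : GL (Fin k) F) : Matrix (Fin k) (Fin k) F) ^ a) := by
  refine (Measurable.pow_const ?_ _).ennreal_ofReal
  simp only [revMinors_coe]
  refine (continuous_prodMinors_coe.comp (?_ : Continuous fun u : unipotent k F =>
    permGL Fin.revPerm * ((u : GL (Fin k) F) * g))).measurable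
  exact continuous_const.mul (continuous_subtype_val.mul continuous_const)

variable (F) in
/-- Convergence of the integral of `revMinors (u * g) ^ (-(1 + s))` over the full unipotent group, with the
dependence on `s` and on the upper triangular matrix `g`. -/
theorem exists_lintegral_revMinors_le (k : ℕ) : ∀ [MeasurableSpace (GL (Fin k) F)]
    [BorelSpace (GL (Fin k) F)] (μ : Measure (unipotent k F)) [μ.IsHaarMeasure],
    ∃ C : ℝ, 0 ≤ C ∧ ∀ (s : ℝ), 0 < s → s ≤ 1 → ∀ g : GL (Fin k) F,
      (g : Matrix (Fin k) (Fin k) F).BlockTriangular id →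
      ∫⁻ u : unipotent k F, ENNReal.ofReal (revMinors
        (((u : GL (Fin k) F) * g : GL (Fin k) F) : Matrix (Fin k) (Fin k) F) ^ (-(1 + s))) ∂μ ≤
      ENNReal.ofReal (C * s⁻¹ ^ (k * k) *
        ∏ i : Fin k, absF (g i i) ^ (-(1 + i : ℝ) - (k - i : ℝ) * s)) := by
  induction k with
  | zero =>
    intro _ _ μ _
    refine ⟨(μ Set.univ).toReal, ENNReal.toReal_nonneg, fun s _ _ g _ => ?_⟩
    have : μ Set.univ ≠ ⊤ := (Set.subsingleton_univ.finite.isCompact.measure_lt_top).ne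
    simp [revMinors, prodMinors, ENNReal.ofReal_toReal this]
  | succ n ih =>
    intro _ _ μ _
    let : MeasurableSpace F := borel F
    have : BorelSpace F := ⟨rfl⟩
    let : MeasurableSpace (GL (Fin n) F) := borel _
    have : BorelSpace (GL (Fin n) F) := ⟨rfl⟩
    let ν : Measure (unipotent n F) := Measure.haar
    obtain ⟨C, hC, hint⟩ := ih ν
    obtain ⟨c, hc⟩ := exists_lintegral_unipotent_eq μ ν
    refine ⟨c * (C * 2 ^ n), by positivity, fun s hs hs1 g hg => ?_⟩
    obtain ⟨a, v, g₂, ha, hg₂, e⟩ := exists_eq_gcons_of_upper hg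
    have ha0 := absF_pos ha
    have hpt : ∀ (u : unipotent n F) (x : Fin n → F), revMinors
        (((ucons x u : GL (Fin (n + 1)) F) * g : GL (Fin (n + 1)) F) :
          Matrix (Fin (n + 1)) (Fin (n + 1)) F) =
        prodMinors (blk ((permGL Fin.revPerm * ((u : GL (Fin n) F) * g₂) : GL (Fin n) F) :
          Matrix (Fin n) (Fin n) F) 0 (v + Matrix.vecMul x (g₂ : Matrix (Fin n) (Fin n) F)) a) := by
      intro u x
      rw [Units.val_mul, coe_ucons, e, gcons_mul, revMinors_gcons, coe_permGL_rev_mul,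
        Units.val_mul, one_mul, one_smul]
    rw [hc _ (measurable_revMinors_mul g _)]
    simp only [hpt]
    refine (mul_le_mul_right (lintegral_mono fun u =>
      lintegral_prodMinors_blk_rpow_le _ g₂ v ha hs hs1) _).trans ?_
    simp only [← revMinors_coe]
    rw [lintegral_const_mul _ (measurable_revMinors_mul g₂ _)]
    refine (mul_le_mul_right (mul_le_mul_right (hint s hs hs1 g₂ hg₂) _) _).trans ?_
    have hd := absF_det_pos g₂
    rw [← ENNReal.ofReal_coe_nnreal, ← ENNReal.ofReal_mul (by positivity),
      ← ENNReal.ofReal_mul (by positivity)]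
    refine ENNReal.ofReal_le_ofReal ?_
    have hgi : ∀ i, 0 < absF (g₂ i i) := by
      intro i
      rw [Matrix.det_of_isUpperTriangular hg₂, absF_prod] at hd
      exact lt_of_le_of_ne (absF_nonneg _) fun h =>
        hd.ne (Finset.prod_eq_zero (Finset.mem_univ i) h.symm).symm
    have hprod : (∏ i : Fin (n + 1), absF (g i i) ^ (-(1 + i : ℝ) - ((n + 1 : ℕ) - i : ℝ) * s)) =
        absF a ^ (-(1 + ((n : ℝ) + 1) * s)) * (absF (g₂ : Matrix (Fin n) (Fin n) F).det)⁻¹ *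
          ∏ i : Fin n, absF (g₂ i i) ^ (-(1 + i : ℝ) - (n - i : ℝ) * s) := by
      rw [Fin.prod_univ_succ, Matrix.det_of_isUpperTriangular hg₂, absF_prod,
        ← Finset.prod_inv_distrib, mul_assoc, ← Finset.prod_mul_distrib, e]
      congr 1
      · rw [gcons_zero_zero]
        congr 1
        push_cast [Fin.val_zero]
        ring
      · refine Finset.prod_congr rfl fun i _ => ?_
        rw [gcons_succ_succ, ← Real.rpow_neg_one (absF (g₂ i i)), ← Real.rpow_add (hgi i)]
        congr 1
        push_cast [Fin.val_succ]
        ring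
    rw [hprod]
    set Q := ∏ i : Fin n, absF (g₂ i i) ^ (-(1 + i : ℝ) - (n - i : ℝ) * s)
    have hQ : 0 ≤ Q := Finset.prod_nonneg fun i _ => Real.rpow_nonneg (absF_nonneg _) _
    -- The row contributes n powers of 1/s and the corner n², and n + n² ≤ (n + 1)².
    have hs2 : (2 / s) ^ n * s⁻¹ ^ (n * n) ≤ 2 ^ n * s⁻¹ ^ ((n + 1) * (n + 1)) := by
      rw [div_eq_mul_inv, mul_pow, mul_assoc, ← pow_add]
      refine mul_le_mul_of_nonneg_left (pow_le_pow_right₀ ((one_le_inv₀ hs).mpr hs1) ?_)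
        (by positivity)
      nlinarith
    calc _ = (c * C * (absF a ^ (-(1 + ((n : ℝ) + 1) * s)) *
            (absF (g₂ : Matrix (Fin n) (Fin n) F).det)⁻¹ * Q)) *
            ((2 / s) ^ n * s⁻¹ ^ (n * n)) := by ring
      _ ≤ (c * C * (absF a ^ (-(1 + ((n : ℝ) + 1) * s)) *
            (absF (g₂ : Matrix (Fin n) (Fin n) F).det)⁻¹ * Q)) *
            (2 ^ n * s⁻¹ ^ ((n + 1) * (n + 1))) := mul_le_mul_of_nonneg_left hs2 (by positivity)
      _ = _ := by ring

variable (F) in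
/-- The unipotent matrices whose coefficients just above the diagonal are bounded by `r`. -/
def superdiagBall (k : ℕ) (r : ℝ) : Set (unipotent k F) :=
  {u | ∀ i j : Fin k, (i : ℕ) + 1 = j → absF ((u : GL (Fin k) F) i j) ≤ r}

lemma measurableSet_superdiagBall (k : ℕ) [MeasurableSpace (GL (Fin k) F)]
    [BorelSpace (GL (Fin k) F)] (r : ℝ) : MeasurableSet (superdiagBall F k r) := by
  have e : superdiagBall F k r = ⋂ i : Fin k, ⋂ j : Fin k, ⋂ (_ : (i : ℕ) + 1 = (j : ℕ)),
      {u : unipotent k F | absF ((u : GL (Fin k) F) i j) ≤ r} := by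
    ext u
    simp only [Set.mem_iInter]
    rfl
  rw [e]
  refine IsClosed.measurableSet ?_
  refine isClosed_iInter fun i => isClosed_iInter fun j => isClosed_iInter fun _ =>
    isClosed_le (continuous_absF.comp ?_) continuous_const
  exact (Units.continuous_val.comp continuous_subtype_val).matrix_elem i j

variable (F) in
/-- The integral over `U(F)_c` of a power of `revMinors u` slightly larger than `-1` grows at
most exponentially in `c`. -/
theorem exists_setLIntegral_revMinors_le (m : ℕ) : ∃ ε : ℝ, 0 < ε ∧ ε ≤ 1 ∧ ∃ A : ℝ, 0 ≤ A ∧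
    ∀ [MeasurableSpace (GL (Fin (m + 1)) F)] [BorelSpace (GL (Fin (m + 1)) F)]
      (μ : Measure (unipotent (m + 1) F)) [μ.IsHaarMeasure],
    ∃ C : ℝ, 0 ≤ C ∧ ∀ r : ℝ, 1 ≤ r →
      ∫⁻ u in superdiagBall F (m + 1) r, ENNReal.ofReal (revMinors
        ((u : GL (Fin (m + 1)) F) : Matrix (Fin (m + 1)) (Fin (m + 1)) F) ^ (-1 + ε)) ∂μ ≤
      ENNReal.ofReal (C * r ^ A) := by
  induction m with
  | zero =>
    refine ⟨1, one_pos, le_rfl, 0, le_rfl, fun μ _ => ?_⟩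
    have : Subsingleton (unipotent (0 + 1) F) := inferInstanceAs (Subsingleton (unipotent 1 F))
    refine ⟨(μ Set.univ).toReal, ENNReal.toReal_nonneg, fun r _ => ?_⟩
    have : μ Set.univ ≠ ⊤ := (Set.subsingleton_univ.finite.isCompact.measure_lt_top).ne
    simpa [ENNReal.ofReal_toReal this] using measure_mono (Set.subset_univ _)
  | succ m ih =>
    obtain ⟨ε', hε', hε1', A, hA, hint⟩ := ih
    -- Chosen so that integrating out the row turns the exponent `-1 + ε` into the exponent `-1 +
    -- ε'` of the induction hypothesis.
    set ε : ℝ := ε' / (3 + 4 * m) with hε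
    have hm : (0 : ℝ) ≤ m := Nat.cast_nonneg m
    have hε0 : 0 < ε := by positivity
    have hε3 : (3 + 4 * m) * ε = ε' := by rw [hε]; field_simp
    have hη1 : (1 + 2 * m) * ε ≤ 1 := by nlinarith
    refine ⟨ε, hε0, by nlinarith, A + 2 * ((1 + 2 * m) * ε), by positivity, ?_⟩
    intro _ _ μ _
    let : MeasurableSpace F := borel F
    have : BorelSpace F := ⟨rfl⟩
    let : MeasurableSpace (GL (Fin (m + 1)) F) := borel _
    have : BorelSpace (GL (Fin (m + 1)) F) := ⟨rfl⟩
    let ν : Measure (unipotent (m + 1) F) := Measure.haar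
    obtain ⟨C, hC, hint⟩ := hint ν
    obtain ⟨c, hc⟩ := exists_lintegral_unipotent_eq μ ν
    set L : ℝ := (2 / ε) ^ m * (2 / ((1 + 2 * m) * ε) + 1)
    refine ⟨c * (L * C), by positivity, fun r hr => ?_⟩
    have hr0 : 0 < r := by linarith
    have hmeas : ∀ (k : ℕ) [MeasurableSpace (GL (Fin k) F)] [BorelSpace (GL (Fin k) F)] (a : ℝ),
        Measurable fun u : unipotent k F => ENNReal.ofReal
          (revMinors ((u : GL (Fin k) F) : Matrix (Fin k) (Fin k) F) ^ a) := by
      intro k _ _ a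
      simpa only [mul_one] using measurable_revMinors_mul (1 : GL (Fin k) F) a
    have hpt : ∀ (u : unipotent (m + 1) F) (x : Fin (m + 1) → F),
        (superdiagBall F (m + 2) r).indicator (fun u => ENNReal.ofReal (revMinors
          ((u : GL (Fin (m + 2)) F) : Matrix (Fin (m + 2)) (Fin (m + 2)) F) ^ (-1 + ε)))
          (ucons x u) ≤
        (superdiagBall F (m + 1) r).indicator (fun u =>
          {x : Fin (m + 1) → F | absF (x 0) ≤ r}.indicator (fun x => ENNReal.ofReal (prodMinors (blk
            ((permGL Fin.revPerm * (u : GL (Fin (m + 1)) F) : GL (Fin (m + 1)) F) :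
            Matrix (Fin (m + 1)) (Fin (m + 1)) F) 0 x 1) ^ (-1 + ε))) x) u := by
      intro u x
      by_cases h : ucons x u ∈ superdiagBall F (m + 2) r
      · have hu : u ∈ superdiagBall F (m + 1) r := fun i j hij => h i.succ j.succ (by simpa using hij)
        have hx : x ∈ {x : Fin (m + 1) → F | absF (x 0) ≤ r} := h 0 (Fin.succ 0) (by simp)
        rw [Set.indicator_of_mem h, Set.indicator_of_mem hu, Set.indicator_of_mem hx, coe_ucons,
          revMinors_gcons, coe_permGL_rev_mul]
      · rw [Set.indicator_of_notMem h]
        exact zero_le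
    have hx : MeasurableSet {x : Fin (m + 1) → F | absF (x 0) ≤ r} :=
      (isClosed_le (continuous_absF.comp (continuous_apply 0)) continuous_const).measurableSet
    rw [← lintegral_indicator (measurableSet_superdiagBall _ r),
      hc _ ((hmeas _ _).indicator (measurableSet_superdiagBall _ r))]
    have hin : ∀ u : unipotent (m + 1) F, ∫⁻ x, (superdiagBall F (m + 2) r).indicator
        (fun u => ENNReal.ofReal (revMinors
          ((u : GL (Fin (m + 2)) F) : Matrix (Fin (m + 2)) (Fin (m + 2)) F) ^ (-1 + ε)))
          (ucons x u) ∂haarVec F (Fin (m + 1)) ≤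
        ENNReal.ofReal (L * r ^ (2 * ((1 + 2 * m) * ε))) * (superdiagBall F (m + 1) r).indicator
          (fun u => ENNReal.ofReal (revMinors ((u : GL (Fin (m + 1)) F) :
            Matrix (Fin (m + 1)) (Fin (m + 1)) F) ^ (-1 + ε'))) u := by
      intro u
      refine (lintegral_mono (hpt u)).trans ?_
      by_cases hu : u ∈ superdiagBall F (m + 1) r
      · simp only [Set.indicator_of_mem hu]
        rw [lintegral_indicator hx, revMinors_coe, ← hε3]
        refine setLIntegral_prodMinors_blk_rpow_le _ ?_ (fun i => ?_) hε0 hη1 hr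
        · rw [coe_permGL_rev_mul, Matrix.submatrix_apply, Fin.rev_last, id, u.2.1, absF_one]
        · rw [coe_permGL_rev_mul]
          exact one_le_minorSup_rev u.2 i
      · simp only [Set.indicator_of_notMem hu, lintegral_zero, mul_zero, le_refl]
    refine (mul_le_mul_right (lintegral_mono hin) _).trans ?_
    rw [lintegral_const_mul _ ((hmeas _ _).indicator (measurableSet_superdiagBall _ r)),
      lintegral_indicator (measurableSet_superdiagBall _ r)]
    refine (mul_le_mul_right (mul_le_mul_right (hint r hr) _) _).trans ?_
    rw [← ENNReal.ofReal_coe_nnreal, ← ENNReal.ofReal_mul (by positivity),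
      ← ENNReal.ofReal_mul (by positivity)]
    refine ENNReal.ofReal_le_ofReal (le_of_eq ?_)
    rw [Real.rpow_add hr0]
    ring

end UnipotentIntegral

/-! ### Splitting the integrand and choosing the cut; the final estimates. -/

section Estimate

variable {F : Type*} [Field F] [ValuativeRel F] [TopologicalSpace F] [IsNonarchimedeanLocalField F]
variable {k : ℕ}

lemma sph_rev_mul (x : GL (Fin k) F) : sph (permGL Fin.revPerm * x) =
    absF (x : Matrix (Fin k) (Fin k) F).det ^ (((k : ℝ) + 1) / 2) /
      revMinors (x : Matrix (Fin k) (Fin k) F) := by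
  rw [sph, ← revMinors_coe, Units.val_mul, Matrix.det_mul, absF_mul,
    absF_det_eq_one_of_mem (permGL_mem _), one_mul]

lemma revMinors_mul_le (x b : GL (Fin k) F) :
    revMinors ((x * b : GL (Fin k) F) : Matrix (Fin k) (Fin k) F) ≤
      Real.exp ((k * k : ℝ) * sigma b) * revMinors (x : Matrix (Fin k) (Fin k) F) := by
  rw [revMinors_coe, revMinors_coe, ← mul_assoc, Units.val_mul _ b]
  refine (prodMinors_mul_le (one_le_exp_sigma b) (absF_le_exp_sigma b)).trans (le_of_eq ?_)
  rw [← Real.exp_nat_mul]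
  push_cast
  rfl

lemma pow_le_mul_exp (e : ℕ) {x ε : ℝ} (hx : 0 ≤ x) (hε : 0 < ε) :
    x ^ e ≤ (e.factorial * (2 / ε) ^ e) * Real.exp (ε / 2 * x) := by
  have h := Real.pow_div_factorial_le_exp (ε / 2 * x) (by positivity) e
  rw [div_le_iff₀ (by positivity), mul_pow] at h
  calc x ^ e = (2 / ε) ^ e * ((ε / 2) ^ e * x ^ e) := by
        rw [← mul_assoc, ← mul_pow]; field_simp; simp
    _ ≤ (2 / ε) ^ e * (Real.exp (ε / 2 * x) * e.factorial) := by gcongr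
    _ = _ := by ring

/-- The integrand, split according to the size of the minors of `w u`. -/
lemma sigma_pow_mul_sph_le (e : ℕ) {ε T : ℝ} (hε : 0 < ε) {u b : GL (Fin k) F}
    (hu : u ∈ unipotent k F) (hT1 : 1 ≤ T) (hT : sigma b ≤ T) :
    sigma (u * b) ^ e * sph (permGL Fin.revPerm * (u * b)) ≤
      ((k + 2) * T) ^ e * Real.exp (k * k + 1) *
          absF (b : Matrix (Fin k) (Fin k) F).det ^ (((k : ℝ) + 1) / 2) *
          revMinors ((u * b : GL (Fin k) F) : Matrix (Fin k) (Fin k) F) ^ (-(1 + T⁻¹)) +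
        (k + 2) ^ e * (e.factorial * (2 / ε) ^ e) * Real.exp ((2 * k * k + k) * sigma b) *
          Real.exp (-(ε / 2 * T)) * revMinors (u : Matrix (Fin k) (Fin k) F) ^ (-1 + ε) := by
  have hY1 := one_le_revMinors hu
  have hσ := sigma_unipotent_le hu
  have hub := sigma_mul_le u b
  have hX := revMinors_pos (u * b)
  have hXY := revMinors_mul_le u b
  have hdet : absF ((u * b : GL (Fin k) F) : Matrix (Fin k) (Fin k) F).det =
      absF (b : Matrix (Fin k) (Fin k) F).det := by
    rw [Units.val_mul, Matrix.det_mul, Matrix.det_of_isUpperTriangular (unipotent_upper hu)]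
    simp [hu.1]
  have hdetu : absF (u : Matrix (Fin k) (Fin k) F).det = 1 := by
    rw [Matrix.det_of_isUpperTriangular (unipotent_upper hu)]
    simp [hu.1]
  set X := revMinors ((u * b : GL (Fin k) F) : Matrix (Fin k) (Fin k) F)
  set Y := revMinors (u : Matrix (Fin k) (Fin k) F)
  have hY0 : 0 < Y := by linarith
  have hk : (0 : ℝ) ≤ k := Nat.cast_nonneg k
  have hd := Real.rpow_nonneg (absF_nonneg (b : Matrix (Fin k) (Fin k) F).det) (((k : ℝ) + 1) / 2)
  have hT0 : 0 < T := by linarith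
  have hσ0 := (sigma_pos (u * b)).le
  -- Below the cut X is at most exp((k² + 1)T), so X^{1/T} is bounded and 1/X may be replaced by
  -- X^{-(1+1/T)}. Above it, half of Y^ε absorbs the powers of log Y and the other half gives
  -- exp(-εT/2).
  rcases le_or_gt (Real.log Y) T with h | h
  · refine le_add_of_le_of_nonneg ?_ (by positivity)
    have h1 : sigma (u * b) ≤ (k + 2) * T := by nlinarith
    have h2 : X⁻¹ ≤ Real.exp (k * k + 1) * X ^ (-(1 + T⁻¹)) := by
      have h3 : X ^ T⁻¹ ≤ Real.exp (k * k + 1) := by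
        have h4 : X ≤ Real.exp ((k * k + 1) * T) := by
          refine hXY.trans ?_
          rw [← Real.exp_log hY0, ← Real.exp_add]
          refine Real.exp_le_exp.mpr ?_
          nlinarith [mul_nonneg hk hk, mul_le_mul_of_nonneg_left hT (mul_nonneg hk hk)]
        refine (Real.rpow_le_rpow hX.le h4 (by positivity)).trans (le_of_eq ?_)
        rw [← Real.exp_mul]
        congr 1
        field_simp
      have h5 : X⁻¹ = X ^ T⁻¹ * X ^ (-(1 + T⁻¹)) := by
        rw [← Real.rpow_add hX, ← Real.rpow_neg_one]
        congr 1; ring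
      rw [h5]
      exact mul_le_mul_of_nonneg_right h3 (by positivity)
    rw [sph_rev_mul, hdet, div_eq_mul_inv]
    calc _ ≤ ((k + 2) * T) ^ e * (absF (b : Matrix (Fin k) (Fin k) F).det ^ (((k : ℝ) + 1) / 2) *
          (Real.exp (k * k + 1) * X ^ (-(1 + T⁻¹)))) := by gcongr
      _ = _ := by ring
  · refine le_add_of_nonneg_of_le (by positivity) ?_
    have h1 : sigma (u * b) ≤ (k + 2) * Real.log Y := by nlinarith
    have hL : 0 ≤ Real.log Y := by linarith
    have h2 : Real.log Y ^ e * Y⁻¹ ≤ (e.factorial * (2 / ε) ^ e) *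
        (Real.exp (-(ε / 2 * T)) * Y ^ (-1 + ε)) := by
      have h3 := pow_le_mul_exp e hL hε
      have h4 : Real.exp (ε / 2 * Real.log Y) * Y⁻¹ ≤ Real.exp (-(ε / 2 * T)) * Y ^ (-1 + ε) := by
        have : Y⁻¹ = Real.exp (-Real.log Y) := by rw [Real.exp_neg, Real.exp_log hY0]
        rw [this, ← Real.exp_add, Real.rpow_def_of_pos hY0, ← Real.exp_add]
        refine Real.exp_le_exp.mpr ?_
        nlinarith
      calc _ ≤ ((e.factorial * (2 / ε) ^ e) * Real.exp (ε / 2 * Real.log Y)) * Y⁻¹ := by gcongr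
        _ = (e.factorial * (2 / ε) ^ e) * (Real.exp (ε / 2 * Real.log Y) * Y⁻¹) := by ring
        _ ≤ _ := by gcongr
    have h5 : sph (permGL Fin.revPerm * (u * b)) ≤
        Real.exp ((2 * k * k + k) * sigma b) * Y⁻¹ := by
      have := sph_mul_le (permGL Fin.revPerm * u) b
      rwa [mul_assoc, sph_rev_mul u, hdetu, Real.one_rpow, one_div] at this
    calc _ ≤ ((k + 2) * Real.log Y) ^ e * (Real.exp ((2 * k * k + k) * sigma b) * Y⁻¹) :=
          mul_le_mul (pow_le_pow_left₀ hσ0 h1 e) h5 (sph_pos _).le (by positivity)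
      _ = (k + 2) ^ e * Real.exp ((2 * k * k + k) * sigma b) * (Real.log Y ^ e * Y⁻¹) := by
          rw [mul_pow]; ring
      _ ≤ (k + 2) ^ e * Real.exp ((2 * k * k + k) * sigma b) * ((e.factorial * (2 / ε) ^ e) *
          (Real.exp (-(ε / 2 * T)) * Y ^ (-1 + ε))) := by gcongr
      _ = _ := by ring

lemma absF_diag_inv_le_of_upper {b : GL (Fin k) F}
    (hb : (b : Matrix (Fin k) (Fin k) F).BlockTriangular id) (i : Fin k) :
    Real.exp (-sigma b) ≤ absF (b i i) := by
  have hinv : ((b⁻¹ : GL (Fin k) F) : Matrix (Fin k) (Fin k) F).BlockTriangular id := by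
    let := b.invertible
    rw [Matrix.coe_units_inv]
    exact Matrix.blockTriangular_inv_of_blockTriangular hb
  have h1 : b i i * (b⁻¹ : GL (Fin k) F) i i = 1 := by
    have h2 : (b * b⁻¹ : GL (Fin k) F) i i = 1 := by
      rw [mul_inv_cancel, Units.val_one, Matrix.one_apply_eq]
    rw [Units.val_mul, Matrix.mul_apply, Finset.sum_eq_single i] at h2
    · exact h2
    · intro j _ hj
      rcases lt_or_gt_of_ne hj with h | h
      · rw [show b i j = 0 from hb h, zero_mul]
      · rw [show (b⁻¹ : GL (Fin k) F) j i = 0 from hinv h, mul_zero]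
    · simp
  have h3 : absF (b i i) * absF ((b⁻¹ : GL (Fin k) F) i i) = 1 := by rw [← absF_mul, h1, absF_one]
  rw [Real.exp_neg, inv_le_iff_one_le_mul₀ (Real.exp_pos _), ← h3]
  exact mul_le_mul_of_nonneg_left (absF_inv_le_exp_sigma b i i) (absF_nonneg _)

/-- At s = 0 the left side is exactly `sph b`. Since |b_ii| ≥ exp(-σ(b)) and σ(b)s ≤ 1, each factor
|b_ii|^{-(k-i)s} is at most exp(k). -/
lemma prod_absF_diag_rpow_le {b : GL (Fin k) F}
    (hb : (b : Matrix (Fin k) (Fin k) F).BlockTriangular id) {s : ℝ} (hs : 0 ≤ s)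
    (hsσ : sigma b * s ≤ 1) :
    absF (b : Matrix (Fin k) (Fin k) F).det ^ (((k : ℝ) + 1) / 2) *
      ∏ i : Fin k, absF (b i i) ^ (-(1 + i : ℝ) - (k - i : ℝ) * s) ≤
      Real.exp (k * k) * sph b := by
  have hk : (0 : ℝ) ≤ k := Nat.cast_nonneg k
  have hbi : ∀ i, 0 < absF (b i i) := fun i =>
    (Real.exp_pos _).trans_le (absF_diag_inv_le_of_upper hb i)
  have h1 : ∀ i : Fin k, absF (b i i) ^ (-(1 + i : ℝ) - (k - i : ℝ) * s) ≤
      (absF (b i i) ^ ((i : ℕ) + 1))⁻¹ * Real.exp k := by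
    intro i
    have hik : (i : ℝ) ≤ k := by exact_mod_cast i.2.le
    have hi0 : (0 : ℝ) ≤ (i : ℕ) := Nat.cast_nonneg _
    rw [sub_eq_add_neg, Real.rpow_add (hbi i), Real.rpow_neg (hbi i).le, ← Real.rpow_natCast]
    have h2 : absF (b i i) ^ (-(((k : ℝ) - i) * s)) ≤ Real.exp k := by
      have h3 : 0 ≤ ((k : ℝ) - i) * s := mul_nonneg (by linarith) hs
      refine (Real.rpow_le_rpow_of_nonpos (Real.exp_pos _) (absF_diag_inv_le_of_upper hb i)
        (by linarith)).trans ?_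
      rw [← Real.exp_mul]
      refine Real.exp_le_exp.mpr ?_
      have : ((k : ℝ) - i) * (sigma b * s) ≤ ((k : ℝ) - i) * 1 :=
        mul_le_mul_of_nonneg_left hsσ (by linarith)
      linarith
    push_cast
    rw [add_comm (1 : ℝ)]
    exact mul_le_mul_of_nonneg_left h2 (by have := hbi i; positivity)
  have h4 := Finset.prod_le_prod (s := Finset.univ)
    (fun i _ => Real.rpow_nonneg (hbi i).le _) fun i _ => h1 i
  rw [Finset.prod_mul_distrib, Finset.prod_inv_distrib, ← prodMinors_upper hb, Finset.prod_const,
    Finset.card_univ, Fintype.card_fin, ← Real.exp_nat_mul] at h4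
  refine (mul_le_mul_of_nonneg_left h4 (Real.rpow_nonneg (absF_nonneg _) _)).trans (le_of_eq ?_)
  rw [sph]
  ring

/-- The cut T is proportional to `c σ(g)`. The first bound is used with s = 1/T and yields T^{k²}.
In the second, exp(-εT/2) compensates q^{cA} and all exponentials in σ(g). -/
lemma exists_setLIntegral_sph_le_of_bounds (e : ℕ) [MeasurableSpace (GL (Fin k) F)]
    [BorelSpace (GL (Fin k) F)] (μ : Measure (unipotent k F)) {C₁ C₂ ε A : ℝ} (hC₁ : 0 ≤ C₁)
    (hC₂ : 0 ≤ C₂) (hε : 0 < ε) (hA : 0 ≤ A)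
    (h1 : ∀ s : ℝ, 0 < s → s ≤ 1 → ∀ g : GL (Fin k) F,
      (g : Matrix (Fin k) (Fin k) F).BlockTriangular id →
      ∫⁻ u : unipotent k F, ENNReal.ofReal (revMinors
        (((u : GL (Fin k) F) * g : GL (Fin k) F) : Matrix (Fin k) (Fin k) F) ^ (-(1 + s))) ∂μ ≤
      ENNReal.ofReal (C₁ * s⁻¹ ^ (k * k) *
        ∏ i : Fin k, absF (g i i) ^ (-(1 + i : ℝ) - (k - i : ℝ) * s)))
    (h2 : ∀ r : ℝ, 1 ≤ r → ∫⁻ u in superdiagBall F k r, ENNReal.ofReal (revMinors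
        ((u : GL (Fin k) F) : Matrix (Fin k) (Fin k) F) ^ (-1 + ε)) ∂μ ≤
      ENNReal.ofReal (C₂ * r ^ A)) :
    ∃ C : ℝ, 0 ≤ C ∧ ∀ c : ℕ, 1 ≤ c → ∀ g : GL (Fin k) F,
      ∫⁻ u in superdiagBall F k (resCard F ^ c), ENNReal.ofReal
        (sigma ((u : GL (Fin k) F) * g) ^ e *
          sph (permGL Fin.revPerm * ((u : GL (Fin k) F) * g))) ∂μ ≤
      ENNReal.ofReal (C * (c * sigma g) ^ (e + k * k) * sph g) := by
  set E : ℝ := 2 * k * k + k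
  have hE : 0 ≤ E := by positivity
  have hq := one_lt_resCard F
  have hq0 := resCard_pos F
  have hlq : 0 ≤ Real.log (resCard F) := Real.log_nonneg hq.le
  -- Then εT/2 exceeds (2E + A log q) c σ(b). One E pays for comparing w·u·b with w·u, the other for
  -- the lower bound of `sph b`, and A log q for the growth in c.
  set β : ℝ := 1 + 2 / ε * (2 * E + A * Real.log (resCard F))
  have hβ1 : 1 ≤ β := le_add_of_nonneg_right (by positivity)
  set M : ℝ := (k + 2) ^ e * (e.factorial * (2 / ε) ^ e) * C₂
  refine ⟨(k + 2) ^ e * Real.exp (k * k + 1) * C₁ * Real.exp (k * k) * β ^ (e + k * k) + M,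
    by positivity, fun c hc g => ?_⟩
  obtain ⟨a, v, hv, κ, hκ, rfl⟩ := iwasawa g
  set b : GL (Fin k) F := diagGL a * v
  have hb : (b : Matrix (Fin k) (Fin k) F).BlockTriangular id :=
    (diagGL_upper a).mul (unipotent_upper hv)
  have hassoc : ∀ x : GL (Fin k) F, x * (b * κ) = x * b * κ := fun x => (mul_assoc x b κ).symm
  have hassoc' : ∀ x : GL (Fin k) F, permGL Fin.revPerm * (x * κ) = permGL Fin.revPerm * x * κ :=
    fun x => (mul_assoc _ x κ).symm
  simp only [hassoc, hassoc', sph_mul_mem _ hκ, sigma_mul_mem _ hκ]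
  clear_value b
  have hσ1 := one_le_sigma b
  have hc1 : (1 : ℝ) ≤ c := by exact_mod_cast hc
  have hcσ : 1 ≤ c * sigma b := one_le_mul_of_one_le_of_one_le hc1 hσ1
  set T : ℝ := β * (c * sigma b) with hTdef
  have hT1 : 1 ≤ T := one_le_mul_of_one_le_of_one_le hβ1 hcσ
  have hσc : sigma b ≤ c * sigma b := le_mul_of_one_le_left (by linarith) hc1
  have hσT : sigma b ≤ T := hσc.trans (le_mul_of_one_le_left (by linarith) hβ1)
  have hT0 : 0 < T := by linarith
  have hd := Real.rpow_nonneg (absF_nonneg (b : Matrix (Fin k) (Fin k) F).det) (((k : ℝ) + 1) / 2)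
  set M₁ : ℝ := ((k + 2) * T) ^ e * Real.exp (k * k + 1) *
    absF (b : Matrix (Fin k) (Fin k) F).det ^ (((k : ℝ) + 1) / 2)
  set M₂ : ℝ := (k + 2) ^ e * (e.factorial * (2 / ε) ^ e) * Real.exp (E * sigma b) *
    Real.exp (-(ε / 2 * T))
  have hM₁ : 0 ≤ M₁ := by positivity
  have hM₂ : 0 ≤ M₂ := by positivity
  have hpt : ∀ u : unipotent k F, ENNReal.ofReal (sigma ((u : GL (Fin k) F) * b) ^ e *
      sph (permGL Fin.revPerm * ((u : GL (Fin k) F) * b))) ≤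
      ENNReal.ofReal M₁ * ENNReal.ofReal (revMinors (((u : GL (Fin k) F) * b : GL (Fin k) F) :
        Matrix (Fin k) (Fin k) F) ^ (-(1 + T⁻¹))) +
      ENNReal.ofReal M₂ * ENNReal.ofReal (revMinors ((u : GL (Fin k) F) :
        Matrix (Fin k) (Fin k) F) ^ (-1 + ε)) := by
    intro u
    have hp1 := (revMinors_pos ((u : GL (Fin k) F) * b)).le
    have hp2 := (revMinors_pos (u : GL (Fin k) F)).le
    rw [← ENNReal.ofReal_mul hM₁, ← ENNReal.ofReal_mul hM₂,
      ← ENNReal.ofReal_add (by positivity) (by positivity)]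
    exact ENNReal.ofReal_le_ofReal (sigma_pow_mul_sph_le e hε u.2 hT1 hσT)
  have hm1 := measurable_revMinors_mul b (-(1 + T⁻¹))
  have hm2 : Measurable fun u : unipotent k F => ENNReal.ofReal
      (revMinors ((u : GL (Fin k) F) : Matrix (Fin k) (Fin k) F) ^ (-1 + ε)) := by
    simpa only [mul_one] using measurable_revMinors_mul (1 : GL (Fin k) F) (-1 + ε)
  refine (lintegral_mono hpt).trans ?_
  rw [lintegral_add_left (hm1.const_mul _), lintegral_const_mul _ hm1, lintegral_const_mul _ hm2]
  have hr1 : (1 : ℝ) ≤ resCard F ^ c := one_le_pow₀ hq.le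
  refine (add_le_add (mul_le_mul_right ((setLIntegral_le_lintegral _ _).trans
    (h1 T⁻¹ (inv_pos.mpr hT0) (inv_le_one_of_one_le₀ hT1) b hb)) _)
    (mul_le_mul_right (h2 _ hr1) _)).trans ?_
  have hp := prod_absF_diag_rpow_le hb (inv_nonneg.mpr hT0.le)
    (by rw [← div_eq_mul_inv, div_le_one hT0]; exact hσT)
  set P := ∏ i : Fin k, absF (b i i) ^ (-(1 + i : ℝ) - (k - i : ℝ) * T⁻¹)
  have hP0 : 0 ≤ P := Finset.prod_nonneg fun i _ => Real.rpow_nonneg (absF_nonneg _) _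
  have hsph := (sph_pos b).le
  have hrA : 0 ≤ (resCard F ^ c) ^ A := by positivity
  rw [← ENNReal.ofReal_mul hM₁, ← ENNReal.ofReal_mul hM₂,
    ← ENNReal.ofReal_add (by positivity) (by positivity)]
  refine ENNReal.ofReal_le_ofReal ?_
  rw [inv_inv, add_mul, add_mul]
  refine add_le_add ?_ ?_
  · calc M₁ * (C₁ * T ^ (k * k) * P) = ((k + 2) * T) ^ e * Real.exp (k * k + 1) * C₁ *
          T ^ (k * k) * (absF (b : Matrix (Fin k) (Fin k) F).det ^ (((k : ℝ) + 1) / 2) * P) := by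
          ring
      _ ≤ ((k + 2) * T) ^ e * Real.exp (k * k + 1) * C₁ *
          T ^ (k * k) * (Real.exp (k * k) * sph b) := by gcongr
      _ = (k + 2) ^ e * Real.exp (k * k + 1) * C₁ * Real.exp (k * k) * (T ^ e * T ^ (k * k)) *
          sph b := by rw [mul_pow]; ring
      _ = _ := by rw [← pow_add, hTdef, mul_pow β]; ring
  · have hexp : Real.exp (E * sigma b) * Real.exp (-(ε / 2 * T)) * (resCard F ^ c) ^ A ≤ sph b := by
      refine le_trans ?_ (exp_neg_sigma_le_sph b)
      have : (resCard F ^ c) ^ A = Real.exp (c * (A * Real.log (resCard F))) := by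
        rw [Real.rpow_def_of_pos (by positivity), Real.log_pow]
        congr 1; ring
      rw [this, ← Real.exp_add, ← Real.exp_add]
      refine Real.exp_le_exp.mpr ?_
      have h3 : ε / 2 * T = ε / 2 * (c * sigma b) +
          (2 * E + A * Real.log (resCard F)) * (c * sigma b) := by
        rw [hTdef]
        simp only [β]
        field_simp
      have h4 : 0 ≤ ε / 2 * (c * sigma b) := by positivity
      have h5 : E * sigma b ≤ E * (c * sigma b) := mul_le_mul_of_nonneg_left hσc hE
      have h6 : c * (A * Real.log (resCard F)) ≤ (A * Real.log (resCard F)) * (c * sigma b) := by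
        rw [mul_comm]
        refine mul_le_mul_of_nonneg_left (le_mul_of_one_le_right (by linarith) hσ1) (by positivity)
      change E * sigma b + -(ε / 2 * T) + c * (A * Real.log (resCard F)) ≤ -(E * sigma b)
      nlinarith
    calc M₂ * (C₂ * (resCard F ^ c) ^ A) = M * (Real.exp (E * sigma b) *
          Real.exp (-(ε / 2 * T)) * (resCard F ^ c) ^ A) := by ring
      _ ≤ M * sph b := by gcongr
      _ ≤ M * (c * sigma b) ^ (e + k * k) * sph b := by
          rw [mul_assoc M]
          exact mul_le_mul_of_nonneg_left
            (le_mul_of_one_le_left hsph (one_le_pow₀ hcσ)) (by positivity : 0 ≤ M)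

variable (F) in
theorem exists_setLIntegral_sph_le (m e : ℕ) [MeasurableSpace (GL (Fin (m + 1)) F)]
    [BorelSpace (GL (Fin (m + 1)) F)] (μ : Measure (unipotent (m + 1) F)) [μ.IsHaarMeasure] :
    ∃ C : ℝ, 0 ≤ C ∧ ∀ c : ℕ, 1 ≤ c → ∀ g : GL (Fin (m + 1)) F,
      ∫⁻ u in superdiagBall F (m + 1) (resCard F ^ c), ENNReal.ofReal
        (sigma ((u : GL (Fin (m + 1)) F) * g) ^ e *
          sph (permGL Fin.revPerm * ((u : GL (Fin (m + 1)) F) * g))) ∂μ ≤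
      ENNReal.ofReal (C * (c * sigma g) ^ (e + (m + 1) * (m + 1)) * sph g) := by
  obtain ⟨ε, hε, -, A, hA, h2⟩ := exists_setLIntegral_revMinors_le F m
  obtain ⟨C₁, hC₁, h1⟩ := exists_lintegral_revMinors_le F (m + 1) μ
  obtain ⟨C₂, hC₂, h2⟩ := h2 μ
  exact exists_setLIntegral_sph_le_of_bounds e μ hC₁ hC₂ hε hA h1 h2

variable (F) in
-- The left invariance of Ξ and σ under K inserts w before the bound for Ξ is applied; without w,
-- `sph (u * g) = sph g` would be constant in u and the bound would be useless.
theorem exists_setLIntegral_Xi_le (m : ℕ) (D : ℝ) : ∃ R : ℕ,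
    ∀ [MeasurableSpace (GL (Fin (m + 1)) F)] [BorelSpace (GL (Fin (m + 1)) F)]
      (μ : Measure (unipotent (m + 1) F)) [μ.IsHaarMeasure],
    ∃ C : ℝ, 0 ≤ C ∧ ∀ c : ℕ, 1 ≤ c → ∀ g : GL (Fin (m + 1)) F,
      ∫⁻ u in superdiagBall F (m + 1) (resCard F ^ c), ENNReal.ofReal
        (Xi ((u : GL (Fin (m + 1)) F) * g) * sigma ((u : GL (Fin (m + 1)) F) * g) ^ D) ∂μ ≤
      ENNReal.ofReal (C * (c * sigma g) ^ R * sph g) := by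
  obtain ⟨C₀, hC₀, d, hXi⟩ := exists_Xi_le F (m + 1)
  -- As σ ≥ 1, a real exponent, possibly negative, may be raised to a natural number.
  obtain ⟨D', hD'⟩ := exists_nat_ge D
  refine ⟨d + D' + (m + 1) * (m + 1), fun μ _ => ?_⟩
  obtain ⟨C, hC, h⟩ := exists_setLIntegral_sph_le F m (d + D') μ
  refine ⟨C₀ * C, by positivity, fun c hc g => ?_⟩
  have hpt : ∀ u : unipotent (m + 1) F, ENNReal.ofReal
      (Xi ((u : GL (Fin (m + 1)) F) * g) * sigma ((u : GL (Fin (m + 1)) F) * g) ^ D) ≤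
      ENNReal.ofReal C₀ * ENNReal.ofReal (sigma ((u : GL (Fin (m + 1)) F) * g) ^ (d + D') *
          sph (permGL Fin.revPerm * ((u : GL (Fin (m + 1)) F) * g))) := by
    intro u
    set x := (u : GL (Fin (m + 1)) F) * g
    rw [← ENNReal.ofReal_mul hC₀]
    refine ENNReal.ofReal_le_ofReal ?_
    have hw := permGL_mem (F := F) (Fin.revPerm (n := m + 1))
    have h1 := hXi (permGL Fin.revPerm * x)
    rw [Xi_mem_mul _ hw, sigma_mem_mul _ hw] at h1
    have h2 : sigma x ^ D ≤ sigma x ^ D' := by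
      rw [← Real.rpow_natCast]
      exact Real.rpow_le_rpow_of_exponent_le (one_le_sigma x) hD'
    have hσ := (sigma_pos x).le
    calc Xi x * sigma x ^ D ≤ (C₀ * sigma x ^ d * sph (permGL Fin.revPerm * x)) * sigma x ^ D' :=
          mul_le_mul h1 h2 (Real.rpow_nonneg hσ _) ((Xi_nonneg x).trans h1)
      _ = _ := by rw [pow_add]; ring
  refine (lintegral_mono hpt).trans ?_
  have hcont : Continuous fun u : unipotent (m + 1) F =>
      sigma ((u : GL (Fin (m + 1)) F) * g) ^ (d + D') *
        sph (permGL Fin.revPerm * ((u : GL (Fin (m + 1)) F) * g)) := by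
    have h1 : Continuous fun u : unipotent (m + 1) F => (u : GL (Fin (m + 1)) F) * g :=
      continuous_subtype_val.mul continuous_const
    exact ((continuous_sigma.comp h1).pow _).mul (continuous_sph.comp (continuous_const.mul h1))
  rw [lintegral_const_mul _ hcont.measurable.ennreal_ofReal]
  refine (mul_le_mul_right (h c hc g) _).trans ?_
  rw [← ENNReal.ofReal_mul hC₀]
  exact ENNReal.ofReal_le_ofReal (le_of_eq (by ring))

lemma coe_unipotentBounded (c : ℕ) :
    (unipotentBounded k F c : Set (unipotent k F)) = superdiagBall F k (resCard F ^ c) := by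
  ext u
  change (∀ i j : Fin k, (i : ℕ) + 1 = j →
    ((-(c : ℤ) : ℤ) : WithTop ℤ) ≤ val ((u : GL (Fin k) F) i j)) ↔
    ∀ i j : Fin k, (i : ℕ) + 1 = j → absF ((u : GL (Fin k) F) i j) ≤ resCard F ^ c
  simp only [val_ge_iff]

variable {m : ℕ} [MeasurableSpace (GL (Fin (m + 1)) F)] [BorelSpace (GL (Fin (m + 1)) F)]

lemma continuous_Xi_mul_sigma_rpow (D : ℝ) (g : GL (Fin (m + 1)) F) :
    Continuous fun u : unipotent (m + 1) F =>
      Xi ((u : GL (Fin (m + 1)) F) * g) * sigma ((u : GL (Fin (m + 1)) F) * g) ^ D := by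
  have h1 : Continuous fun u : unipotent (m + 1) F => (u : GL (Fin (m + 1)) F) * g :=
    continuous_subtype_val.mul continuous_const
  exact (continuous_Xi.comp h1).mul ((continuous_sigma.comp h1).rpow_const fun _ =>
    Or.inl (sigma_pos _).ne')

lemma Xi_mul_sigma_rpow_nonneg (D : ℝ) (g : GL (Fin (m + 1)) F) : 0 ≤ Xi g * sigma g ^ D :=
  mul_nonneg (Xi_nonneg _) (Real.rpow_nonneg (sigma_pos _).le _)

theorem integrableOn_Xi_mul_sigma_rpow (D : ℝ) (μ : Measure (unipotent (m + 1) F))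
    [μ.IsHaarMeasure] {c : ℕ} (hc : 1 ≤ c) (g : GL (Fin (m + 1)) F) :
    IntegrableOn (fun u : unipotent (m + 1) F =>
      Xi ((u : GL (Fin (m + 1)) F) * g) * sigma ((u : GL (Fin (m + 1)) F) * g) ^ D)
      (unipotentBounded (m + 1) F c) μ := by
  obtain ⟨R, hR⟩ := exists_setLIntegral_Xi_le F m D
  obtain ⟨C, hC, h⟩ := hR μ
  refine ⟨(continuous_Xi_mul_sigma_rpow D g).aestronglyMeasurable, ?_⟩
  rw [hasFiniteIntegral_iff_ofReal
    (Filter.Eventually.of_forall fun _ => Xi_mul_sigma_rpow_nonneg D _), coe_unipotentBounded]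
  exact (h c hc g).trans_lt ENNReal.ofReal_lt_top

variable (F m) in
theorem exists_setIntegral_Xi_mul_sigma_rpow_le (D : ℝ) : ∃ R : ℝ,
    ∀ (μ : Measure (unipotent (m + 1) F)) [μ.IsHaarMeasure],
      ∃ C : ℝ, 0 < C ∧ ∀ (c : ℕ) (_ : 1 ≤ c) (g : GL (Fin (m + 1)) F),
        ∫ u in unipotentBounded (m + 1) F c, Xi ((u : GL (Fin (m + 1)) F) * g) *
            sigma ((u : GL (Fin (m + 1)) F) * g) ^ D ∂μ ≤
          C * (c : ℝ) ^ R * sigma g ^ R * Real.sqrt (modulus (torusPart g)) := by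
  obtain ⟨R, hR⟩ := exists_setLIntegral_Xi_le F m D
  refine ⟨R, fun μ _ => ?_⟩
  obtain ⟨C, hC, h⟩ := hR μ
  -- C is only known to be nonnegative, while the constant must be positive.
  refine ⟨C + 1, by linarith, fun c hc g => ?_⟩
  have hσ := (sigma_pos g).le
  have hsph := (sph_pos g).le
  have h1 : C * (c * sigma g) ^ R * sph g ≤
      (C + 1) * (c : ℝ) ^ (R : ℝ) * sigma g ^ (R : ℝ) * sph g := by
    rw [Real.rpow_natCast, Real.rpow_natCast, mul_pow, mul_assoc (C + 1)]
    gcongr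
    linarith
  rw [sqrt_modulus_torusPart, integral_eq_lintegral_of_nonneg_ae
    (Filter.Eventually.of_forall fun _ => Xi_mul_sigma_rpow_nonneg D _)
    (continuous_Xi_mul_sigma_rpow D g).aestronglyMeasurable, coe_unipotentBounded]
  exact ENNReal.toReal_le_of_le_ofReal (by positivity)
    ((h c hc g).trans (ENNReal.ofReal_le_ofReal h1))

end Estimate

end HarishChandra

theorem proposition3p2 {F : Type*} [Field F] [CharZero F] [ValuativeRel F] [TopologicalSpace F]
    [IsNonarchimedeanLocalField F] (k : ℕ) (hk : 1 ≤ k)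
    [MeasurableSpace (GL (Fin k) F)] [BorelSpace (GL (Fin k) F)] :
    (∀ (D : ℝ) (μ : Measure (HarishChandra.unipotent k F)) [μ.IsHaarMeasure]
      (c : ℕ) (_ : 1 ≤ c) (g : GL (Fin k) F),
      IntegrableOn (fun u : HarishChandra.unipotent k F =>
          HarishChandra.Xi ((u : GL (Fin k) F) * g) *
            HarishChandra.sigma ((u : GL (Fin k) F) * g) ^ D)
        (HarishChandra.unipotentBounded k F c) μ) ∧
    ∀ D : ℝ, ∃ R : ℝ, ∀ (μ : Measure (HarishChandra.unipotent k F)) [μ.IsHaarMeasure],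
      ∃ C : ℝ, 0 < C ∧ ∀ (c : ℕ) (_ : 1 ≤ c) (g : GL (Fin k) F),
        ∫ u in HarishChandra.unipotentBounded k F c,
            HarishChandra.Xi ((u : GL (Fin k) F) * g) *
              HarishChandra.sigma ((u : GL (Fin k) F) * g) ^ D ∂μ ≤
          C * (c : ℝ) ^ R * HarishChandra.sigma g ^ R *
            Real.sqrt (HarishChandra.modulus (HarishChandra.torusPart g)) := by
  obtain ⟨m, rfl⟩ : ∃ m, k = m + 1 := ⟨k - 1, by omega⟩
  exact ⟨fun D μ _ _ hc g => HarishChandra.integrableOn_Xi_mul_sigma_rpow D μ hc g,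
    HarishChandra.exists_setIntegral_Xi_mul_sigma_rpow_le F m⟩
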